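/- **Theorem (strong extension axiom for $\sigma$ and $\lambda$).** Let $X$ be a connected finite simplicial complex of dimension $n$, let $\pi$ be a group and let $\phi:\pi_1(X)\to\pi$ be a homomorphism (not necessarily surjective). Let $(X',\phi')$ be an extension of $(X,\phi)$. Then $$\sigma_{\phi'}(X')=\sigma_\phi(X)\qquad\text{and}\qquad \lambda_{\phi'}(X')=\lambda_\phi(X).$$ Here the following definitions are used. *Metrics.* A Riemannian metric $g$ on a finite simplicial complex consists of a smooth Riemannian metric on each closed simplex such that the metric of a simplex restricts to the metric of each of its faces. $\operatorname{Vol}$ denotes the $n$-dimensional Riemannian volume. *Systolic constant.* $\operatorname{sys}_\phi(X,g)\in(0,\infty]$ is the infimum of the lengths of the closed piecewise smooth curves in $X$ whose images under the map $X\to K(\pi,1)$ corresponding to $\phi$ are non-contractible (so it is $\infty$ if there are no such curves), and $$\sigma_\phi(X):=\inf_g \frac{\operatorname{Vol}(X,g)}{\operatorname{sys}_\phi(X,g)^n},$$ where the infimum is over all Riemannian metrics $g$ on $X$ and the quotient is $0$ if the systole is infinite and $n\ge1$. *Minimal volume entropy.* Let $\tilde X_\phi$ be the Galois covering of $X$ associated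 to $\ker\phi\lhd\pi_1(X)$. Then $$\lambda_\phi(X,g):=\lim_{r\to\infty}\tfrac1r\log\operatorname{Vol}(B(x,r)),\qquad \lambda_\phi(X):=\inf_g\lambda_\phi(X,g)\operatorname{Vol}(X,g)^{1/n},$$ where $B(x,r)$ is the ball of radius $r$ around a point $x\in\tilde X_\phi$ with respect to the lifted metric (the limit exists and is independent of $x$). *Extensions.* A one-cell extension of $(X,\phi)$ is a pair $(X',\phi')$ of the following form: $X'=X\cup_h D^k$ with $1\le k<n$ and $h:S^{k-1}\to X$ a simplicial map, where $X'$ is a finite simplicial complex that contains $X$ as a subcomplex; and $\phi':\pi_1(X')\to\pi$ is a homomorphism with $\phi'\circ i_*=\phi$ for the inclusion $i:X\hookrightarrow X'$. (For $k=1$, $\phi'$ is an arbitrary extension of $\phi$; for $k=2$, such a $\phi'$ exists exactly if $h$ becomes contractible in $K(\pi,1)$, and it is then unique; for $k\ge3$, $\phi'$ is $\phi$.) An extension of $(X,\phi)$ is obtained by finitely many such attachments. -/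

import Mathlib

open Set Filter Topology
open scoped ENNReal ContDiff unitInterval

noncomputable section

namespace SystolicEntropy

open Geometry (SimplicialComplex)

variable {E : Type*} [NormedAddCommGroup E] [NormedSpace ℝ E]

/-! ### Riemannian metrics on simplicial complexes -/

/-- A (continuous, piecewise smooth) Riemannian metric on a simplicial complex: on every closed
simplex `s` a Riemannian metric `form s`, smooth up to the boundary, such that the metric of a
simplex restricts to the metric of each of its faces. The tangent space of a simplex is
`vectorSpan ℝ s`; the values of `form s` outside the simplex or on other vectors are irrelevant. -/
structure RiemannianMetric (K : SimplicialComplex ℝ E) where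
  form : Finset E → E → E →L[ℝ] E →L[ℝ] ℝ
  smooth : ∀ s ∈ K.faces, ContDiffOn ℝ ∞ (form s) (convexHull ℝ (s : Set E))
  symm : ∀ s ∈ K.faces, ∀ x ∈ convexHull ℝ (s : Set E),
    ∀ v ∈ vectorSpan ℝ (s : Set E), ∀ w ∈ vectorSpan ℝ (s : Set E),
      form s x v w = form s x w v
  pos : ∀ s ∈ K.faces, ∀ x ∈ convexHull ℝ (s : Set E),
    ∀ v ∈ vectorSpan ℝ (s : Set E), v ≠ 0 → 0 < form s x v v
  compat : ∀ s ∈ K.faces, ∀ t ∈ K.faces, t ⊆ s → ∀ x ∈ convexHull ℝ (t : Set E),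
    ∀ v ∈ vectorSpan ℝ (t : Set E), ∀ w ∈ vectorSpan ℝ (t : Set E),
      form s x v w = form t x v w

/-! ### Volume -/

/-- The corner simplex `{t ∈ ℝⁿ | tᵢ ≥ 0, ∑ tᵢ ≤ 1}`. -/
def cornerSimplex (n : ℕ) : Set (Fin n → ℝ) :=
  {t | (∀ i, 0 ≤ t i) ∧ ∑ i, t i ≤ 1}

/-- An enumeration of the vertices of an `n`-simplex. -/
def vertex {n : ℕ} (s : Finset E) (hs : s.card = n + 1) (i : Fin (n + 1)) : E :=
  ((s.equivFinOfCardEq hs).symm i : E)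

/-- The edge vectors of an `n`-simplex at its zeroth vertex. -/
def edge {n : ℕ} (s : Finset E) (hs : s.card = n + 1) (i : Fin n) : E :=
  vertex s hs i.succ - vertex s hs 0

/-- The affine parametrization of an `n`-simplex by the corner simplex. -/
def chart {n : ℕ} (s : Finset E) (hs : s.card = n + 1) (t : Fin n → ℝ) : E :=
  vertex s hs 0 + ∑ i, t i • edge s hs i

variable {K : SimplicialComplex ℝ E}

/-- The integral of `f` over `(K, g)` with respect to the `n`-dimensional Riemannian volume, i.e.
the sum over the `n`-simplices of the integrals of `f √(det gᵢⱼ)` in affine coordinates. -/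
def RiemannianMetric.volIntegral (g : RiemannianMetric K) (n : ℕ) (f : E → ℝ≥0∞) : ℝ≥0∞ :=
  ∑' s : {s : Finset E // s ∈ K.faces ∧ s.card = n + 1},
    ∫⁻ t in cornerSimplex n, f (chart s.1 s.2.2 t) *
      ENNReal.ofReal (Real.sqrt (Matrix.det (Matrix.of fun i j : Fin n =>
        g.form s.1 (chart s.1 s.2.2 t) (edge s.1 s.2.2 i) (edge s.1 s.2.2 j))))

/-- The `n`-dimensional Riemannian volume of `(K, g)`. -/
def RiemannianMetric.vol (g : RiemannianMetric K) (n : ℕ) : ℝ≥0∞ :=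
  g.volIntegral n fun _ => 1

/-! ### Piecewise smooth curves and their lengths -/

/-- The piecewise smooth structure of a curve in `|K|`: a subdivision of `[0, 1]` into finitely many
closed intervals, each of which is mapped smoothly to one closed simplex. -/
structure SmoothPieces {x y : K.space} (γ : Path x y) where
  num : ℕ
  time : ℕ → ℝ
  time_zero : time 0 = 0
  time_num : time num = 1
  mono : Monotone time
  face : ℕ → Finset E
  face_mem : ∀ i < num, face i ∈ K.faces
  maps : ∀ i < num, ∀ u ∈ Icc (time i) (time (i + 1)),
    (γ.extend u : E) ∈ convexHull ℝ (face i : Set E)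
  smooth : ∀ i < num, ContDiffOn ℝ ∞ (fun u => (γ.extend u : E)) (Icc (time i) (time (i + 1)))

/-- The length `∫ √g(γ', γ')` of a piecewise smooth curve. By the compatibility of the metrics on
the simplices it does not depend on the chosen subdivision. -/
def RiemannianMetric.length (g : RiemannianMetric K) {x y : K.space} {γ : Path x y}
    (P : SmoothPieces γ) : ℝ≥0∞ :=
  ∑ i ∈ Finset.range P.num, ∫⁻ u in Icc (P.time i) (P.time (i + 1)),
    ENNReal.ofReal (Real.sqrt (g.form (P.face i) (γ.extend u)
      (deriv (fun u => (γ.extend u : E)) u) (deriv (fun u => (γ.extend u : E)) u)))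

/-! ### The systolic constant -/

section Marked

variable {π : Type*} [Group π] {x₀ : K.space}

/-- The image under `φ` of the class of a loop at the base point. -/
def loopClass (φ : FundamentalGroup K.space x₀ →* π) (γ : Path x₀ x₀) : π :=
  φ (FundamentalGroup.fromPath (Path.Homotopic.Quotient.mk γ))

/-- A closed curve is `φ`-noncontractible, i.e. noncontractible in `K(π, 1)`, if, connected to the
base point by some path (equivalently, by any path), it gives a loop outside `ker φ`. -/
def Noncontractible (φ : FundamentalGroup K.space x₀ →* π) {y : K.space} (γ : Path y y) : Prop :=
  ∃ p : Path x₀ y, loopClass φ ((p.trans γ).trans p.symm) ≠ 1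

/-- The `φ`-systole: the infimum (`∞` if there are none) of the lengths of the `φ`-noncontractible
piecewise smooth closed curves. -/
def systole (φ : FundamentalGroup K.space x₀ →* π) (g : RiemannianMetric K) : ℝ≥0∞ :=
  ⨅ (y : K.space) (γ : Path y y) (_ : Noncontractible φ γ) (P : SmoothPieces γ), g.length P

/-- The systolic constant relative to `φ` of an `n`-dimensional complex. If the systole is infinite
(trivial `φ`), the quotient is `0`. -/
def systolicConstant (n : ℕ) (φ : FundamentalGroup K.space x₀ →* π) : ℝ≥0∞ :=
  ⨅ g : RiemannianMetric K, g.vol n / systole φ g ^ n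

/-! ### The Galois covering and the minimal volume entropy -/

/-- Two paths from the base point with the same end point define the same point of the Galois
covering associated to `ker φ` if their difference lies in `ker φ`. -/
def coverSetoid (φ : FundamentalGroup K.space x₀ →* π) (y : K.space) : Setoid (Path x₀ y) where
  r p q := loopClass φ (p.trans q.symm) = 1
  iseqv := by
    have key : ∀ p q r : Path x₀ y, loopClass φ (p.trans r.symm) =
        loopClass φ (q.trans r.symm) * loopClass φ (p.trans q.symm) := by
      intro p q r
      rw [loopClass, loopClass, loopClass, ← map_mul, FundamentalGroup.mul_def]
      congr 1
      change _ = Path.Homotopic.Quotient.trans (Path.Homotopic.Quotient.mk (p.trans q.symm))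
        (Path.Homotopic.Quotient.mk (q.trans r.symm))
      change Path.Homotopic.Quotient.mk (p.trans r.symm) = _
      simp only [Path.Homotopic.Quotient.mk_trans, Path.Homotopic.Quotient.mk_symm]
      rw [Path.Homotopic.Quotient.trans_assoc,
        ← Path.Homotopic.Quotient.trans_assoc (Path.Homotopic.Quotient.mk q).symm,
        Path.Homotopic.Quotient.symm_trans, Path.Homotopic.Quotient.refl_trans]
    have hr : ∀ p : Path x₀ y, loopClass φ (p.trans p.symm) = 1 := by
      intro p
      have := key p p p
      simpa using this
    refine ⟨hr, fun {p q} h => ?_, fun {p q r} h h' => ?_⟩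
    · have := key p q p
      rw [hr, h, mul_one] at this
      exact this.symm
    · rw [key p q r, h, h', one_mul]

/-- The Galois covering of `|K|` associated to `ker φ`, with covering projection `Sigma.fst`: a
point over `y` is a class of paths from the base point to `y`. -/
def GaloisCover (φ : FundamentalGroup K.space x₀ →* π) : Type _ :=
  Σ y : K.space, Quotient (coverSetoid φ y)

/-- The point of the Galois covering given by a path from the base point. -/
def GaloisCover.mk (φ : FundamentalGroup K.space x₀ →* π) {y : K.space} (p : Path x₀ y) :
    GaloisCover φ :=
  ⟨y, Quotient.mk (coverSetoid φ y) p⟩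

/-- The open ball of radius `r` around `c` in the Galois covering with respect to the lifted metric:
the end points of the lifts starting at `c` of the piecewise smooth curves of length less than `r`.
(The lift of `γ` that starts at the class of `p` ends at the class of `p · γ`.) -/
def GaloisCover.ball {φ : FundamentalGroup K.space x₀ →* π} (g : RiemannianMetric K)
    (c : GaloisCover φ) (r : ℝ) : Set (GaloisCover φ) :=
  {q | ∃ (y z : K.space) (p : Path x₀ y) (γ : Path y z) (P : SmoothPieces γ),
    c = GaloisCover.mk φ p ∧ q = GaloisCover.mk φ (p.trans γ) ∧ g.length P < ENNReal.ofReal r}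

/-- The `n`-dimensional volume of a subset of the Galois covering with respect to the lifted metric.
As the projection is a local isometry, it is the integral over `|K|` of the number of points of the
subset in the fibre. -/
def GaloisCover.vol {φ : FundamentalGroup K.space x₀ →* π} (g : RiemannianMetric K) (n : ℕ)
    (A : Set (GaloisCover φ)) : ℝ≥0∞ :=
  g.volIntegral n fun x => (({a ∈ A | (a.1 : E) = x}.encard : ℕ∞) : ℝ≥0∞)

/-- The volume entropy of `(K, g)` relative to `φ`: the exponential growth rate of the volumes of
the balls around a point of the Galois covering. The limit exists and does not depend on the centre;
the upper limit makes the definition total, and the centre is the base point of the covering. -/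
def volumeEntropy (n : ℕ) (φ : FundamentalGroup K.space x₀ →* π) (g : RiemannianMetric K) : EReal :=
  limsup (fun r : ℝ => ENNReal.log
    (GaloisCover.vol g n (GaloisCover.ball g (GaloisCover.mk φ (Path.refl x₀)) r)) / (r : EReal))
    atTop

/-- The minimal volume entropy relative to `φ` of an `n`-dimensional complex. -/
def minimalVolumeEntropy (n : ℕ) (φ : FundamentalGroup K.space x₀ →* π) : ℝ≥0∞ :=
  ⨅ g : RiemannianMetric K, (volumeEntropy n φ g).toENNReal * g.vol n ^ (1 / (n : ℝ))

end Marked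

/-! ### Extensions -/

/-- `K` is a simplicial complex of dimension `n`. -/
def HasDimension (K : SimplicialComplex ℝ E) (n : ℕ) : Prop :=
  (∃ s ∈ K.faces, s.card = n + 1) ∧ ∀ s ∈ K.faces, s.card ≤ n + 1

/-- The map `f : |T| → |K|` is simplicial: it maps every simplex of `T` affinely onto a simplex
of `K`. -/
def IsSimplicialMap {F : Type*} [NormedAddCommGroup F] [NormedSpace ℝ F]
    (T : SimplicialComplex ℝ F) (K : SimplicialComplex ℝ E) (f : T.space → E) : Prop :=
  ∀ s ∈ T.faces, ∃ A : F →ᵃ[ℝ] E,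
    (∃ t ∈ K.faces, (t : Set E) = A '' (s : Set F)) ∧
      ∀ x : T.space, (x : F) ∈ convexHull ℝ (s : Set F) → f x = A x

/-- `L` is a finite simplicial complex that contains `K` as a subcomplex and that arises from `K` by
attaching a `k`-cell along a simplicial map `h : S^{k-1} → |K|`, i.e. `|L| = |K| ∪_h D^k`. The map
`χ` is the characteristic map of the cell, and `T` is the triangulation of the sphere with respect
to which `h` (the restriction of `χ`) is simplicial. -/
structure IsCellAttachment (K L : SimplicialComplex ℝ E) (k : ℕ) : Prop where
  finite : L.faces.Finite
  le : K.faces ⊆ L.faces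
  card_le : ∀ s ∈ L.faces, s ∉ K.faces → s.card ≤ k + 1
  exists_cell : ∃ χ : EuclideanSpace ℝ (Fin k) → E,
    ContinuousOn χ (Metric.closedBall 0 1) ∧
    BijOn χ (Metric.ball 0 1) (L.space \ K.space) ∧
    ∃ (m : ℕ) (T : SimplicialComplex ℝ (EuclideanSpace ℝ (Fin m))), T.faces.Finite ∧
      ∃ e : T.space ≃ₜ Metric.sphere (0 : EuclideanSpace ℝ (Fin k)) 1,
        IsSimplicialMap T K fun x => χ (e x)

/-- A simplicial complex containing the point `b`, together with a homomorphism from the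
fundamental group based at `b` to `π`. -/
structure MarkedComplex (b : E) (π : Type*) [Group π] where
  cx : SimplicialComplex ℝ E
  base_mem : b ∈ cx.space
  hom : FundamentalGroup cx.space ⟨b, base_mem⟩ →* π

variable {b : E} {π : Type*} [Group π]

theorem space_mono {K L : SimplicialComplex ℝ E} (h : K.faces ⊆ L.faces) : K.space ⊆ L.space :=
  biUnion_subset_biUnion_left h

/-- The inclusion of a subcomplex. -/
def inclusionMap {K L : SimplicialComplex ℝ E} (h : K.faces ⊆ L.faces) : C(K.space, L.space) :=
  ⟨Set.inclusion (space_mono h), continuous_inclusion (space_mono h)⟩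

/-- `(L, ψ)` arises from `(K, φ)` by attaching one cell of dimension `1 ≤ k < n`, where
`ψ ∘ i_* = φ` for the inclusion `i`. For `k = 1` this says that `ψ` is an arbitrary extension of
`φ`; for `k ≥ 2` it determines `ψ`, as `i_*` is surjective, and for `k = 2` it is possible only if
the attaching circle is `φ`-contractible. -/
def IsOneCellExtension (n : ℕ) (X Y : MarkedComplex b π) : Prop :=
  ∃ k : ℕ, 1 ≤ k ∧ k < n ∧ IsCellAttachment X.cx Y.cx k ∧
    ∃ h : X.cx.faces ⊆ Y.cx.faces,
      X.hom = Y.hom.comp (FundamentalGroup.map (inclusionMap h) ⟨b, X.base_mem⟩)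

/-- An extension arises by finitely many attachments of cells of dimensions `1 ≤ k < n`. -/
def IsExtension (n : ℕ) : MarkedComplex b π → MarkedComplex b π → Prop :=
  Relation.ReflTransGen (IsOneCellExtension n)

end SystolicEntropy

end

noncomputable section

namespace SystolicEntropy

open Geometry (SimplicialComplex)

variable {E : Type*} [NormedAddCommGroup E] [NormedSpace ℝ E]

/-! ### Barycentric coordinates -/

/-! An extension adds only simplices of dimension less than `n`. They carry no `n`-dimensional
volume, so they can matter only through the shortcuts they offer. Restricting a metric from the
larger complex `L` to the smaller `K` keeps the volume, does not decrease the systole, and maps the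
balls of the covering of `K` injectively into those of the covering of `L` (`systole_le_restrict`,
`volumeEntropy_restrict_le`). This gives one inequality for each constant.

For the other, let `g` be a metric on `K`. In `exists_metric_extension` it is blended, near the
boundaries of the `n`-simplices, into a huge constant form, which is also used on all simplices of
lower dimension. The new metric dominates `g` on `K` and `Λ² ‖·‖²` on the simplices outside `K`,
with `Λ` as large as desired, and the volume increases arbitrarily little.

A curve in `L` then costs at least as much as a chain of curves in `K`, measured by `g`, and of
chords, measured by `Λ` times the norm (`exists_chain`). Chords of total norm at most `2δ` stay in
the open star of a vertex; hence they have one of finitely many labels in `π`, and if their ends lie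
in `K`, a curve in `K` of length at most `Λ₀` times that norm can replace them
(`exists_isControlled`). Here `δ` and `Λ₀` do not depend on `Λ`. So for `Λ ≥ Λ₀` an excursion from
`K` is either replaceable at no loss or costs at least `Λδ` (`Chain.exists_settled`).

Systole: a noncontractible closed curve shorter than `Λδ` can be moved into `K` without becoming
longer (`min_systole_le`). Entropy: the label of a curve is a word in labels of curves in `K`,
separated by pairs from a finite set, and every pair costs `D = Λδ`. The labels of curves in `K`
grow at any rate above the entropy of `g` (`exists_cardLE_loopClass`), for large `D` the words grow
hardly faster (`exists_cardLE_word`), and words bound the fibres of balls (`vol_ball_le`). Both are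
combined in `exists_extension_metric`; the constants agree in the limit. -/

theorem exists_affineMap_eq_ite [FiniteDimensional ℝ E] {s : Finset E}
    (hs : AffineIndependent ℝ ((↑) : s → E)) (v : E) :
    ∃ A : E →ᵃ[ℝ] ℝ, ∀ w ∈ s, A w = Set.indicator {v} 1 w := by
  classical
  by_cases hv : v ∈ s
  -- The vertices are completed to an affine basis of `E`; its coordinate at `v` does it.
  · obtain ⟨t, hst, ht, htop⟩ := exists_subset_affineIndependent_affineSpan_eq_top
      (k := ℝ) (s := (s : Set E)) hs
    let B : AffineBasis t ℝ E := ⟨(↑), ht, by simpa using htop⟩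
    refine ⟨B.coord ⟨v, hst hv⟩, fun w hw => ?_⟩
    have := B.coord_apply ⟨v, hst hv⟩ ⟨w, hst hw⟩
    change B.coord ⟨v, hst hv⟩ w = _ at this
    rw [this]
    by_cases h : w = v
    · simp [h]
    · simp [h, Ne.symm h]
  · refine ⟨0, fun w hw => ?_⟩
    have : w ≠ v := fun h => hv (h ▸ hw)
    simp [this]

/-- An affine function that restricts on the simplex `s` to the barycentric coordinate of `v`. -/
def simplexCoord (s : Finset E) (v : E) : E →ᵃ[ℝ] ℝ :=
  open Classical in
  if h : ∃ A : E →ᵃ[ℝ] ℝ, ∀ w ∈ s, A w = Set.indicator {v} 1 w then h.choose else 0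

theorem simplexCoord_apply [FiniteDimensional ℝ E] {s : Finset E}
    (hs : AffineIndependent ℝ ((↑) : s → E)) (v : E) {w : E} (hw : w ∈ s) :
    simplexCoord s v w = Set.indicator {v} 1 w := by
  have h := exists_affineMap_eq_ite hs v
  rw [simplexCoord, dif_pos h]
  exact h.choose_spec w hw

theorem affineMap_sum_smul (A : E →ᵃ[ℝ] ℝ) (s : Finset E) {c : E → ℝ} (hc : ∑ y ∈ s, c y = 1) :
    A (∑ y ∈ s, c y • y) = ∑ y ∈ s, c y * A y := by
  have h : ∀ x, A x = A.linear x + A 0 := fun x => congrFun (AffineMap.decomp A) x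
  calc A (∑ y ∈ s, c y • y) = ∑ y ∈ s, c y * A.linear y + (∑ y ∈ s, c y) * A 0 := by
        rw [h, map_sum, hc, one_mul]
        simp
    _ = ∑ y ∈ s, c y * A y := by
        rw [Finset.sum_mul, ← Finset.sum_add_distrib]
        exact Finset.sum_congr rfl fun y _ => by rw [h y, mul_add]

section

variable [FiniteDimensional ℝ E] {s : Finset E}

theorem simplexCoord_sum_smul (hs : AffineIndependent ℝ ((↑) : s → E)) {t : Finset E} (hts : t ⊆ s)
    {c : E → ℝ} (hc : ∑ y ∈ t, c y = 1) (v : E) :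
    simplexCoord s v (∑ y ∈ t, c y • y) = Set.indicator (t : Set E) c v := by
  classical
  rw [affineMap_sum_smul _ _ hc]
  by_cases hv : v ∈ t
  · rw [Set.indicator_of_mem (by exact_mod_cast hv), Finset.sum_eq_single_of_mem v hv]
    · simp [simplexCoord_apply hs v (hts hv)]
    · intro w hw hwv
      simp [simplexCoord_apply hs v (hts hw), hwv]
  · rw [Set.indicator_of_notMem (by exact_mod_cast hv)]
    refine Finset.sum_eq_zero fun w hw => ?_
    have : w ≠ v := fun h => hv (h ▸ hw)
    simp [simplexCoord_apply hs v (hts hw), this]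

theorem simplexCoord_of_convexHull (hs : AffineIndependent ℝ ((↑) : s → E)) {x : E}
    (hx : x ∈ convexHull ℝ (s : Set E)) :
    (∀ v, 0 ≤ simplexCoord s v x) ∧ (∀ v, v ∉ s → simplexCoord s v x = 0) ∧
      ∑ v ∈ s, simplexCoord s v x = 1 ∧ ∑ v ∈ s, simplexCoord s v x • v = x := by
  obtain ⟨c, h0, h1, rfl⟩ := Finset.mem_convexHull'.1 hx
  have key := simplexCoord_sum_smul hs subset_rfl h1
  simp_rw [key]
  refine ⟨fun v => Set.indicator_apply_nonneg fun h => h0 v (by exact_mod_cast h), fun v hv =>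
    Set.indicator_of_notMem (by exact_mod_cast hv) _, ?_, ?_⟩
  · rw [← h1]
    exact Finset.sum_congr rfl fun v hv => Set.indicator_of_mem (by exact_mod_cast hv) _
  · exact Finset.sum_congr rfl fun v hv => by
      rw [Set.indicator_of_mem (by exact_mod_cast hv)]

theorem simplexCoord_eq_zero_of_face (hs : AffineIndependent ℝ ((↑) : s → E)) {t : Finset E}
    (hts : t ⊆ s) {x : E} (hx : x ∈ convexHull ℝ (t : Set E)) {v : E} (hv : v ∉ t) :
    simplexCoord s v x = 0 := by
  obtain ⟨c, h0, h1, rfl⟩ := Finset.mem_convexHull'.1 hx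
  rw [simplexCoord_sum_smul hs hts h1]
  exact Set.indicator_of_notMem (by exact_mod_cast hv) _

theorem contDiff_simplexCoord (s : Finset E) (v : E) : ContDiff ℝ ∞ (simplexCoord s v) := by
  rw [show (simplexCoord s v : E → ℝ) = fun x => (simplexCoord s v).linear x + simplexCoord s v 0
    from AffineMap.decomp _]
  exact ((simplexCoord s v).linear.toContinuousLinearMap.contDiff).add contDiff_const

theorem exists_abs_simplexCoord_sub_le (s : Finset E) (v : E) :
    ∃ C : ℝ, ∀ x y, |simplexCoord s v x - simplexCoord s v y| ≤ C * ‖x - y‖ := by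
  refine ⟨‖(simplexCoord s v).linear.toContinuousLinearMap‖, fun x y => ?_⟩
  have : simplexCoord s v x - simplexCoord s v y =
      (simplexCoord s v).linear.toContinuousLinearMap (x - y) := by
    have h := (simplexCoord s v).linearMap_vsub x y
    simpa using h.symm
  rw [this, ← Real.norm_eq_abs]
  exact ContinuousLinearMap.le_opNorm _ _

end

/-- The barycentric coordinate of a vertex `v` on a simplicial complex. -/
def bary (K : SimplicialComplex ℝ E) (v x : E) : ℝ :=
  open Classical in
  if h : ∃ s ∈ K.faces, x ∈ convexHull ℝ (s : Set E) then simplexCoord h.choose v x else 0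

section

variable [FiniteDimensional ℝ E] {K : SimplicialComplex ℝ E} {s : Finset E} {x v : E}

/-- Two simplices meet in the hull of their common vertices, where both coordinate functions read
off the same coefficients. -/
theorem bary_eq (hs : s ∈ K.faces) (hx : x ∈ convexHull ℝ (s : Set E)) (v : E) :
    bary K v x = simplexCoord s v x := by
  classical
  have h : ∃ s ∈ K.faces, x ∈ convexHull ℝ (s : Set E) := ⟨s, hs, hx⟩
  rw [bary, dif_pos h]
  suffices key : ∀ t ∈ K.faces, x ∈ convexHull ℝ (t : Set E) →
      simplexCoord t v x = simplexCoord s v x from key _ h.choose_spec.1 h.choose_spec.2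
  intro t ht hxt
  have hst : x ∈ convexHull ℝ ((s ∩ t : Finset E) : Set E) := by
    have := K.inter_subset_convexHull hs ht ⟨hx, hxt⟩
    simpa using this
  obtain ⟨c, -, h1, rfl⟩ := Finset.mem_convexHull'.1 hst
  rw [simplexCoord_sum_smul (K.indep ht) Finset.inter_subset_right h1,
    simplexCoord_sum_smul (K.indep hs) Finset.inter_subset_left h1]

theorem bary_nonneg (hx : x ∈ K.space) (v : E) : 0 ≤ bary K v x := by
  obtain ⟨s, hs, hxs⟩ := SimplicialComplex.mem_space_iff.1 hx
  rw [bary_eq hs hxs]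
  exact (simplexCoord_of_convexHull (K.indep hs) hxs).1 v

theorem mem_of_bary_pos (hs : s ∈ K.faces) (hx : x ∈ convexHull ℝ (s : Set E))
    (hv : 0 < bary K v x) : v ∈ s := by
  by_contra h
  rw [bary_eq hs hx, (simplexCoord_of_convexHull (K.indep hs) hx).2.1 v h] at hv
  exact lt_irrefl _ hv

theorem sum_bary (hs : s ∈ K.faces) (hx : x ∈ convexHull ℝ (s : Set E)) :
    ∑ v ∈ s, bary K v x = 1 := by
  simp_rw [bary_eq hs hx]
  exact (simplexCoord_of_convexHull (K.indep hs) hx).2.2.1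

theorem sum_bary_smul (hs : s ∈ K.faces) (hx : x ∈ convexHull ℝ (s : Set E)) :
    ∑ v ∈ s, bary K v x • v = x := by
  simp_rw [bary_eq hs hx]
  exact (simplexCoord_of_convexHull (K.indep hs) hx).2.2.2

theorem bary_vertex (hs : s ∈ K.faces) (hx : x ∈ s) (v : E) :
    bary K v x = Set.indicator {v} 1 x := by
  rw [bary_eq hs (subset_convexHull ℝ _ (by exact_mod_cast hx)), simplexCoord_apply (K.indep hs) v hx]

/-- Only finitely many pairs of a simplex and one of its vertices matter, as the coordinates of all
other points vanish on the simplex. -/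
theorem exists_abs_bary_sub_le (hfin : K.faces.Finite) :
    ∃ C : ℝ, 0 < C ∧ ∀ s ∈ K.faces, ∀ x ∈ convexHull ℝ (s : Set E),
      ∀ y ∈ convexHull ℝ (s : Set E), ∀ v, |bary K v x - bary K v y| ≤ C * ‖x - y‖ := by
  classical
  choose C hC using fun (s : Finset E) (v : E) => exists_abs_simplexCoord_sub_le s v
  obtain ⟨M, hM⟩ := ((hfin.toFinset.sigma fun s => s).image fun p => C p.1 p.2).exists_le
  refine ⟨max M 1, by positivity, fun s hs x hx y hy v => ?_⟩
  rw [bary_eq hs hx, bary_eq hs hy]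
  by_cases hv : v ∈ s
  · refine (hC s v x y).trans ?_
    gcongr
    exact (hM _ (Finset.mem_image.2 ⟨⟨s, v⟩, by simp [hs, hv], rfl⟩)).trans (le_max_left _ _)
  · rw [(simplexCoord_of_convexHull (K.indep hs) hx).2.1 v hv,
      (simplexCoord_of_convexHull (K.indep hs) hy).2.1 v hv]
    simp only [sub_self, abs_zero]
    positivity

/-- A vertex at which the barycentric coordinates of `x` are maximal. -/
def topVertex (K : SimplicialComplex ℝ E) (x : E) : E :=
  Classical.epsilon fun v => ∀ w, bary K w x ≤ bary K v x

theorem bary_le_bary_topVertex (hx : x ∈ K.space) (w : E) :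
    bary K w x ≤ bary K (topVertex K x) x := by
  obtain ⟨s, hs, hxs⟩ := SimplicialComplex.mem_space_iff.1 hx
  have : ∃ v, ∀ w, bary K w x ≤ bary K v x := by
    obtain ⟨v, hv, hmax⟩ := s.exists_max_image (fun v => bary K v x)
      (SimplicialComplex.nonempty_of_mem_faces hs)
    refine ⟨v, fun w => ?_⟩
    by_cases hw : w ∈ s
    · exact hmax w hw
    · rw [bary_eq hs hxs w, (simplexCoord_of_convexHull (K.indep hs) hxs).2.1 w hw]
      exact bary_nonneg hx v
  exact Classical.epsilon_spec this w

/-- The coordinates sum to one, so the largest is at least the inverse of the number of vertices of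
the simplex. -/
theorem exists_le_bary_topVertex (hfin : K.faces.Finite) :
    ∃ c : ℝ, 0 < c ∧ ∀ x ∈ K.space, c ≤ bary K (topVertex K x) x := by
  obtain ⟨M, hM⟩ := (hfin.toFinset.image fun s => (s.card : ℝ)).exists_le
  refine ⟨(max M 1)⁻¹, by positivity, fun x hx => ?_⟩
  obtain ⟨s, hs, hxs⟩ := SimplicialComplex.mem_space_iff.1 hx
  have h1 : (1 : ℝ) ≤ s.card * bary K (topVertex K x) x := by
    rw [← sum_bary hs hxs, ← nsmul_eq_mul]
    exact Finset.sum_le_card_nsmul _ _ _ fun v _ => bary_le_bary_topVertex hx v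
  have h2 : (s.card : ℝ) ≤ max M 1 :=
    (hM _ (Finset.mem_image.2 ⟨s, by simpa using hs, rfl⟩)).trans (le_max_left _ _)
  rw [inv_le_iff_one_le_mul₀ (by positivity)]
  have h0 := bary_nonneg hx (topVertex K x)
  nlinarith

theorem bary_topVertex_pos (hx : x ∈ K.space) : 0 < bary K (topVertex K x) x := by
  obtain ⟨s, hs, hxs⟩ := SimplicialComplex.mem_space_iff.1 hx
  by_contra! h
  have : ∑ v ∈ s, bary K v x ≤ 0 :=
    Finset.sum_nonpos fun v _ => (bary_le_bary_topVertex hx v).trans h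
  rw [sum_bary hs hxs] at this
  exact absurd this (by norm_num)

theorem topVertex_mem (hs : s ∈ K.faces) (hx : x ∈ convexHull ℝ (s : Set E)) :
    topVertex K x ∈ s :=
  mem_of_bary_pos hs hx (bary_topVertex_pos (SimplicialComplex.mem_space_iff.2 ⟨s, hs, hx⟩))

theorem topVertex_vertex (hs : s ∈ K.faces) (hx : x ∈ s) : topVertex K x = x := by
  have hxs : x ∈ convexHull ℝ (s : Set E) := subset_convexHull ℝ _ (by exact_mod_cast hx)
  have h := bary_topVertex_pos (K := K) (SimplicialComplex.mem_space_iff.2 ⟨s, hs, hxs⟩)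
  rw [bary_vertex hs hx] at h
  by_contra hne
  rw [Set.indicator_of_notMem (by simpa using Ne.symm hne)] at h
  exact lt_irrefl _ h

end

end SystolicEntropy

end


noncomputable section

namespace SystolicEntropy

open Geometry (SimplicialComplex)

variable {E : Type*} [NormedAddCommGroup E] [NormedSpace ℝ E]

/-! ### Paths in simplices -/

section

variable {K : SimplicialComplex ℝ E}

/-- Simplices are simply connected. This lets chords stand for arbitrary paths inside a simplex. -/
theorem homotopic_of_mem_convexHull {s : Finset E} (hs : s ∈ K.faces) {x y : K.space}
    (γ γ' : Path x y) (h : ∀ t, (γ t : E) ∈ convexHull ℝ (s : Set E))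
    (h' : ∀ t, (γ' t : E) ∈ convexHull ℝ (s : Set E)) : γ.Homotopic γ' := by
  let U := convexHull ℝ (s : Set E)
  have hx : (x : E) ∈ U := by simpa using h 0
  have hy : (y : E) ∈ U := by simpa using h 1
  have : ContractibleSpace U := (convex_convexHull ℝ (s : Set E)).contractibleSpace ⟨x, hx⟩
  let lift : ∀ p : Path x y, (∀ t, (p t : E) ∈ U) → Path (⟨x, hx⟩ : U) ⟨y, hy⟩ := fun p hp =>
    { toFun := fun t => ⟨p t, hp t⟩
      continuous_toFun := by fun_prop
      source' := by simp
      target' := by simp }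
  let i : C(U, K.space) := ⟨Set.inclusion (SimplicialComplex.convexHull_subset_space hs),
    continuous_inclusion _⟩
  have := (SimplyConnectedSpace.paths_homotopic (lift γ h) (lift γ' h')).map i
  exact this

/-- The straight path between two points of `|K|`. -/
def segPath {x y : K.space} (h : segment ℝ (x : E) y ⊆ K.space) : Path x y where
  toFun t := ⟨AffineMap.lineMap (x : E) (y : E) (t : ℝ), h (by
    rw [segment_eq_image_lineMap]
    exact mem_image_of_mem _ t.2)⟩
  continuous_toFun := by
    refine Continuous.subtype_mk ?_ _
    exact AffineMap.lineMap_continuous.comp continuous_subtype_val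
  source' := by simp
  target' := by simp

theorem segPath_mem {s : Finset E} {x y : K.space} (h : segment ℝ (x : E) y ⊆ K.space)
    (hx : (x : E) ∈ convexHull ℝ (s : Set E)) (hy : (y : E) ∈ convexHull ℝ (s : Set E)) (t : I) :
    (segPath h t : E) ∈ convexHull ℝ (s : Set E) := by
  apply (convex_convexHull ℝ (s : Set E)).segment_subset hx hy
  rw [segment_eq_image_lineMap]
  exact mem_image_of_mem _ t.2

theorem segment_subset_space {s : Finset E} (hs : s ∈ K.faces) {x y : E}
    (hx : x ∈ convexHull ℝ (s : Set E)) (hy : y ∈ convexHull ℝ (s : Set E)) :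
    segment ℝ x y ⊆ K.space :=
  ((convex_convexHull ℝ (s : Set E)).segment_subset hx hy).trans
    (SimplicialComplex.convexHull_subset_space hs)

theorem trans_mem {U : Set K.space} {x y z : K.space} {p : Path x y} {q : Path y z}
    (hp : ∀ t, p t ∈ U) (hq : ∀ t, q t ∈ U) (t : I) : (p.trans q) t ∈ U := by
  rw [Path.trans_apply]
  split_ifs
  · exact hp _
  · exact hq _

/-! ### Holonomy -/

variable {π : Type*} [Group π] {x₀ : K.space} (φ : FundamentalGroup K.space x₀ →* π)

theorem loopClass_congr {p q : Path x₀ x₀} (h : p.Homotopic q) : loopClass φ p = loopClass φ q := by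
  rw [loopClass, loopClass, Path.Homotopic.Quotient.eq.2 h]

/-- The product of the fundamental group is opposite to concatenation here; this is why `holonomy`
contains an inverse. -/
theorem loopClass_trans (p q : Path x₀ x₀) :
    loopClass φ (p.trans q) = loopClass φ q * loopClass φ p := by
  rw [loopClass, loopClass, loopClass, ← map_mul, FundamentalGroup.mul_def]
  rfl

theorem loopClass_refl : loopClass φ (Path.refl x₀) = 1 :=
  map_one φ

theorem loopClass_symm (p : Path x₀ x₀) : loopClass φ p.symm = (loopClass φ p)⁻¹ := by
  rw [loopClass, loopClass, ← map_inv, FundamentalGroup.inv_def]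
  rfl

theorem quotient_symm_trans_cancel {x y z : K.space} (p : Path.Homotopic.Quotient x y)
    (r : Path.Homotopic.Quotient y z) : p.symm.trans (p.trans r) = r := by
  rw [← Path.Homotopic.Quotient.trans_assoc, Path.Homotopic.Quotient.symm_trans,
    Path.Homotopic.Quotient.refl_trans]

/-- The inverse of the class of the loop that a path in `|K|` becomes after its end points are
connected to the base point by the paths `q`; it is trivial for the paths outside the path component
of the base point. -/
def holonomy (q : ∀ x, Joined x₀ x → Path x₀ x) {x y : K.space} (γ : Path x y) : π :=
  open Classical in
  if h : Joined x₀ x then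
    (loopClass φ (((q x h).trans γ).trans (q y (h.trans ⟨γ⟩)).symm))⁻¹
  else 1

variable {φ} {q : ∀ x, Joined x₀ x → Path x₀ x}

theorem holonomy_of_joined {x y : K.space} (γ : Path x y) (h : Joined x₀ x) (h' : Joined x₀ y) :
    holonomy φ q γ = (loopClass φ (((q x h).trans γ).trans (q y h').symm))⁻¹ := by
  rw [holonomy, dif_pos h]

theorem homotopic_of_mk_eq {x y : K.space} {p p' : Path x y}
    (h : Path.Homotopic.Quotient.mk p = Path.Homotopic.Quotient.mk p') : p.Homotopic p' :=
  Path.Homotopic.Quotient.eq.1 h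

/-- The connecting path at the middle point cancels. -/
theorem holonomy_trans {x y z : K.space} (γ : Path x y) (γ' : Path y z) :
    holonomy φ q (γ.trans γ') = holonomy φ q γ * holonomy φ q γ' := by
  by_cases h : Joined x₀ x
  · have hy : Joined x₀ y := h.trans ⟨γ⟩
    have hz : Joined x₀ z := hy.trans ⟨γ'⟩
    rw [holonomy_of_joined _ h hz, holonomy_of_joined _ h hy, holonomy_of_joined _ hy hz,
      ← mul_inv_rev, ← loopClass_trans]
    congr 1
    apply loopClass_congr
    apply homotopic_of_mk_eq
    simp only [Path.Homotopic.Quotient.mk_trans, Path.Homotopic.Quotient.mk_symm,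
      Path.Homotopic.Quotient.trans_assoc,
      quotient_symm_trans_cancel]
  · have hy : ¬ Joined x₀ y := fun hy => h (hy.trans ⟨γ.symm⟩)
    simp [holonomy, h, hy]

theorem holonomy_congr {x y : K.space} {γ γ' : Path x y} (h : γ.Homotopic γ') :
    holonomy φ q γ = holonomy φ q γ' := by
  by_cases hx : Joined x₀ x
  · have hy : Joined x₀ y := hx.trans ⟨γ⟩
    rw [holonomy_of_joined _ hx hy, holonomy_of_joined _ hx hy]
    congr 1
    exact loopClass_congr φ (((Path.Homotopic.refl _).hcomp h).hcomp (Path.Homotopic.refl _))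
  · simp [holonomy, hx]

theorem holonomy_refl (x : K.space) : holonomy φ q (Path.refl x) = 1 := by
  have h : holonomy φ q ((Path.refl x).trans (Path.refl x)) = holonomy φ q (Path.refl x) := by
    rw [Path.refl_trans_refl]
  rw [holonomy_trans] at h
  simpa using h

/-- Another connecting path changes the loop class by a conjugation. -/
theorem noncontractible_iff {x : K.space} (γ : Path x x) :
    Noncontractible φ γ ↔ holonomy φ q γ ≠ 1 := by
  have conj : ∀ (p : Path x₀ x) (h : Joined x₀ x), loopClass φ ((p.trans γ).trans p.symm) =
      loopClass φ ((q x h).trans p.symm) * (holonomy φ q γ)⁻¹ *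
        (loopClass φ ((q x h).trans p.symm))⁻¹ := by
    intro p h
    rw [holonomy_of_joined γ h h, inv_inv, ← loopClass_symm, ← loopClass_trans,
      ← loopClass_trans]
    apply loopClass_congr
    apply homotopic_of_mk_eq
    simp only [Path.Homotopic.Quotient.mk_trans, Path.Homotopic.Quotient.mk_symm,
      Path.Homotopic.Quotient.trans_assoc, Path.trans_symm, Path.symm_symm,
      quotient_symm_trans_cancel]
  constructor
  · rintro ⟨p, hp⟩ hw
    rw [conj p ⟨p⟩, hw] at hp
    simp at hp
  · intro hw
    have h : Joined x₀ x := by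
      by_contra h
      simp [holonomy, h] at hw
    refine ⟨q x h, fun hp => hw ?_⟩
    rw [conj _ h] at hp
    simpa using hp

theorem holonomy_eq_iff {x y : K.space} (h : Joined x₀ x) (γ γ' : Path x y) :
    holonomy φ q γ = holonomy φ q γ' ↔
      loopClass φ (((q x h).trans γ).trans ((q x h).trans γ').symm) = 1 := by
  have hy : Joined x₀ y := h.trans ⟨γ⟩
  have : loopClass φ (((q x h).trans γ).trans ((q x h).trans γ').symm) =
      holonomy φ q γ' * (holonomy φ q γ)⁻¹ := by
    rw [holonomy_of_joined _ h hy, holonomy_of_joined _ h hy, inv_inv, ← loopClass_symm,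
      ← loopClass_trans]
    apply loopClass_congr
    apply homotopic_of_mk_eq
    simp only [Path.Homotopic.Quotient.mk_trans, Path.Homotopic.Quotient.mk_symm,
      Path.Homotopic.Quotient.trans_assoc, Path.trans_symm, Path.symm_symm,
      quotient_symm_trans_cancel]
  rw [this, mul_inv_eq_one, eq_comm]

end

end SystolicEntropy

end


noncomputable section

namespace SystolicEntropy

open Geometry (SimplicialComplex)

variable {E : Type*} [NormedAddCommGroup E] [NormedSpace ℝ E]

/-! ### Lengths of reparametrized and concatenated curves -/

/-- The length element of a curve. -/
def speed (B : E → E →L[ℝ] E →L[ℝ] ℝ) (ρ : ℝ → E) (u : ℝ) : ℝ≥0∞ :=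
  ENNReal.ofReal (Real.sqrt (B (ρ u) (deriv ρ u) (deriv ρ u)))

/-- At the end points `deriv` also sees values outside the interval, but these two points are
negligible for the integral. -/
theorem lintegral_speed_congr (B : E → E →L[ℝ] E →L[ℝ] ℝ) {ρ τ : ℝ → E} {a b : ℝ}
    (h : EqOn ρ τ (Icc a b)) :
    ∫⁻ u in Icc a b, speed B ρ u = ∫⁻ u in Icc a b, speed B τ u := by
  rw [← MeasureTheory.restrict_Ioo_eq_restrict_Icc]
  refine MeasureTheory.setLIntegral_congr_fun measurableSet_Ioo fun u hu => ?_
  have hev : ρ =ᶠ[𝓝 u] τ := by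
    filter_upwards [Icc_mem_nhds hu.1 hu.2] with v hv using h hv
  simp only [speed, hev.deriv_eq, hev.eq_of_nhds]

theorem lintegral_speed_comp_affine (B : E → E →L[ℝ] E →L[ℝ] ℝ) (ρ : ℝ → E) (a b d : ℝ) {c : ℝ}
    (hc : 0 < c) :
    ∫⁻ u in Icc a b, speed B (fun u => ρ (c * u + d)) u =
      ∫⁻ u in Icc (c * a + d) (c * b + d), speed B ρ u := by
  have himg : (fun u => c * u + d) '' Icc a b = Icc (c * a + d) (c * b + d) := by
    have := image_affine_Icc' hc d a b
    exact this
  have hinj : InjOn (fun u => c * u + d) (Icc a b) := by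
    intro u _ v _ h
    simpa [hc.ne'] using h
  have hderiv : ∀ u ∈ Icc a b, HasDerivWithinAt (fun u => c * u + d) c (Icc a b) u := fun u _ => by
    simpa using (((hasDerivAt_id u).const_mul c).add_const d).hasDerivWithinAt
  rw [← himg, MeasureTheory.lintegral_image_eq_lintegral_abs_deriv_mul measurableSet_Icc hderiv hinj]
  refine MeasureTheory.lintegral_congr fun u => ?_
  have hd : deriv (fun u => ρ (c * u + d)) u = c • deriv ρ (c * u + d) := by
    have h1 := deriv_comp_mul_left c (fun v => ρ (v + d)) u
    rw [h1, deriv_comp_add_const]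
  rw [speed, speed, hd, abs_of_pos hc, ← ENNReal.ofReal_mul hc.le]
  congr 1
  simp only [map_smul, smul_eq_mul, _root_.smul_apply]
  rw [← mul_assoc, Real.sqrt_mul (mul_self_nonneg c), Real.sqrt_mul_self hc.le]

section

variable {K : SimplicialComplex ℝ E}

/-- The summand `0` matches the shape `c * u + d` in `lintegral_speed_comp_affine`. -/
theorem extend_trans_of_le {x y z : K.space} (γ : Path x y) (γ' : Path y z) {u : ℝ}
    (h0 : 0 ≤ u) (h1 : u ≤ 1 / 2) : (γ.trans γ').extend u = γ.extend (2 * u + 0) := by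
  rw [Path.extend_apply _ ⟨h0, by linarith⟩, Path.trans_apply, dif_pos h1,
    Path.extend_apply _ ⟨by linarith, by linarith⟩]
  simp

theorem extend_trans_of_ge {x y z : K.space} (γ : Path x y) (γ' : Path y z) {u : ℝ}
    (h0 : 1 / 2 ≤ u) (h1 : u ≤ 1) : (γ.trans γ').extend u = γ'.extend (2 * u + -1) := by
  rcases h0.eq_or_lt with rfl | h
  · rw [extend_trans_of_le γ γ' (by norm_num) le_rfl, show (2 : ℝ) * (1 / 2) + 0 = 1 by norm_num,
      show (2 : ℝ) * (1 / 2) + -1 = 0 by norm_num, Path.extend_one, Path.extend_zero]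
  · rw [Path.extend_apply _ ⟨by linarith, h1⟩, Path.trans_apply, dif_neg (not_le.2 h),
      Path.extend_apply _ ⟨by linarith, by linarith⟩]
    rfl

namespace SmoothPieces

variable {x y z : K.space} {γ : Path x y} {γ' : Path y z}

theorem time_mem (P : SmoothPieces γ) {i : ℕ} (hi : i ≤ P.num) : P.time i ∈ Icc (0 : ℝ) 1 := by
  refine ⟨?_, ?_⟩
  · rw [← P.time_zero]; exact P.mono (Nat.zero_le i)
  · rw [← P.time_num]; exact P.mono hi

/-- The subdivision of a concatenation. -/
def transTime (P : SmoothPieces γ) (Q : SmoothPieces γ') (i : ℕ) : ℝ :=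
  if i < P.num then P.time i / 2 else (Q.time (i - P.num) + 1) / 2

theorem transTime_left (P : SmoothPieces γ) (Q : SmoothPieces γ') {i : ℕ} (hi : i ≤ P.num) :
    transTime P Q i = P.time i / 2 := by
  rcases hi.lt_or_eq with h | rfl
  · rw [transTime, if_pos h]
  · rw [transTime, if_neg (lt_irrefl _), Nat.sub_self, Q.time_zero, P.time_num]
    norm_num

theorem transTime_right (P : SmoothPieces γ) (Q : SmoothPieces γ') (i : ℕ) :
    transTime P Q (P.num + i) = (Q.time i + 1) / 2 := by
  rw [transTime, if_neg (by omega), Nat.add_sub_cancel_left]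

/-- The piecewise smooth structure of a concatenation. -/
def trans (P : SmoothPieces γ) (Q : SmoothPieces γ') : SmoothPieces (γ.trans γ') where
  num := P.num + Q.num
  time := transTime P Q
  time_zero := by rw [transTime_left P Q (Nat.zero_le _), P.time_zero, zero_div]
  time_num := by rw [transTime_right, Q.time_num]; norm_num
  mono := by
    refine monotone_nat_of_le_succ fun i => ?_
    rcases lt_or_ge i P.num with h | h
    · rw [transTime_left P Q h.le, transTime_left P Q h]
      have := P.mono (Nat.le_succ i)
      linarith
    · obtain ⟨j, rfl⟩ := Nat.exists_eq_add_of_le h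
      rw [transTime_right, add_assoc, transTime_right]
      have := Q.mono (Nat.le_succ j)
      simp only [Nat.succ_eq_add_one] at this
      linarith
  face i := if i < P.num then P.face i else Q.face (i - P.num)
  face_mem i hi := by
    split_ifs with h
    · exact P.face_mem i h
    · exact Q.face_mem _ (by omega)
  maps i hi u hu := by
    split_ifs with h
    · rw [transTime_left P Q h.le, transTime_left P Q h] at hu
      have h0 := (P.time_mem h.le).1
      have h1 := (P.time_mem (i := i + 1) h).2
      rw [extend_trans_of_le γ γ' (by linarith [hu.1]) (by linarith [hu.2])]
      exact P.maps i h _ ⟨by linarith [hu.1], by linarith [hu.2]⟩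
    · obtain ⟨j, rfl⟩ := Nat.exists_eq_add_of_le (not_lt.1 h)
      rw [transTime_right, add_assoc, transTime_right] at hu
      have hj : j < Q.num := by omega
      have h0 := (Q.time_mem hj.le).1
      have h1 := (Q.time_mem (i := j + 1) hj).2
      rw [extend_trans_of_ge γ γ' (by linarith [hu.1]) (by linarith [hu.2]), Nat.add_sub_cancel_left]
      exact Q.maps j hj _ ⟨by linarith [hu.1], by linarith [hu.2]⟩
  smooth i hi := by
    rcases lt_or_ge i P.num with h | h
    · rw [transTime_left P Q h.le, transTime_left P Q h]
      have h0 := (P.time_mem h.le).1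
      have h1 := (P.time_mem (i := i + 1) h).2
      have hs := (P.smooth i h).comp (s := Icc (P.time i / 2) (P.time (i + 1) / 2))
        (f := fun u : ℝ => 2 * u + 0) (by fun_prop)
        fun u hu => ⟨by linarith [hu.1], by linarith [hu.2]⟩
      refine hs.congr fun u hu => ?_
      rw [extend_trans_of_le γ γ' (by linarith [hu.1]) (by linarith [hu.2])]
      rfl
    · obtain ⟨j, rfl⟩ := Nat.exists_eq_add_of_le h
      rw [transTime_right, add_assoc, transTime_right]
      have hj : j < Q.num := by omega
      have h0 := (Q.time_mem hj.le).1
      have h1 := (Q.time_mem (i := j + 1) hj).2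
      have hs := (Q.smooth j hj).comp (s := Icc ((Q.time j + 1) / 2) ((Q.time (j + 1) + 1) / 2))
        (f := fun u : ℝ => 2 * u + -1) (by fun_prop)
        fun u hu => ⟨by linarith [hu.1], by linarith [hu.2]⟩
      refine hs.congr fun u hu => ?_
      rw [extend_trans_of_ge γ γ' (by linarith [hu.1]) (by linarith [hu.2])]
      rfl

theorem length_trans (g : RiemannianMetric K) (P : SmoothPieces γ) (Q : SmoothPieces γ') :
    g.length (P.trans Q) = g.length P + g.length Q := by
  change ∑ i ∈ Finset.range (P.num + Q.num), ∫⁻ u in Icc (transTime P Q i) (transTime P Q (i + 1)),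
    speed (g.form (if i < P.num then P.face i else Q.face (i - P.num)))
      (fun u => ((γ.trans γ').extend u : E)) u = _
  rw [Finset.sum_range_add]
  congr 1
  · refine Finset.sum_congr rfl fun i hi => ?_
    have h := Finset.mem_range.1 hi
    have h0 := (P.time_mem h.le).1
    have h1 := (P.time_mem (i := i + 1) h).2
    rw [transTime_left P Q h.le, transTime_left P Q h, if_pos h]
    have heq : EqOn (fun u => ((γ.trans γ').extend u : E)) (fun u => (γ.extend (2 * u + 0) : E))
        (Icc (P.time i / 2) (P.time (i + 1) / 2)) := fun u hu => by
      simp only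
      rw [extend_trans_of_le γ γ' (by linarith [hu.1]) (by linarith [hu.2])]
    rw [lintegral_speed_congr _ heq, lintegral_speed_comp_affine _ (fun u => (γ.extend u : E)) _ _ 0
      two_pos]
    congr 3 <;> ring
  · refine Finset.sum_congr rfl fun j hj => ?_
    have hj := Finset.mem_range.1 hj
    have h0 := (Q.time_mem hj.le).1
    have h1 := (Q.time_mem (i := j + 1) hj).2
    rw [transTime_right, add_assoc, transTime_right, if_neg (by omega), Nat.add_sub_cancel_left]
    have heq : EqOn (fun u => ((γ.trans γ').extend u : E)) (fun u => (γ'.extend (2 * u + -1) : E))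
        (Icc ((Q.time j + 1) / 2) ((Q.time (j + 1) + 1) / 2)) := fun u hu => by
      simp only
      rw [extend_trans_of_ge γ γ' (by linarith [hu.1]) (by linarith [hu.2])]
    rw [lintegral_speed_congr _ heq, lintegral_speed_comp_affine _ (fun u => (γ'.extend u : E)) _ _ _
      two_pos]
    congr 3 <;> ring

end SmoothPieces

theorem exists_path_of_contDiffOn (g : RiemannianMetric K) {s : Finset E} (hs : s ∈ K.faces)
    {ρ : ℝ → E} {a b : ℝ} (hab : a ≤ b) (hρ : ContDiffOn ℝ ∞ ρ (Icc a b))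
    (hm : ∀ u ∈ Icc a b, ρ u ∈ convexHull ℝ (s : Set E)) {x y : K.space} (hx : (x : E) = ρ a)
    (hy : (y : E) = ρ b) :
    ∃ γ : Path x y, (∀ t, (γ t : E) ∈ convexHull ℝ (s : Set E)) ∧
      ∃ P : SmoothPieces γ, g.length P ≤ ∫⁻ u in Icc a b, speed (g.form s) ρ u := by
  have hmem : ∀ t : ℝ, t ∈ Icc (0 : ℝ) 1 → (b - a) * t + a ∈ Icc a b := fun t ht =>
    ⟨by nlinarith [ht.1], by nlinarith [ht.2]⟩
  let γ : Path x y :=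
    { toFun := fun t => ⟨ρ ((b - a) * t + a),
        SimplicialComplex.convexHull_subset_space hs (hm _ (hmem _ t.2))⟩
      continuous_toFun := by
        refine Continuous.subtype_mk ?_ _
        exact hρ.continuousOn.comp_continuous (by fun_prop) fun t => hmem _ t.2
      source' := Subtype.ext (by simp [hx])
      target' := Subtype.ext (by simp [hy]) }
  have hγ : ∀ u ∈ Icc (0 : ℝ) 1, (γ.extend u : E) = ρ ((b - a) * u + a) := fun u hu => by
    rw [Path.extend_apply _ hu]
    rfl
  refine ⟨γ, fun t => hm _ (hmem _ t.2), ?_⟩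
  have htime : ∀ i : ℕ, i < 1 → Icc (min (i : ℝ) 1) (min ((i + 1 : ℕ) : ℝ) 1) = Icc 0 1 := by
    intro i hi
    obtain rfl : i = 0 := by omega
    simp
  refine ⟨{
    num := 1
    time := fun i => min (i : ℝ) 1
    time_zero := by simp
    time_num := by simp
    mono := fun i j h => min_le_min_right _ (by exact_mod_cast h)
    face := fun _ => s
    face_mem := fun _ _ => hs
    maps := fun i hi u hu => by
      rw [htime i hi] at hu
      rw [hγ u hu]
      exact hm _ (hmem _ hu)
    smooth := fun i hi => by
      rw [htime i hi]
      exact (hρ.comp (f := fun u : ℝ => (b - a) * u + a) (by fun_prop) hmem).congr hγ }, ?_⟩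
  change ∑ i ∈ Finset.range 1, ∫⁻ u in Icc (min (i : ℝ) 1) (min ((i + 1 : ℕ) : ℝ) 1),
    speed (g.form s) (fun u => (γ.extend u : E)) u ≤ _
  rw [Finset.sum_range_one, htime 0 one_pos, lintegral_speed_congr _ hγ]
  rcases hab.eq_or_lt with rfl | h
  -- On a degenerate interval the change of variables is not available, but the curve is constant.
  · simp [speed]
  · rw [lintegral_speed_comp_affine _ ρ _ _ a (sub_pos.2 h)]
    simp

/-- The homotopy class of the path `γ` contains a piecewise smooth path of length at most `ℓ`. -/
def Reach (g : RiemannianMetric K) {x y : K.space} (γ : Path x y) (ℓ : ℝ) : Prop :=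
  ∃ γ' : Path x y, γ'.Homotopic γ ∧ ∃ P : SmoothPieces γ', g.length P ≤ ENNReal.ofReal ℓ

namespace Reach

variable {g : RiemannianMetric K} {x y z : K.space} {γ : Path x y} {γ' : Path y z} {ℓ ℓ' : ℝ}

theorem mono (h : Reach g γ ℓ) (hℓ : ℓ ≤ ℓ') : Reach g γ ℓ' := by
  obtain ⟨p, hp, P, hP⟩ := h
  exact ⟨p, hp, P, hP.trans (ENNReal.ofReal_le_ofReal hℓ)⟩

theorem trans (h : Reach g γ ℓ) (h' : Reach g γ' ℓ') (hℓ : 0 ≤ ℓ) (hℓ' : 0 ≤ ℓ') :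
    Reach g (γ.trans γ') (ℓ + ℓ') := by
  obtain ⟨p, hp, P, hP⟩ := h
  obtain ⟨p', hp', P', hP'⟩ := h'
  refine ⟨p.trans p', hp.hcomp hp', P.trans P', ?_⟩
  rw [SmoothPieces.length_trans, ENNReal.ofReal_add hℓ hℓ']
  exact add_le_add hP hP'

theorem of_contDiffOn {s : Finset E} (hs : s ∈ K.faces)
    {ρ : ℝ → E} {a b : ℝ} (hab : a ≤ b) (hρ : ContDiffOn ℝ ∞ ρ (Icc a b))
    (hm : ∀ u ∈ Icc a b, ρ u ∈ convexHull ℝ (s : Set E)) (hx : (x : E) = ρ a)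
    (hy : (y : E) = ρ b) (hγ : ∀ t, (γ t : E) ∈ convexHull ℝ (s : Set E))
    (hℓ : ∫⁻ u in Icc a b, speed (g.form s) ρ u ≤ ENNReal.ofReal ℓ) : Reach g γ ℓ := by
  obtain ⟨p, hp, P, hP⟩ := exists_path_of_contDiffOn g hs hab hρ hm hx hy
  exact ⟨p, homotopic_of_mem_convexHull hs _ _ hp hγ, P, hP.trans hℓ⟩

/-- The path is homotopic to its chord, whose speed is at most `M` times the norm of the difference
of the ends. -/
theorem of_mem_convexHull {M : ℝ} (hM : 0 ≤ M) {s : Finset E} (hs : s ∈ K.faces)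
    (hg : ∀ x ∈ convexHull ℝ (s : Set E), ∀ v, g.form s x v v ≤ M ^ 2 * ‖v‖ ^ 2)
    (hγ : ∀ t, (γ t : E) ∈ convexHull ℝ (s : Set E)) : Reach g γ (M * ‖(x : E) - y‖) := by
  have hx : (x : E) ∈ convexHull ℝ (s : Set E) := by simpa using hγ 0
  have hy : (y : E) ∈ convexHull ℝ (s : Set E) := by simpa using hγ 1
  have hm : ∀ u ∈ Icc (0 : ℝ) 1, AffineMap.lineMap (x : E) (y : E) u ∈ convexHull ℝ (s : Set E) :=
    fun u hu => (convex_convexHull ℝ (s : Set E)).segment_subset hx hy (by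
      rw [segment_eq_image_lineMap]
      exact mem_image_of_mem _ hu)
  have hd : ∀ u, deriv (fun u : ℝ => AffineMap.lineMap (x : E) (y : E) u) u = (y : E) - x :=
    fun u => AffineMap.hasDerivAt_lineMap.deriv
  refine of_contDiffOn hs (ρ := fun u : ℝ => AffineMap.lineMap (x : E) (y : E) u) zero_le_one
    (by
      simp only [AffineMap.lineMap_apply, vsub_eq_sub, vadd_eq_add]
      fun_prop) hm (by simp) (by simp) hγ ?_
  calc ∫⁻ u in Icc (0 : ℝ) 1, speed (g.form s) (fun u : ℝ => AffineMap.lineMap (x : E) (y : E) u) u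
      ≤ ∫⁻ u in Icc (0 : ℝ) 1, ENNReal.ofReal (M * ‖(x : E) - y‖) := by
        refine MeasureTheory.setLIntegral_mono measurable_const fun u hu => ?_
        rw [speed, hd]
        refine ENNReal.ofReal_le_ofReal ?_
        refine Real.sqrt_le_iff.2 ⟨by positivity, ?_⟩
        rw [mul_pow, norm_sub_rev]
        exact hg _ (hm u hu) _
    _ = _ := by simp

end Reach

end

end SystolicEntropy

end


noncomputable section

namespace SystolicEntropy

open Geometry (SimplicialComplex)

variable {E : Type*} [NormedAddCommGroup E] [NormedSpace ℝ E]

/-! ### Decomposition of curves into curves in the subcomplex and short curves -/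

/-- An abstraction of the curves in a complex `L` with subcomplex `K`, labelled by the elements of a
group: `seg x y` is the label of the straight path from `x` to `y`, and `step x y a ℓ` says that
there is a curve in `K` from `x` to `y` with label `a` and length at most `ℓ`. -/
structure CurveSystem (K L : SimplicialComplex ℝ E) (π : Type*) [Group π] where
  le : K.faces ⊆ L.faces
  seg : E → E → π
  seg_mul : ∀ s ∈ L.faces, ∀ x ∈ convexHull ℝ (s : Set E), ∀ y ∈ convexHull ℝ (s : Set E),
    ∀ z ∈ convexHull ℝ (s : Set E), seg x y * seg y z = seg x z
  seg_topVertex : ∀ x ∈ L.space, seg (topVertex L x) x = 1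
  step : E → E → π → ℝ → Prop
  step_mem : ∀ {x y a ℓ}, step x y a ℓ → x ∈ K.space ∧ y ∈ K.space ∧ 0 ≤ ℓ
  step_mono : ∀ {x y a ℓ ℓ'}, step x y a ℓ → ℓ ≤ ℓ' → step x y a ℓ'
  step_mul : ∀ {x y z a b ℓ ℓ'}, step x y a ℓ → step y z b ℓ' → step x z (a * b) (ℓ + ℓ')
  slope : ℝ
  slope_nonneg : 0 ≤ slope
  step_seg : ∀ s ∈ K.faces, ∀ x ∈ convexHull ℝ (s : Set E), ∀ y ∈ convexHull ℝ (s : Set E),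
    step x y (seg x y) (slope * ‖x - y‖)

namespace CurveSystem

variable {K L : SimplicialComplex ℝ E} {π : Type*} [Group π] (S : CurveSystem K L π)

theorem seg_self {s : Finset E} (hs : s ∈ L.faces) {x : E} (hx : x ∈ convexHull ℝ (s : Set E)) :
    S.seg x x = 1 := by
  have := S.seg_mul s hs x hx x hx x hx
  simpa using this

theorem step_refl {x : E} (hx : x ∈ K.space) : S.step x x 1 0 := by
  obtain ⟨s, hs, hxs⟩ := SimplicialComplex.mem_space_iff.1 hx
  have := S.step_seg s hs x hxs x hxs
  rwa [S.seg_self (S.le hs) hxs, sub_self, norm_zero, mul_zero] at this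

/-- The polygonal paths in `L`, with their labels and their lengths with respect to the norm. -/
inductive Polygon : E → E → π → ℝ → Prop
  | nil {x : E} (hx : x ∈ L.space) : Polygon x x 1 0
  | cons {s : Finset E} {x y z : E} {f : π} {m : ℝ} (hs : s ∈ L.faces)
      (hx : x ∈ convexHull ℝ (s : Set E)) (hy : y ∈ convexHull ℝ (s : Set E))
      (h : Polygon y z f m) : Polygon x z (S.seg x y * f) (‖x - y‖ + m)

variable {S}

theorem Polygon.norm_sub_le {x y : E} {f : π} {m : ℝ} (h : S.Polygon x y f m) : ‖x - y‖ ≤ m := by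
  induction h with
  | nil => simp
  | cons _ _ _ _ ih => exact (norm_sub_le_norm_sub_add_norm_sub _ _ _).trans (by gcongr)

theorem Polygon.nonneg {x y : E} {f : π} {m : ℝ} (h : S.Polygon x y f m) : 0 ≤ m :=
  (norm_nonneg _).trans h.norm_sub_le

theorem Polygon.mem {x y : E} {f : π} {m : ℝ} (h : S.Polygon x y f m) :
    x ∈ L.space ∧ y ∈ L.space := by
  induction h with
  | nil hx => exact ⟨hx, hx⟩
  | cons hs hx _ _ ih => exact ⟨SimplicialComplex.mem_space_iff.2 ⟨_, hs, hx⟩, ih.2⟩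

theorem Polygon.abs_bary_sub_le [FiniteDimensional ℝ E] {C : ℝ}
    (hC : ∀ s ∈ L.faces, ∀ x ∈ convexHull ℝ (s : Set E),
      ∀ y ∈ convexHull ℝ (s : Set E), ∀ v, |bary L v x - bary L v y| ≤ C * ‖x - y‖)
    {x y : E} {f : π} {m : ℝ} (h : S.Polygon x y f m) (v : E) :
    |bary L v x - bary L v y| ≤ C * m := by
  induction h with
  | nil => simp
  | @cons s x y z f m hs hx hy h ih =>
    refine (abs_sub_le _ (bary L v y) _).trans ?_
    rw [mul_add]
    exact add_le_add (hC _ hs _ hx _ hy v) ih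

/-- The coordinate of `v` cannot drop to zero along the polygon, so all segments lie in simplices
containing `v`, and the labels telescope through `v`. -/
theorem Polygon.eq_seg_mul_seg [FiniteDimensional ℝ E] {C : ℝ} (hC0 : 0 ≤ C)
    (hC : ∀ s ∈ L.faces, ∀ x ∈ convexHull ℝ (s : Set E),
      ∀ y ∈ convexHull ℝ (s : Set E), ∀ v, |bary L v x - bary L v y| ≤ C * ‖x - y‖)
    {x y : E} {f : π} {m : ℝ} (h : S.Polygon x y f m) {v : E} (hv : C * m < bary L v x) :
    0 < bary L v y ∧ f = S.seg x v * S.seg v y := by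
  induction h with
  | @nil x hx =>
    obtain ⟨s, hs, hxs⟩ := SimplicialComplex.mem_space_iff.1 hx
    rw [mul_zero] at hv
    have hvs : v ∈ convexHull ℝ (s : Set E) :=
      subset_convexHull ℝ _ (by exact_mod_cast mem_of_bary_pos hs hxs hv)
    exact ⟨hv, by rw [S.seg_mul s hs x hxs v hvs x hxs, S.seg_self hs hxs]⟩
  | @cons s x y z f m hs hx hy h ih =>
    have h1 := (abs_le.1 (hC _ hs _ hx _ hy v)).2
    obtain ⟨h2, rfl⟩ := ih (by rw [mul_add] at hv; linarith)
    have h0 : 0 < bary L v x := lt_of_le_of_lt (by have := h.nonneg; positivity) hv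
    have hvs : v ∈ convexHull ℝ (s : Set E) :=
      subset_convexHull ℝ _ (by exact_mod_cast mem_of_bary_pos hs hx h0)
    exact ⟨h2, by rw [← mul_assoc, S.seg_mul s hs x hx y hy v hvs]⟩

/-! ### Labels and replacement of short polygons -/

variable (S) in
/-- The labels of the edges of `L`. -/
def edgeLabels : Set π := image2 S.seg L.vertices L.vertices

theorem finite_vertices (hfin : L.faces.Finite) : L.vertices.Finite := by
  rw [SimplicialComplex.vertices_eq]
  exact hfin.biUnion fun s _ => s.finite_toSet

theorem finite_edgeLabels (hfin : L.faces.Finite) : S.edgeLabels.Finite :=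
  (finite_vertices hfin).image2 _ (finite_vertices hfin)

theorem mem_vertices_of_mem {s : Finset E} (hs : s ∈ L.faces) {v : E} (hv : v ∈ s) :
    v ∈ L.vertices :=
  L.down_closed hs (Finset.singleton_subset_iff.2 hv) (Finset.singleton_nonempty v)

theorem one_mem_edgeLabels [FiniteDimensional ℝ E] {x : E} (hx : x ∈ L.space) :
    1 ∈ S.edgeLabels := by
  obtain ⟨s, hs, hxs⟩ := SimplicialComplex.mem_space_iff.1 hx
  have hv := topVertex_mem hs hxs
  exact ⟨_, mem_vertices_of_mem hs hv, _, mem_vertices_of_mem hs hv,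
    S.seg_self hs (subset_convexHull ℝ _ (by exact_mod_cast hv))⟩

variable (S) in
/-- `δ` and `Λ` are such that polygons of length at most `2δ` are determined by the stars of their
end points, and such that polygons of length `m ≤ 2δ` with end points in `K` can be replaced by
curves in `K` of length at most `Λm`. -/
structure IsControlled (δ Λ : ℝ) : Prop where
  pos : 0 < δ
  nonneg : 0 ≤ Λ
  mem_edgeLabels : ∀ {x y f m}, S.Polygon x y f m → m ≤ 2 * δ → f ∈ S.edgeLabels
  eq_one : ∀ {x f m}, S.Polygon x x f m → m ≤ 2 * δ → f = 1
  step : ∀ {x y f m}, S.Polygon x y f m → m ≤ 2 * δ → x ∈ K.space → y ∈ K.space →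
    S.step x y f (Λ * m)

theorem IsControlled.mono {δ Λ Λ' : ℝ} (h : S.IsControlled δ Λ) (hΛ : Λ ≤ Λ') :
    S.IsControlled δ Λ' where
  pos := h.pos
  nonneg := h.nonneg.trans hΛ
  mem_edgeLabels := h.mem_edgeLabels
  eq_one := h.eq_one
  step hp hm hx hy := S.step_mono (h.step hp hm hx hy) (by have := hp.nonneg; gcongr)

variable (S) in
theorem exists_isControlled [FiniteDimensional ℝ E] (hfin : L.faces.Finite) :
    ∃ δ Λ, S.IsControlled δ Λ := by
  classical
  obtain ⟨C, hC0, hC⟩ := exists_abs_bary_sub_le hfin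
  obtain ⟨c, hc0, hc⟩ := exists_le_bary_topVertex hfin
  set V := (finite_vertices hfin).toFinset with hV
  have hsV : ∀ s ∈ L.faces, s ⊆ V := fun s hs v hv => by
    rw [hV, Set.Finite.mem_toFinset]
    exact mem_vertices_of_mem hs hv
  obtain ⟨R, hR⟩ := ((V ×ˢ V).image fun p => ‖p.1 - p.2‖).exists_le
  have hR : ∀ v ∈ V, ∀ w ∈ V, ‖v - w‖ ≤ max R 0 := fun v hv w hw =>
    (hR _ (Finset.mem_image.2 ⟨(v, w), Finset.mem_product.2 ⟨hv, hw⟩, rfl⟩)).trans (le_max_left _ _)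
  -- `A * m` will bound the distance from `x` to its projection `p` to the common face: at most
  -- `V.card` vertices move, each with weight at most `C * m` and by at most the diameter of the
  -- vertex set.
  set A := V.card * (C * max R 0) with hA
  have hA0 : 0 ≤ A := by positivity
  -- With this choice a polygon of length `2δ` changes coordinates by at most `c / 2`, so it stays
  -- in the open star of the top vertex of its starting point.
  set δ := c / (4 * C) with hδ
  have hδ0 : 0 < δ := by positivity
  have small : ∀ {x y f m}, S.Polygon x y f m → m ≤ 2 * δ →
      0 < bary L (topVertex L x) y ∧ f = S.seg x (topVertex L x) * S.seg (topVertex L x) y := by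
    intro x y f m h hm
    refine h.eq_seg_mul_seg hC0.le hC (lt_of_lt_of_le ?_ (hc x h.mem.1))
    calc C * m ≤ C * (2 * δ) := by gcongr
      _ = c / 2 := by rw [hδ]; field_simp; norm_num
      _ < c := by linarith
  have mem : ∀ {s : Finset E} {v : E}, v ∈ s → v ∈ convexHull ℝ (s : Set E) := fun hv =>
    subset_convexHull ℝ _ (by exact_mod_cast hv)
  refine ⟨δ, S.slope * (2 * A + 1), hδ0, by have := S.slope_nonneg; positivity, ?_, ?_, ?_⟩
  · intro x y f m h hm
    obtain ⟨h1, rfl⟩ := small h hm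
    obtain ⟨s, hs, hxs⟩ := SimplicialComplex.mem_space_iff.1 h.mem.1
    obtain ⟨t, ht, hyt⟩ := SimplicialComplex.mem_space_iff.1 h.mem.2
    have hv := topVertex_mem hs hxs
    have hvt := mem_of_bary_pos ht hyt h1
    have hw := topVertex_mem ht hyt
    refine ⟨_, mem_vertices_of_mem hs hv, _, mem_vertices_of_mem ht hw, ?_⟩
    -- As the segments from top vertices have label `1`, the label of the polygon equals that of the
    -- segment between the top vertices of its ends.
    have e1 := S.seg_mul s hs x hxs _ (mem hv) x hxs
    rw [S.seg_topVertex x h.mem.1, S.seg_self hs hxs, mul_one] at e1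
    have e2 := S.seg_mul t ht _ (mem hvt) _ (mem hw) y hyt
    rw [S.seg_topVertex y h.mem.2, mul_one] at e2
    rw [e1, one_mul, e2]
  · intro x f m h hm
    obtain ⟨h1, rfl⟩ := small h hm
    obtain ⟨s, hs, hxs⟩ := SimplicialComplex.mem_space_iff.1 h.mem.1
    rw [S.seg_mul s hs x hxs _ (mem (topVertex_mem hs hxs)) x hxs, S.seg_self hs hxs]
  · intro x y f m h hm hxK hyK
    obtain ⟨h1, rfl⟩ := small h hm
    obtain ⟨s, hs, hxs⟩ := SimplicialComplex.mem_space_iff.1 hxK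
    obtain ⟨t, ht, hyt⟩ := SimplicialComplex.mem_space_iff.1 hyK
    set v := topVertex L x
    have hvs : v ∈ s := topVertex_mem (S.le hs) hxs
    have hvt : v ∈ t := mem_of_bary_pos (S.le ht) hyt h1
    -- Moving the weights of the vertices outside `t` to `v` projects `x` to a point `p` of the
    -- common face of `s` and `t`; the replacing curve in `K` is the one from `x` through `p` to
    -- `y`.
    let r : E → E := fun w => if w ∈ t then w else v
    set p := ∑ w ∈ s, bary L w x • r w with hp
    have hb : ∀ w ∈ s, 0 ≤ bary L w x := fun w _ => bary_nonneg h.mem.1 w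
    have hps : p ∈ convexHull ℝ (s : Set E) := by
      refine (convex_convexHull ℝ (s : Set E)).sum_mem hb (sum_bary (S.le hs) hxs) fun w hw => mem ?_
      by_cases hwt : w ∈ t <;> simp [r, hwt, hw, hvs]
    have hpt : p ∈ convexHull ℝ (t : Set E) := by
      refine (convex_convexHull ℝ (t : Set E)).sum_mem hb (sum_bary (S.le hs) hxs) fun w hw => mem ?_
      by_cases hwt : w ∈ t <;> simp [r, hwt, hvt]
    have hm0 := h.nonneg
    have hxp : ‖x - p‖ ≤ A * m := by
      have : x - p = ∑ w ∈ s, bary L w x • (w - r w) := by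
        simp_rw [smul_sub, Finset.sum_sub_distrib]
        rw [sum_bary_smul (S.le hs) hxs]
      rw [this]
      calc ‖∑ w ∈ s, bary L w x • (w - r w)‖ ≤ ∑ w ∈ s, (C * m) * max R 0 := by
            refine norm_sum_le_of_le _ fun w hw => ?_
            by_cases hwt : w ∈ t
            · simp only [r, hwt, if_true, sub_self, smul_zero, norm_zero]
              positivity
            · simp only [r, hwt, if_false]
              rw [norm_smul, Real.norm_of_nonneg (hb w hw)]
              -- The coordinate of `w` vanishes at `y`, so at `x` it is at most the variation `C *
              -- m`.
              have hy0 : bary L w y = 0 := by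
                rw [bary_eq (S.le ht) hyt,
                  (simplexCoord_of_convexHull (L.indep (S.le ht)) hyt).2.1 w hwt]
              have h2 := (abs_le.1 (h.abs_bary_sub_le hC w)).2
              rw [hy0, sub_zero] at h2
              exact mul_le_mul h2 (hR _ (hsV s (S.le hs) hw) _ (hsV s (S.le hs) hvs))
                (norm_nonneg _) (by positivity)
        _ = s.card * (C * max R 0) * m := by
            rw [Finset.sum_const, nsmul_eq_mul]; ring
        _ ≤ A * m := by
            rw [hA]
            have := Finset.card_le_card (hsV s (S.le hs))
            gcongr
    have hpy : ‖p - y‖ ≤ A * m + m := by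
      calc ‖p - y‖ ≤ ‖p - x‖ + ‖x - y‖ := norm_sub_le_norm_sub_add_norm_sub _ _ _
        _ ≤ A * m + m := add_le_add (by rwa [norm_sub_rev]) h.norm_sub_le
    have e1 := S.seg_mul s (S.le hs) x hxs v (mem hvs) p hps
    have e2 := S.seg_mul t (S.le ht) p hpt v (mem hvt) y hyt
    have e3 := S.seg_mul s (S.le hs) v (mem hvs) p hps v (mem hvs)
    rw [S.seg_self (S.le hs) (mem hvs)] at e3
    -- Both `v` and `p` lie in `s` and in `t`, so the detour from `v` to `p` and back has trivial
    -- label.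
    have e4 : S.seg x v * S.seg v y = S.seg x p * S.seg p y := by
      rw [← e1, ← e2, mul_assoc, ← mul_assoc (S.seg v p), e3, one_mul]
    rw [e4]
    refine S.step_mono (S.step_mul (S.step_seg s hs x hxs p hps) (S.step_seg t ht p hpt y hyt)) ?_
    rw [← mul_add, mul_assoc]
    exact mul_le_mul_of_nonneg_left (by linarith) S.slope_nonneg

/-! ### Chains and their decomposition into words -/

variable (S) in
/-- The curves in `L` that consist of curves in `K` and of straight segments of length at most `δ`,
whose length is multiplied by `Λ`. -/
inductive Chain (δ Λ : ℝ) (y : E) : E → π → ℝ → Prop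
  | nil (hy : y ∈ L.space) : Chain δ Λ y y 1 0
  | step {x z : E} {a b : π} {v ℓ : ℝ} (hs : S.step x z a v) (h : Chain δ Λ y z b ℓ) :
      Chain δ Λ y x (a * b) (v + ℓ)
  | thin {s : Finset E} {x z : E} {b : π} {ℓ : ℝ} (hs : s ∈ L.faces)
      (hx : x ∈ convexHull ℝ (s : Set E)) (hz : z ∈ convexHull ℝ (s : Set E))
      (hδ : ‖x - z‖ ≤ δ) (h : Chain δ Λ y z b ℓ) :
      Chain δ Λ y x (S.seg x z * b) (Λ * ‖x - z‖ + ℓ)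

theorem Chain.append {δ Λ : ℝ} {x y z : E} {a b : π} {ℓ ℓ' : ℝ} (h : S.Chain δ Λ y x a ℓ)
    (h' : S.Chain δ Λ z y b ℓ') : S.Chain δ Λ z x (a * b) (ℓ + ℓ') := by
  induction h with
  | nil => simpa using h'
  | step hs _ ih =>
    rw [mul_assoc, add_assoc]
    exact .step hs ih
  | thin hs hx hz hδ _ ih =>
    rw [mul_assoc, add_assoc]
    exact .thin hs hx hz hδ ih

/-- A chain that does not meet `K` is a polygon. -/
theorem Chain.polygon_or {δ Λ : ℝ} {x y : E} {a : π} {ℓ : ℝ} (h : S.Chain δ Λ y x a ℓ) :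
    (∃ m, S.Polygon x y a m ∧ Λ * m ≤ ℓ) ∨ ∃ p ∈ K.space, ∃ b b' v v',
      S.Chain δ Λ p x b v ∧ S.Chain δ Λ y p b' v' ∧ a = b * b' ∧ v + v' = ℓ := by
  induction h with
  | nil hy => exact .inl ⟨0, .nil hy, by simp⟩
  | @step x z a b v ℓ hs h ih =>
    have hx := (S.step_mem hs).1
    exact .inr ⟨x, hx, _, _, _, _, .nil (space_mono S.le hx), .step hs h, by simp, by simp⟩
  | thin hs hx hz hδ h ih =>
    obtain ⟨m, hm, hml⟩ | ⟨p, hp, b, b', v, v', h1, h2, rfl, rfl⟩ := ih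
    · exact .inl ⟨_, .cons hs hx hz hm, by rw [mul_add]; gcongr⟩
    · exact .inr ⟨p, hp, _, _, _, _, .thin hs hx hz hδ h1, h2, by rw [mul_assoc], by ring⟩

variable (S) in
/-- The labels of the sequences of curves in `K` that alternate with pairs of edges of cost `D`. -/
inductive Word (D : ℝ) : π → ℝ → Prop
  | base {x z : E} {a : π} {v ℓ : ℝ} (hs : S.step x z a v) (hv : v ≤ ℓ) : Word D a ℓ
  -- Consecutive curves need not fit together at their end points, since only labels are to be
  -- counted.
  | cons {x z : E} {a f f' b : π} {v ℓ ℓ' : ℝ} (hs : S.step x z a v) (hf : f ∈ S.edgeLabels)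
      (hf' : f' ∈ S.edgeLabels) (hw : Word D b ℓ') (hℓ : v + D + ℓ' ≤ ℓ) :
      Word D (a * (f * (f' * b))) ℓ

theorem Word.nonneg {D : ℝ} (hD : 0 ≤ D) {a : π} {ℓ : ℝ} (h : S.Word D a ℓ) : 0 ≤ ℓ := by
  induction h with
  | base hs hv => exact (S.step_mem hs).2.2.trans hv
  | cons hs _ _ _ hℓ ih => linarith [(S.step_mem hs).2.2]

variable (S) in
/-- The state at a point `z` in the decomposition of a chain from `z` to `y`. -/
inductive Settled (D : ℝ) (y z : E) : π → ℝ → Prop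
  -- A polygon with label `f` and cost at least `D` starts at `z`; in `last` and `mid` a curve in
  -- `K` starts there, and in `last` it reaches `y`.
  | cut {f b : π} {ℓ ℓ' : ℝ} (hf : f ∈ S.edgeLabels) (hw : S.Word D b ℓ') (hℓ : D + ℓ' ≤ ℓ) :
      Settled D y z (f * b) ℓ
  | last {a : π} {v ℓ : ℝ} (hs : S.step z y a v) (hℓ : v ≤ ℓ) : Settled D y z a ℓ
  | mid {z' : E} {a f f' b : π} {v ℓ ℓ' : ℝ} (hs : S.step z z' a v) (hf : f ∈ S.edgeLabels)
      (hf' : f' ∈ S.edgeLabels) (hw : S.Word D b ℓ') (hℓ : v + D + ℓ' ≤ ℓ) :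
      Settled D y z (a * (f * (f' * b))) ℓ

/-- A cut is padded with a constant curve and a trivial edge label. -/
theorem Settled.word [FiniteDimensional ℝ E] {D : ℝ} {y z : E} (hy : y ∈ K.space) {a : π} {ℓ : ℝ}
    (h : S.Settled D y z a ℓ) : S.Word D a ℓ := by
  cases h with
  | @cut f b _ _ hf hw hℓ =>
    have : S.Word D (1 * (1 * (f * b))) ℓ :=
      .cons (S.step_refl hy) (one_mem_edgeLabels (space_mono S.le hy)) hf hw (by rwa [zero_add])
    simpa using this
  | last hs hℓ => exact .base hs hℓ
  | mid hs hf hf' hw hℓ => exact .cons hs hf hf' hw hℓ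

/-- The chain is read backwards from `y`. The thin segments read last form a pending polygon of
length at most `δ` in front of the settled rest. The pending polygon is absorbed when a curve in `K`
comes up and cut off when it exceeds `δ`; its length is then still at most `2δ`, the bound in
`IsControlled`. -/
theorem Chain.exists_settled [FiniteDimensional ℝ E] {δ Λ : ℝ} (hS : S.IsControlled δ Λ) {x y : E}
    (hy : y ∈ K.space) {a : π} {ℓ : ℝ} (h : S.Chain δ Λ y x a ℓ) :
    ∃ z f m b v, S.Polygon x z f m ∧ m ≤ δ ∧ S.Settled (Λ * δ) y z b v ∧ a = f * b ∧
      Λ * m + v ≤ ℓ := by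
  have hδ := hS.pos
  have hΛ := hS.nonneg
  induction h with
  | nil hyL =>
    exact ⟨y, 1, 0, 1, 0, .nil hyL, hδ.le, .last (S.step_refl hy) le_rfl, by simp, by simp⟩
  | @step x z a b v ℓ hs h ih =>
    obtain ⟨z', f, m, b, w, hp, hm, hset, rfl, hℓ⟩ := ih
    obtain ⟨hxK, hzK, hv0⟩ := S.step_mem hs
    have hm0 := hp.nonneg
    have hxL := space_mono S.le hxK
    have hm0' : 0 ≤ Λ * m := by positivity
    cases hset with
    | cut hf hw hc =>
      -- The pending polygon and the one cut off before it provide the two edge labels, for which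
      -- only the latter is charged.
      exact ⟨x, 1, 0, _, _, .nil hxL, hδ.le,
        .mid hs (hS.mem_edgeLabels hp (by linarith)) hf hw le_rfl, by simp, by linarith⟩
    | last hl hc =>
      -- The pending polygon runs between points of `K`, so it is replaced by a curve in `K` of
      -- length at most `Λ * m` and merged with its neighbours.
      have h1 := S.step_mul (hS.step hp (by linarith) hzK (S.step_mem hl).1) hl
      exact ⟨x, 1, 0, _, _, .nil hxL, hδ.le, .last (S.step_mul hs h1) le_rfl, by simp,
        by linarith⟩
    | mid hl hf hf' hw hc =>
      have h1 := S.step_mul (hS.step hp (by linarith) hzK (S.step_mem hl).1) hl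
      exact ⟨x, 1, 0, _, _, .nil hxL, hδ.le, .mid (S.step_mul hs h1) hf hf' hw le_rfl,
        by simp [mul_assoc], by linarith⟩
  | @thin s x z b ℓ hs hx hz hle h ih =>
    obtain ⟨z', f, m, b, w, hp, hm, hset, rfl, hℓ⟩ := ih
    have hp' := Polygon.cons hs hx hz hp
    by_cases hmδ : ‖x - z‖ + m ≤ δ
    · exact ⟨z', _, _, b, w, hp', hmδ, hset, by rw [mul_assoc], by rw [mul_add]; linarith⟩
    -- The polygon has become longer than `δ`, so it pays the cost `Λ * δ` of a cut.
    · have hb := hset.word hy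
      refine ⟨x, 1, 0, _, _, .nil hp'.mem.1, hδ.le,
        .cut (hS.mem_edgeLabels hp' (by linarith)) hb le_rfl, by simp [mul_assoc], ?_⟩
      have : Λ * δ ≤ Λ * (‖x - z‖ + m) := by
        have := (not_le.1 hmδ).le
        gcongr
      rw [mul_add] at this
      linarith

/-- A short closed chain with nontrivial label gives a closed curve in `K` that is not longer. -/
theorem Chain.exists_step [FiniteDimensional ℝ E] {δ Λ : ℝ} (hS : S.IsControlled δ Λ) (hΛ : 0 < Λ)
    {y : E} {a : π} {ℓ : ℝ} (h : S.Chain δ Λ y y a ℓ) (ha : a ≠ 1) (hℓ : ℓ < Λ * δ) :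
    ∃ p b, b ≠ 1 ∧ S.step p p b ℓ := by
  obtain ⟨m, hm, hml⟩ | ⟨p, hp, b, b', v, v', h1, h2, rfl, rfl⟩ := h.polygon_or
  · have : m < δ := lt_of_mul_lt_mul_left (hml.trans_lt hℓ) hΛ.le
    exact absurd (hS.eq_one hm (by linarith [hS.pos])) ha
  · have hδ := hS.pos
    -- The closed chain is rotated so as to start at `p`, which conjugates its label.
    obtain ⟨z, f, m, c, w, hp', hm, hset, heq, hle⟩ := (h2.append h1).exists_settled hS hp
    have hm0 : 0 ≤ Λ * m := mul_nonneg hΛ.le hp'.nonneg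
    have hD : 0 ≤ Λ * δ := by positivity
    refine ⟨p, f * c, ?_, ?_⟩
    · rw [← heq]
      intro h
      apply ha
      rw [mul_eq_one_iff_eq_inv] at h ⊢
      rw [h, inv_inv]
    · cases hset with
      -- Every cut costs `Λ * δ`, more than the whole chain, so only `last` survives.
      | cut hf hw hc => linarith [hw.nonneg hD]
      | last hl hc =>
        exact S.step_mono (S.step_mul (hS.step hp' (by linarith) hp (S.step_mem hl).1) hl)
          (by linarith)
      | mid hl hf hf' hw hc => linarith [hw.nonneg hD, (S.step_mem hl).2.2]

theorem Chain.exists_word [FiniteDimensional ℝ E] {δ Λ : ℝ} (hS : S.IsControlled δ Λ) {x y : E}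
    (hy : y ∈ K.space) {a : π} {ℓ : ℝ} (h : S.Chain δ Λ y x a ℓ) :
    ∃ f ∈ S.edgeLabels, ∃ b v, S.Word (Λ * δ) b v ∧ a = f * b ∧ v ≤ ℓ := by
  obtain ⟨z, f, m, b, v, hp, hm, hset, rfl, hle⟩ := h.exists_settled hS hy
  have := mul_nonneg hS.nonneg hp.nonneg
  exact ⟨f, hS.mem_edgeLabels hp (by linarith [hS.pos]), b, v, hset.word hy, rfl, by linarith⟩

end CurveSystem

end SystolicEntropy

end


noncomputable section

namespace SystolicEntropy

open Geometry (SimplicialComplex)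

variable {E : Type*} [NormedAddCommGroup E] [NormedSpace ℝ E]

/-! ### Counting words -/

/-- The set `s` is finite with at most `c` elements. -/
def CardLE {α : Type*} (s : Set α) (c : ℝ) : Prop :=
  ∃ F : Finset α, s ⊆ F ∧ (F.card : ℝ) ≤ c

namespace CardLE

variable {α β γ ι : Type*} {s t : Set α} {c d : ℝ}

theorem mono (h : CardLE t d) (hst : s ⊆ t) (hc : d ≤ c) : CardLE s c := by
  obtain ⟨F, hF, hFc⟩ := h
  exact ⟨F, hst.trans hF, hFc.trans hc⟩

theorem union (hs : CardLE s c) (ht : CardLE t d) : CardLE (s ∪ t) (c + d) := by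
  classical
  obtain ⟨F, hF, hFc⟩ := hs
  obtain ⟨G, hG, hGd⟩ := ht
  refine ⟨F ∪ G, by rw [Finset.coe_union]; exact union_subset_union hF hG, ?_⟩
  have : ((F ∪ G).card : ℝ) ≤ F.card + G.card := by exact_mod_cast Finset.card_union_le F G
  linarith

theorem image2 {t : Set β} (f : α → β → γ) (hs : CardLE s c) (ht : CardLE t d) :
    CardLE (image2 f s t) (c * d) := by
  classical
  obtain ⟨F, hF, hFc⟩ := hs
  obtain ⟨G, hG, hGd⟩ := ht
  refine ⟨Finset.image₂ f F G, by rw [Finset.coe_image₂]; exact image2_subset hF hG, ?_⟩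
  have : ((Finset.image₂ f F G).card : ℝ) ≤ F.card * G.card := by
    exact_mod_cast Finset.card_image₂_le f F G
  refine this.trans (mul_le_mul hFc hGd (Nat.cast_nonneg _) ((Nat.cast_nonneg _).trans hFc))

theorem biUnion (J : Finset ι) {s : ι → Set α} {c : ι → ℝ} (h : ∀ i ∈ J, CardLE (s i) (c i)) :
    CardLE (⋃ i ∈ J, s i) (∑ i ∈ J, c i) := by
  classical
  choose! F hF hFc using h
  refine ⟨J.biUnion F, ?_, ?_⟩
  · rw [Finset.coe_biUnion]
    exact biUnion_mono subset_rfl hF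
  · calc ((J.biUnion F).card : ℝ) ≤ ∑ i ∈ J, ((F i).card : ℝ) := by
          exact_mod_cast Finset.card_biUnion_le
      _ ≤ _ := Finset.sum_le_sum hFc

theorem encard_le (h : CardLE s c) : ((s.encard : ℕ∞) : ℝ≥0∞) ≤ ENNReal.ofReal c := by
  obtain ⟨F, hF, hFc⟩ := h
  have h1 : s.encard ≤ (F.card : ℕ∞) := (encard_le_encard hF).trans (by simp)
  calc ((s.encard : ℕ∞) : ℝ≥0∞) ≤ ((F.card : ℕ∞) : ℝ≥0∞) := by exact_mod_cast h1
    _ = ENNReal.ofReal (F.card : ℝ) := by simp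
    _ ≤ _ := ENNReal.ofReal_le_ofReal hFc

end CardLE

namespace CurveSystem

variable {K L : SimplicialComplex ℝ E} {π : Type*} [Group π] {S : CurveSystem K L π}

theorem Word.mono {D : ℝ} {a : π} {ℓ ℓ' : ℝ} (h : S.Word D a ℓ) (hℓ : ℓ ≤ ℓ') : S.Word D a ℓ' := by
  cases h with
  | base hs hv => exact .base hs (hv.trans hℓ)
  | cons hs hf hf' hw h => exact .cons hs hf hf' hw (h.trans hℓ)

variable (S) in
/-- If the number of labels of the curves in `K` of length at most `v` grows at most like
`exp (h * v)`, then the number of words grows at most like `exp (h' * ℓ)`, where `h' > h` is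
arbitrary if the cost of the edges is large enough. -/
theorem exists_cardLE_word {q A₀ h h' : ℝ} (hq : CardLE S.edgeLabels q) (hh : 0 ≤ h)
    (hh' : h < h') (hA₀ : 0 ≤ A₀)
    (hstep : ∀ v, 0 ≤ v → CardLE {a | ∃ x z, S.step x z a v} (A₀ * Real.exp (h * v))) :
    ∃ D₀, ∀ D, D₀ ≤ D → ∀ ℓ, 0 ≤ ℓ →
      CardLE {a | S.Word D a ℓ} (2 * A₀ * Real.exp (h' * ℓ)) := by
  set r := Real.exp (-(h' - h)) with hr
  have hr0 : 0 < r := Real.exp_pos _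
  have hr1 : r < 1 := by rw [hr, Real.exp_lt_one_iff]; linarith
  have hq0 : 0 ≤ q := by
    obtain ⟨F, -, hF⟩ := hq
    exact (Nat.cast_nonneg _).trans hF
  -- `B * exp (-(h' * D))` bounds the ratio between the sum over words with at least one pair of
  -- edges and the claimed bound; `D` is chosen such that it is at most `1 / 2`.
  set B := A₀ * Real.exp h * (q * q) * (1 - r)⁻¹ with hB
  have hB0 : 0 ≤ B := by
    have : 0 ≤ (1 - r)⁻¹ := inv_nonneg.2 (by linarith)
    positivity
  have htend : Tendsto (fun D : ℝ => B * Real.exp (-(h' * D))) atTop (𝓝 0) := by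
    have h1 : Tendsto (fun D : ℝ => h' * D) atTop atTop :=
      tendsto_id.const_mul_atTop (by linarith)
    simpa using (Real.tendsto_exp_neg_atTop_nhds_zero.comp h1).const_mul B
  obtain ⟨D₁, hD₁⟩ := eventually_atTop.1 (htend.eventually_le_const (show (0 : ℝ) < 1 / 2 by norm_num))
  refine ⟨max D₁ 1, fun D hD => ?_⟩
  have hDB := hD₁ D ((le_max_left _ _).trans hD)
  -- Each pair of edges thus lowers the remaining length by at least one, so induction on an integer
  -- bound for `ℓ` works.
  have hD1 : 1 ≤ D := (le_max_right _ _).trans hD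
  suffices key : ∀ (N : ℕ) (ℓ : ℝ), 0 ≤ ℓ → ℓ ≤ N →
      CardLE {a | S.Word D a ℓ} (2 * A₀ * Real.exp (h' * ℓ)) from fun ℓ hℓ =>
    key ⌈ℓ⌉₊ ℓ hℓ (Nat.le_ceil ℓ)
  have hbase : ∀ ℓ, 0 ≤ ℓ → A₀ * Real.exp (h * ℓ) ≤ A₀ * Real.exp (h' * ℓ) := fun ℓ hℓ => by
    have := hh'.le
    gcongr
  intro N
  induction N with
  | zero =>
    intro ℓ h0 hN
    refine (hstep ℓ h0).mono ?_ (by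
      have := hbase ℓ h0
      have : 0 ≤ A₀ * Real.exp (h' * ℓ) := by positivity
      linarith)
    intro a ha
    cases ha with
    | base hs hv => exact ⟨_, _, S.step_mono hs hv⟩
    | cons hs hf hf' hw hℓ =>
      have := hw.nonneg (by linarith)
      have := (S.step_mem hs).2.2
      simp only [Nat.cast_zero] at hN
      linarith
  | succ N ih =>
    intro ℓ h0 hN
    -- `j` is the integer part of the length of the first curve in `K`.
    set J := (Finset.range (⌈ℓ⌉₊ + 1)).filter fun j : ℕ => (j : ℝ) + D ≤ ℓ with hI
    have hmem : ∀ j ∈ J, (j : ℝ) + D ≤ ℓ := fun j hj => (Finset.mem_filter.1 hj).2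
    have hpiece : ∀ j ∈ J, CardLE (Set.image2 (· * ·) {a | ∃ x z, S.step x z a ((j : ℝ) + 1)}
        (Set.image2 (· * ·) S.edgeLabels (Set.image2 (· * ·) S.edgeLabels
          {a | S.Word D a (ℓ - j - D)})))
        (A₀ * Real.exp (h * (j + 1)) * (q * (q * (2 * A₀ * Real.exp (h' * (ℓ - j - D)))))) := by
      intro j hj
      have := hmem j hj
      push_cast at hN
      have hj0 : (0 : ℝ) ≤ j := Nat.cast_nonneg j
      exact (hstep _ (by positivity)).image2 _ (hq.image2 _ (hq.image2 _
        (ih _ (by linarith) (by linarith))))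
    refine ((hstep ℓ h0).union (CardLE.biUnion J hpiece)).mono ?_ ?_
    · intro a ha
      cases ha with
      | base hs hv => exact .inl ⟨_, _, S.step_mono hs hv⟩
      | @cons x z a f f' b v _ ℓ' hs hf hf' hw hℓ =>
        have hl := hw.nonneg (by linarith)
        have hv := (S.step_mem hs).2.2
        refine .inr (mem_biUnion (x := ⌊v⌋₊) ?_ ?_)
        · rw [Finset.mem_coe, hI, Finset.mem_filter, Finset.mem_range]
          have h1 := Nat.floor_le hv
          refine ⟨?_, by linarith⟩
          have : (⌊v⌋₊ : ℝ) ≤ ⌈ℓ⌉₊ := by linarith [Nat.le_ceil ℓ]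
          exact Nat.lt_succ_of_le (by exact_mod_cast this)
        · have h1 := Nat.floor_le hv
          exact mem_image2_of_mem ⟨x, z, S.step_mono hs (Nat.lt_floor_add_one v).le⟩
            (mem_image2_of_mem hf (mem_image2_of_mem hf' (hw.mono (by linarith))))
    · have hterm : ∀ j ∈ J,
          A₀ * Real.exp (h * (j + 1)) * (q * (q * (2 * A₀ * Real.exp (h' * (ℓ - j - D))))) =
          2 * A₀ * Real.exp (h' * ℓ) * Real.exp (-(h' * D)) * (A₀ * Real.exp h * (q * q)) * r ^ j := by
        intro j _
        have e1 : Real.exp (h * (j + 1)) * Real.exp (h' * (ℓ - j - D)) =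
            Real.exp (h' * ℓ) * Real.exp (-(h' * D)) * Real.exp h * r ^ j := by
          rw [hr, ← Real.exp_nat_mul, ← Real.exp_add, ← Real.exp_add, ← Real.exp_add, ← Real.exp_add]
          congr 1
          ring
        linear_combination (A₀ * (q * q) * 2 * A₀) * e1
      rw [Finset.sum_congr rfl hterm, ← Finset.mul_sum]
      have hsum : ∑ j ∈ J, r ^ j ≤ (1 - r)⁻¹ := by
        rw [← tsum_geometric_of_lt_one hr0.le hr1]
        exact (summable_geometric_of_lt_one hr0.le hr1).sum_le_tsum J fun _ _ => by positivity
      have h1 : 2 * A₀ * Real.exp (h' * ℓ) * Real.exp (-(h' * D)) * (A₀ * Real.exp h * (q * q)) *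
          ∑ j ∈ J, r ^ j ≤ 2 * A₀ * Real.exp (h' * ℓ) * (B * Real.exp (-(h' * D))) := by
        calc _ ≤ 2 * A₀ * Real.exp (h' * ℓ) * Real.exp (-(h' * D)) * (A₀ * Real.exp h * (q * q)) *
            (1 - r)⁻¹ := by gcongr
          _ = _ := by rw [hB]; ring
      have h2 : 2 * A₀ * Real.exp (h' * ℓ) * (B * Real.exp (-(h' * D))) ≤
          2 * A₀ * Real.exp (h' * ℓ) * (1 / 2) := by gcongr
      linarith [hbase ℓ h0]

end CurveSystem

end SystolicEntropy

end


noncomputable section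

namespace SystolicEntropy

open Geometry (SimplicialComplex)

variable {E : Type*} [NormedAddCommGroup E] [NormedSpace ℝ E]

/-! ### The corner simplex -/

section CornerSimplex

variable {n : ℕ}

theorem convex_cornerSimplex : Convex ℝ (cornerSimplex n) := by
  intro t ht u hu a b ha hb hab
  refine ⟨fun i => ?_, ?_⟩
  · have := ht.1 i
    have := hu.1 i
    simp only [Pi.add_apply, Pi.smul_apply, smul_eq_mul]
    positivity
  · simp only [Pi.add_apply, Pi.smul_apply, smul_eq_mul, Finset.sum_add_distrib, ← Finset.mul_sum]
    nlinarith [ht.2, hu.2]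

theorem isCompact_cornerSimplex : IsCompact (cornerSimplex n) := by
  have hclosed : IsClosed (cornerSimplex n) := by
    have : cornerSimplex n = (⋂ i, {t | 0 ≤ t i}) ∩ {t | ∑ i, t i ≤ 1} := by
      ext t
      simp [cornerSimplex]
    rw [this]
    refine (isClosed_iInter fun i => ?_).inter ?_
    · exact isClosed_le continuous_const (continuous_apply i)
    · exact isClosed_le (by fun_prop) continuous_const
  refine (isCompact_Icc (a := (0 : Fin n → ℝ)) (b := 1)).of_isClosed_subset hclosed fun t ht => ?_
  refine ⟨fun i => ht.1 i, fun i => ?_⟩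
  exact (Finset.single_le_sum (fun j _ => ht.1 j) (Finset.mem_univ i)).trans ht.2

theorem measurableSet_cornerSimplex : MeasurableSet (cornerSimplex n) :=
  isCompact_cornerSimplex.isClosed.measurableSet

theorem volume_cornerSimplex_lt_top : MeasureTheory.volume (cornerSimplex n) < ⊤ :=
  isCompact_cornerSimplex.measure_lt_top

theorem volume_cornerSimplex_pos : 0 < MeasureTheory.volume (cornerSimplex n) := by
  have hopen : IsOpen {t : Fin n → ℝ | (∀ i, 0 < t i) ∧ ∑ i, t i < 1} := by
    have : {t : Fin n → ℝ | (∀ i, 0 < t i) ∧ ∑ i, t i < 1} =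
        (⋂ i, {t | 0 < t i}) ∩ {t | ∑ i, t i < 1} := by
      ext t
      simp
    rw [this]
    refine (isOpen_iInter_of_finite fun i => ?_).inter ?_
    · exact isOpen_lt continuous_const (continuous_apply i)
    · exact isOpen_lt (by fun_prop) continuous_const
  refine (hopen.measure_pos MeasureTheory.volume ⟨fun _ => ((n : ℝ) + 1)⁻¹, fun i => by positivity,
    ?_⟩).trans_le (MeasureTheory.measure_mono fun t ht => ⟨fun i => (ht.1 i).le, ht.2.le⟩)
  rw [Finset.sum_const, Finset.card_univ, Fintype.card_fin, nsmul_eq_mul, ← div_eq_mul_inv,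
    div_lt_one (by positivity)]
  linarith

theorem ae_cornerSimplex_interior :
    ∀ᵐ t ∂MeasureTheory.volume.restrict (cornerSimplex n), (∀ i, 0 < t i) ∧ ∑ i, t i < 1 := by
  have h1 : ∀ᵐ t ∂MeasureTheory.volume.restrict (cornerSimplex n), t ∉ frontier (cornerSimplex n) :=
    MeasureTheory.ae_restrict_of_ae (MeasureTheory.measure_eq_zero_iff_ae_notMem.1
      (convex_cornerSimplex.addHaar_frontier MeasureTheory.volume))
  filter_upwards [h1, MeasureTheory.ae_restrict_mem measurableSet_cornerSimplex] with t hf ht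
  have hint : t ∈ interior (cornerSimplex n) := by
    by_contra h
    exact hf ⟨subset_closure ht, h⟩
  obtain ⟨ε, hε, hball⟩ := Metric.mem_nhds_iff.1 (mem_interior_iff_mem_nhds.1 hint)
  -- Diagonal translates remain in the simplex: downwards this yields positive coordinates, upwards
  -- a sum less than one.
  have hmem : ∀ c : ℝ, |c| < ε → (fun i => t i + c) ∈ cornerSimplex n := fun c hc => by
    apply hball
    rw [Metric.mem_ball, dist_pi_lt_iff hε]
    intro i
    simpa [Real.dist_eq] using hc
  refine ⟨fun i => ?_, ?_⟩
  · have := (hmem (-(ε / 2)) (by rw [abs_neg, abs_of_pos (by positivity)]; linarith)).1 i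
    simp only at this
    linarith
  · have := (hmem (ε / 2) (by rw [abs_of_pos (by positivity)]; linarith)).2
    rw [Finset.sum_add_distrib, Finset.sum_const, Finset.card_univ, Fintype.card_fin,
      nsmul_eq_mul] at this
    rcases Nat.eq_zero_or_pos n with rfl | hn
    · simp
    · have : (0 : ℝ) < n := by exact_mod_cast hn
      have : 0 < (n : ℝ) * (ε / 2) := by positivity
      linarith

end CornerSimplex

/-! ### The affine parametrization of a simplex -/

section Chart

variable {n : ℕ}

section

variable {V : Type*} {s : Finset V} (hs : s.card = n + 1)

theorem vertex_mem (i : Fin (n + 1)) : vertex s hs i ∈ s :=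
  ((s.equivFinOfCardEq hs).symm i).2

theorem vertex_injective : Function.Injective (vertex s hs) :=
  Subtype.val_injective.comp (s.equivFinOfCardEq hs).symm.injective

theorem exists_vertex_eq {v : V} (hv : v ∈ s) : ∃ i, vertex s hs i = v :=
  ⟨s.equivFinOfCardEq hs ⟨v, hv⟩, by simp [vertex]⟩

end

variable {s : Finset E} (hs : s.card = n + 1)

theorem continuous_chart : Continuous (chart s hs) := by
  unfold chart
  fun_prop

theorem chart_mem {t : Fin n → ℝ} (ht : t ∈ cornerSimplex n) :
    chart s hs t ∈ convexHull ℝ (s : Set E) := by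
  have : chart s hs t = ∑ k : Fin (n + 1),
      (Fin.cons (1 - ∑ i, t i) t : Fin (n + 1) → ℝ) k • vertex s hs k := by
    rw [Fin.sum_univ_succ]
    simp only [Fin.cons_zero, Fin.cons_succ, chart, edge, smul_sub, Finset.sum_sub_distrib, sub_smul,
      one_smul, Finset.sum_smul]
    abel
  rw [this]
  refine (convex_convexHull ℝ (s : Set E)).sum_mem (fun k _ => ?_) ?_ fun k _ =>
    subset_convexHull ℝ _ (by exact_mod_cast vertex_mem hs k)
  · refine Fin.cases ?_ (fun i => ?_) k
    · simpa using ht.2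
    · simpa using ht.1 i
  · rw [Fin.sum_univ_succ]
    simp

theorem affineMap_chart (A : E →ᵃ[ℝ] ℝ) (t : Fin n → ℝ) :
    A (chart s hs t) = A (vertex s hs 0) + ∑ i, t i * (A (vertex s hs i.succ) - A (vertex s hs 0)) := by
  have h : ∀ x y, A x - A y = A.linear (x - y) := fun x y => by
    simpa using (A.linearMap_vsub x y).symm
  have h1 := h (chart s hs t) (vertex s hs 0)
  simp_rw [h]
  rw [← sub_eq_iff_eq_add', h1]
  simp [chart, edge]

theorem simplexCoord_chart_pos [FiniteDimensional ℝ E] (hind : AffineIndependent ℝ ((↑) : s → E))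
    {t : Fin n → ℝ} (h0 : ∀ i, 0 < t i) (h1 : ∑ i, t i < 1) {v : E} (hv : v ∈ s) :
    0 < simplexCoord s v (chart s hs t) := by
  classical
  obtain ⟨k, rfl⟩ := exists_vertex_eq hs hv
  rw [affineMap_chart]
  have hval : ∀ i, simplexCoord s (vertex s hs k) (vertex s hs i) = if i = k then 1 else 0 := by
    intro i
    rw [simplexCoord_apply hind _ (vertex_mem hs i)]
    by_cases h : i = k
    · simp [h]
    · simp [h, (vertex_injective hs).ne h]
  simp_rw [hval]
  refine Fin.cases ?_ (fun j => ?_) k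
  · simp [Fin.succ_ne_zero]
    linarith
  · simp [(Fin.succ_ne_zero j).symm, h0 j]

theorem linearIndependent_edge (hind : AffineIndependent ℝ ((↑) : s → E)) :
    LinearIndependent ℝ (edge s hs) := by
  have h1 : AffineIndependent ℝ (vertex s hs) :=
    hind.comp_embedding (s.equivFinOfCardEq hs).symm.toEmbedding
  rw [affineIndependent_iff_linearIndependent_vsub ℝ _ (0 : Fin (n + 1))] at h1
  have := h1.comp (fun i : Fin n => (⟨i.succ, Fin.succ_ne_zero i⟩ : {x : Fin (n + 1) // x ≠ 0}))
    fun i j h => by simpa using h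
  exact this

theorem edge_mem (i : Fin n) : edge s hs i ∈ vectorSpan ℝ (s : Set E) :=
  vsub_mem_vectorSpan ℝ (by exact_mod_cast vertex_mem hs _) (by exact_mod_cast vertex_mem hs _)

/-- The Gram determinant of the edges of a simplex. -/
def edgeDet (A : E →L[ℝ] E →L[ℝ] ℝ) : ℝ :=
  Matrix.det (Matrix.of fun i j : Fin n => A (edge s hs i) (edge s hs j))

theorem continuous_edgeDet : Continuous (edgeDet hs) := by
  unfold edgeDet
  refine Continuous.matrix_det ?_
  refine continuous_matrix fun i j => ?_
  simp only [Matrix.of_apply]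
  fun_prop

/-- The Gram matrix of linearly independent vectors is positive definite. -/
theorem edgeDet_pos (hind : AffineIndependent ℝ ((↑) : s → E)) {A : E →L[ℝ] E →L[ℝ] ℝ}
    (hsymm : ∀ v ∈ vectorSpan ℝ (s : Set E), ∀ w ∈ vectorSpan ℝ (s : Set E), A v w = A w v)
    (hpos : ∀ v ∈ vectorSpan ℝ (s : Set E), v ≠ 0 → 0 < A v v) : 0 < edgeDet hs A := by
  apply Matrix.PosDef.det_pos
  refine Matrix.PosDef.of_dotProduct_mulVec_pos ?_ fun x hx => ?_
  · ext i j
    simp [hsymm _ (edge_mem hs j) _ (edge_mem hs i)]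
  · have hne : ∑ i, x i • edge s hs i ≠ 0 := fun h => hx (by
      ext i
      exact Fintype.linearIndependent_iff.1 (linearIndependent_edge hs hind) x h i)
    have hmem : ∑ i, x i • edge s hs i ∈ vectorSpan ℝ (s : Set E) :=
      Submodule.sum_mem _ fun i _ => Submodule.smul_mem _ _ (edge_mem hs i)
    have h := hpos _ hmem hne
    convert! h using 1
    simp only [star_trivial, dotProduct, Matrix.mulVec, Matrix.of_apply, map_sum, Finset.mul_sum,
      map_smul, smul_eq_mul, sum_apply, _root_.smul_apply]
    exact Finset.sum_comm.trans (Finset.sum_congr rfl fun i _ => Finset.sum_congr rfl fun j _ => by ring)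

end Chart

/-! ### Volumes -/

section Volume

variable {K L : SimplicialComplex ℝ E} {n : ℕ}

theorem volIntegral_eq (g : RiemannianMetric K) (n : ℕ) (f : E → ℝ≥0∞) :
    g.volIntegral n f = ∑' s : {s : Finset E // s ∈ K.faces ∧ s.card = n + 1},
      ∫⁻ t in cornerSimplex n, f (chart s.1 s.2.2 t) *
        ENNReal.ofReal (Real.sqrt (edgeDet s.2.2 (g.form s.1 (chart s.1 s.2.2 t)))) := rfl

theorem volIntegral_mono (g : RiemannianMetric K) (n : ℕ) {f f' : E → ℝ≥0∞}
    (h : ∀ x ∈ K.space, f x ≤ f' x) : g.volIntegral n f ≤ g.volIntegral n f' := by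
  rw [volIntegral_eq, volIntegral_eq]
  refine ENNReal.tsum_le_tsum fun s => MeasureTheory.setLIntegral_mono' measurableSet_cornerSimplex
    fun t ht => ?_
  gcongr
  exact h _ (SimplicialComplex.convexHull_subset_space s.2.1 (chart_mem s.2.2 ht))

theorem volIntegral_const (g : RiemannianMetric K) (n : ℕ) {c : ℝ≥0∞} (hc : c ≠ ⊤) :
    g.volIntegral n (fun _ => c) = c * g.vol n := by
  rw [RiemannianMetric.vol, volIntegral_eq, volIntegral_eq, ← ENNReal.tsum_mul_left]
  refine tsum_congr fun s => ?_
  rw [MeasureTheory.lintegral_const_mul' _ _ hc]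
  simp

theorem continuousOn_form_chart (g : RiemannianMetric K) {s : Finset E} (hsK : s ∈ K.faces)
    (hs : s.card = n + 1) : ContinuousOn (fun t => g.form s (chart s hs t)) (cornerSimplex n) :=
  (g.smooth s hsK).continuousOn.comp (continuous_chart hs).continuousOn fun _ ht => chart_mem hs ht

theorem lintegral_edgeDet_pos (g : RiemannianMetric K) {s : Finset E} (hsK : s ∈ K.faces)
    (hs : s.card = n + 1) : 0 < ∫⁻ t in cornerSimplex n,
      ENNReal.ofReal (Real.sqrt (edgeDet hs (g.form s (chart s hs t)))) := by
  have hcont : ContinuousOn (fun t => edgeDet hs (g.form s (chart s hs t))) (cornerSimplex n) :=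
    (continuous_edgeDet hs).comp_continuousOn (continuousOn_form_chart g hsK hs)
  have hne : (cornerSimplex n).Nonempty := ⟨0, by simp [cornerSimplex]⟩
  obtain ⟨t₀, ht₀, hmin⟩ := isCompact_cornerSimplex.exists_isMinOn hne hcont
  have hpos : 0 < edgeDet hs (g.form s (chart s hs t₀)) :=
    edgeDet_pos hs (K.indep hsK) (g.symm s hsK _ (chart_mem hs ht₀))
      (g.pos s hsK _ (chart_mem hs ht₀))
  calc 0 < ENNReal.ofReal (Real.sqrt (edgeDet hs (g.form s (chart s hs t₀)))) *
        MeasureTheory.volume (cornerSimplex n) :=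
        ENNReal.mul_pos (by simpa using hpos) volume_cornerSimplex_pos.ne'
    _ = ∫⁻ _ in cornerSimplex n,
        ENNReal.ofReal (Real.sqrt (edgeDet hs (g.form s (chart s hs t₀)))) := by simp
    _ ≤ _ := by
        refine MeasureTheory.setLIntegral_mono' measurableSet_cornerSimplex fun t ht => ?_
        exact ENNReal.ofReal_le_ofReal (Real.sqrt_le_sqrt (hmin ht))

theorem vol_pos (g : RiemannianMetric K) (h : ∃ s ∈ K.faces, s.card = n + 1) : 0 < g.vol n := by
  obtain ⟨s, hsK, hs⟩ := h
  rw [RiemannianMetric.vol, volIntegral_eq]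
  simp only [one_mul]
  exact (lintegral_edgeDet_pos g hsK hs).trans_le (ENNReal.le_tsum
    (f := fun s : {s : Finset E // s ∈ K.faces ∧ s.card = n + 1} => ∫⁻ t in cornerSimplex n,
      ENNReal.ofReal (Real.sqrt (edgeDet s.2.2 (g.form s.1 (chart s.1 s.2.2 t)))))
    (⟨s, hsK, hs⟩ : {s : Finset E // s ∈ K.faces ∧ s.card = n + 1}))

/-- On a bounded set of forms the integrands in the volume are bounded. -/
theorem exists_edgeDet_le {s : Finset E} (hs : s.card = n + 1) (R : ℝ) :
    ∃ M : ℝ, ∀ A : E →L[ℝ] E →L[ℝ] ℝ, ‖A‖ ≤ R → Real.sqrt (edgeDet hs A) ≤ M := by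
  obtain ⟨c, hc⟩ := (Finset.univ.image fun i => ‖edge s hs i‖).exists_le
  have hc : ∀ i, ‖edge s hs i‖ ≤ max c 0 := fun i =>
    (hc _ (Finset.mem_image_of_mem _ (Finset.mem_univ i))).trans (le_max_left _ _)
  refine ⟨Real.sqrt (n.factorial • (max R 0 * max c 0 * max c 0) ^ n), fun A hA =>
    Real.sqrt_le_sqrt ((le_abs_self _).trans ?_)⟩
  have := Matrix.det_le (A := Matrix.of fun i j : Fin n => A (edge s hs i) (edge s hs j))
    (abv := AbsoluteValue.abs) (x := max R 0 * max c 0 * max c 0) fun i j => by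
      rw [AbsoluteValue.abs_apply, Matrix.of_apply, ← Real.norm_eq_abs]
      refine (A.le_opNorm₂ _ _).trans ?_
      gcongr
      · exact hA.trans (le_max_left _ _)
      · exact hc i
      · exact hc j
  simpa [edgeDet] using this

theorem exists_norm_form_le (hfin : K.faces.Finite) (g : RiemannianMetric K) :
    ∃ M : ℝ, 0 ≤ M ∧ ∀ s ∈ K.faces, ∀ x ∈ convexHull ℝ (s : Set E), ‖g.form s x‖ ≤ M := by
  have h : ∀ s ∈ K.faces, ∃ M : ℝ, ∀ x ∈ convexHull ℝ (s : Set E), ‖g.form s x‖ ≤ M := by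
    intro s hs
    have hcont : ContinuousOn (fun x => ‖g.form s x‖) (convexHull ℝ (s : Set E)) :=
      ContinuousOn.norm (E := E →L[ℝ] E →L[ℝ] ℝ) (g.smooth s hs).continuousOn
    obtain ⟨M, hM⟩ := (s.finite_toSet.isCompact_convexHull ℝ).bddAbove_image hcont
    exact ⟨M, fun x hx => hM (mem_image_of_mem _ hx)⟩
  choose! M hM using h
  obtain ⟨R, hR⟩ := (hfin.toFinset.image M).exists_le
  refine ⟨max R 0, le_max_right _ _, fun s hs x hx => (hM s hs x hx).trans
    ((hR _ (Finset.mem_image_of_mem _ (by simpa using hs))).trans (le_max_left _ _))⟩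

theorem vol_lt_top (hfin : K.faces.Finite) (g : RiemannianMetric K) (n : ℕ) :
    g.vol n < ⊤ := by
  have : Finite {s : Finset E // s ∈ K.faces ∧ s.card = n + 1} :=
    (hfin.subset fun s (hs : s ∈ K.faces ∧ s.card = n + 1) => hs.1).to_subtype
  cases nonempty_fintype {s : Finset E // s ∈ K.faces ∧ s.card = n + 1}
  obtain ⟨R, -, hR⟩ := exists_norm_form_le hfin g
  rw [RiemannianMetric.vol, volIntegral_eq, tsum_fintype, ENNReal.sum_lt_top]
  intro s _
  obtain ⟨M, hM⟩ := exists_edgeDet_le s.2.2 R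
  calc _ ≤ ∫⁻ _ in cornerSimplex n, ENNReal.ofReal M := by
        refine MeasureTheory.setLIntegral_mono' measurableSet_cornerSimplex fun t ht => ?_
        rw [one_mul]
        exact ENNReal.ofReal_le_ofReal (hM _ (hR _ s.2.1 _ (chart_mem s.2.2 ht)))
    _ < ⊤ := by
        rw [MeasureTheory.setLIntegral_const]
        exact ENNReal.mul_lt_top ENNReal.ofReal_lt_top volume_cornerSimplex_lt_top

end Volume

end SystolicEntropy

end


noncomputable section

set_option maxSynthPendingDepth 3

namespace SystolicEntropy

open Geometry (SimplicialComplex)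

variable {E : Type*} [NormedAddCommGroup E] [NormedSpace ℝ E]

/-! ### Restriction and extension of metrics -/

section

variable {K L : SimplicialComplex ℝ E} {n : ℕ}

/-- The restriction of a metric to a subcomplex. -/
def RiemannianMetric.restrict (g : RiemannianMetric L) (h : K.faces ⊆ L.faces) :
    RiemannianMetric K where
  form := g.form
  smooth s hs := g.smooth s (h hs)
  symm s hs := g.symm s (h hs)
  pos s hs := g.pos s (h hs)
  compat s hs t ht := g.compat s (h hs) t (h ht)

theorem volIntegral_restrict (g : RiemannianMetric L) (h : K.faces ⊆ L.faces)
    (hn : ∀ s ∈ L.faces, s.card = n + 1 → s ∈ K.faces) (f : E → ℝ≥0∞) :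
    (g.restrict h).volIntegral n f = g.volIntegral n f := by
  rw [volIntegral_eq, volIntegral_eq]
  let e : {s : Finset E // s ∈ K.faces ∧ s.card = n + 1} ≃
      {s : Finset E // s ∈ L.faces ∧ s.card = n + 1} :=
    Equiv.subtypeEquivRight fun s => ⟨fun hs => ⟨h hs.1, hs.2⟩, fun hs => ⟨hn s hs.1 hs.2, hs.2⟩⟩
  exact e.tsum_eq fun s => ∫⁻ t in cornerSimplex n, f (chart s.1 s.2.2 t) *
    ENNReal.ofReal (Real.sqrt (edgeDet s.2.2 (g.form s.1 (chart s.1 s.2.2 t))))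

theorem vol_restrict (g : RiemannianMetric L) (h : K.faces ⊆ L.faces)
    (hn : ∀ s ∈ L.faces, s.card = n + 1 → s ∈ K.faces) : (g.restrict h).vol n = g.vol n :=
  volIntegral_restrict g h hn _

/-- A Euclidean inner product is pulled back along a linear isomorphism and scaled by the squared
norm of the inverse, so as to dominate the norm. -/
theorem exists_innerForm [FiniteDimensional ℝ E] : ∃ B : E →L[ℝ] E →L[ℝ] ℝ,
    (∀ v w, B v w = B w v) ∧ ∀ v, ‖v‖ ^ 2 ≤ B v v := by
  let T : E ≃L[ℝ] EuclideanSpace ℝ (Fin (Module.finrank ℝ E)) := toEuclidean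
  refine ⟨(‖(T.symm : EuclideanSpace ℝ (Fin (Module.finrank ℝ E)) →L[ℝ] E)‖ ^ 2) •
    (innerSL ℝ).bilinearComp T.toContinuousLinearMap T.toContinuousLinearMap, fun v w => ?_, fun v => ?_⟩
  · simp [real_inner_comm]
  · have h := (T.symm : EuclideanSpace ℝ (Fin (Module.finrank ℝ E)) →L[ℝ] E).le_opNorm (T v)
    simp only [ContinuousLinearEquiv.coe_coe, ContinuousLinearEquiv.symm_apply_apply] at h
    have h2 := pow_le_pow_left₀ (norm_nonneg v) h 2
    rw [mul_pow] at h2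
    simpa using h2

/-- A function on the simplex `s` that is `1` on the boundary and that tends to `0` in the interior
as `j` tends to infinity. -/
def collar (s : Finset E) (j : ℕ) (x : E) : ℝ :=
  (1 - ∏ v ∈ s, simplexCoord s v x) ^ j

theorem collar_of_face [FiniteDimensional ℝ E] {s t : Finset E}
    (hs : AffineIndependent ℝ ((↑) : s → E)) (hts : t ⊂ s) {x : E}
    (hx : x ∈ convexHull ℝ (t : Set E)) (j : ℕ) : collar s j x = 1 := by
  obtain ⟨v, hv, hvt⟩ := Finset.exists_of_ssubset hts
  rw [collar, Finset.prod_eq_zero hv (simplexCoord_eq_zero_of_face hs hts.1 hx hvt), sub_zero,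
    one_pow]

theorem prod_simplexCoord_le_one [FiniteDimensional ℝ E] {s : Finset E}
    (hs : AffineIndependent ℝ ((↑) : s → E)) {x : E} (hx : x ∈ convexHull ℝ (s : Set E)) :
    ∏ v ∈ s, simplexCoord s v x ≤ 1 := by
  obtain ⟨h0, -, h1, -⟩ := simplexCoord_of_convexHull hs hx
  refine Finset.prod_le_one (fun v _ => h0 v) fun v hv => ?_
  rw [← h1]
  exact Finset.single_le_sum (fun w _ => h0 w) hv

theorem collar_mem [FiniteDimensional ℝ E] {s : Finset E} (hs : AffineIndependent ℝ ((↑) : s → E))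
    {x : E} (hx : x ∈ convexHull ℝ (s : Set E)) (j : ℕ) : 0 ≤ collar s j x ∧ collar s j x ≤ 1 := by
  have h1 := prod_simplexCoord_le_one hs hx
  have h0 : 0 ≤ ∏ v ∈ s, simplexCoord s v x :=
    Finset.prod_nonneg fun v _ => (simplexCoord_of_convexHull hs hx).1 v
  exact ⟨pow_nonneg (by linarith) j, pow_le_one₀ (by linarith) (by linarith)⟩

theorem tendsto_collar [FiniteDimensional ℝ E] {s : Finset E}
    (hs : AffineIndependent ℝ ((↑) : s → E)) {x : E} (hx : x ∈ convexHull ℝ (s : Set E))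
    (hpos : ∀ v ∈ s, 0 < simplexCoord s v x) :
    Tendsto (fun j => collar s j x) atTop (𝓝 0) := by
  have h1 := prod_simplexCoord_le_one hs hx
  have h0 : 0 < ∏ v ∈ s, simplexCoord s v x := Finset.prod_pos hpos
  exact tendsto_pow_atTop_nhds_zero_of_lt_one (by linarith) (by linarith)

theorem contDiff_collar [FiniteDimensional ℝ E] (s : Finset E) (j : ℕ) :
    ContDiff ℝ ∞ (collar s j) :=
  (contDiff_const.sub (contDiff_prod fun v _ => contDiff_simplexCoord s v)).pow j

open Classical in
/-- The form of the metric that is modified near the boundaries of the `n`-simplices and on the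
other simplices. -/
def stretchForm (g : RiemannianMetric K) (n : ℕ) (A : E →L[ℝ] E →L[ℝ] ℝ) (j : ℕ)
    (s : Finset E) (x : E) : E →L[ℝ] E →L[ℝ] ℝ :=
  if s ∈ K.faces ∧ s.card = n + 1 then
    (1 - collar s j x) • g.form s x + collar s j x • A
  else A

theorem stretchForm_of_face [FiniteDimensional ℝ E] (g : RiemannianMetric K) {n : ℕ}
    (A : E →L[ℝ] E →L[ℝ] ℝ) (j : ℕ) {s t : Finset E} (hs : AffineIndependent ℝ ((↑) : s → E))
    (hts : t ⊂ s) {x : E} (hx : x ∈ convexHull ℝ (t : Set E)) : stretchForm g n A j s x = A := by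
  rw [stretchForm]
  split_ifs
  · simp [collar_of_face hs hts hx]
  · rfl

/-- The metric with the modified form; all simplices of `L` that are not in `K` have dimension less
than `n`. -/
def RiemannianMetric.stretch [FiniteDimensional ℝ E] (g : RiemannianMetric K) (n : ℕ)
    (hL : ∀ s ∈ L.faces, s.card ≤ n + 1) (A : E →L[ℝ] E →L[ℝ] ℝ)
    (hsymm : ∀ v w, A v w = A w v) (hpos : ∀ v, v ≠ 0 → 0 < A v v) (j : ℕ) :
    RiemannianMetric L where
  form := stretchForm g n A j
  smooth s hs := by
    by_cases h : s ∈ K.faces ∧ s.card = n + 1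
    · have : stretchForm g n A j s =
          fun x => (1 - collar s j x) • g.form s x + collar s j x • A := by
        funext x
        rw [stretchForm, if_pos h]
      rw [this]
      have hc := (contDiff_collar s j).contDiffOn (s := convexHull ℝ (s : Set E))
      exact ((contDiffOn_const.sub hc).smul (g.smooth s h.1)).add (hc.smul contDiffOn_const)
    · have : stretchForm g n A j s = fun _ => A := by
        funext x
        rw [stretchForm, if_neg h]
      rw [this]
      exact contDiffOn_const
  symm s hs x hx v hv w hw := by
    rw [stretchForm]
    split_ifs with h
    · simp [g.symm s h.1 x hx v hv w hw, hsymm v w]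
    · exact hsymm v w
  pos s hs x hx v hv hv0 := by
    rw [stretchForm]
    split_ifs with h
    · have h1 := g.pos s h.1 x hx v hv hv0
      have h2 := hpos v hv0
      obtain ⟨hc0, hc1⟩ := collar_mem (L.indep hs) hx j
      simp only [add_apply, _root_.smul_apply, smul_eq_mul]
      rcases hc0.eq_or_lt with hc | hc
      · rw [← hc]
        simpa using h1
      · have : 0 ≤ (1 - collar s j x) * g.form s x v v := mul_nonneg (by linarith) h1.le
        positivity
    · exact hpos v hv0
  compat s hs t ht hts x hx v hv w hw := by
    rcases eq_or_ssubset_of_subset hts with rfl | h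
    · rfl
    -- On a proper face both sides are `A`: the collar function is `1` there, and the face is not an
    -- `n`-simplex.
    · rw [stretchForm_of_face g A j (L.indep hs) h hx, stretchForm, if_neg]
      rintro ⟨-, hc⟩
      have := Finset.card_lt_card h
      have := hL s hs
      omega

/-- In the interiors of the `n`-simplices, hence almost everywhere, the forms converge to those of
`g`; dominated convergence applies. -/
theorem tendsto_vol_stretch [FiniteDimensional ℝ E] (hfin : K.faces.Finite) (g : RiemannianMetric K)
    (n : ℕ) (hK : ∀ s ∈ K.faces, s.card ≤ n + 1) (A : E →L[ℝ] E →L[ℝ] ℝ)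
    (hsymm : ∀ v w, A v w = A w v) (hpos : ∀ v, v ≠ 0 → 0 < A v v) :
    Tendsto (fun j => (g.stretch n hK A hsymm hpos j).vol n) atTop (𝓝 (g.vol n)) := by
  have : Finite {s : Finset E // s ∈ K.faces ∧ s.card = n + 1} :=
    (hfin.subset fun s (hs : s ∈ K.faces ∧ s.card = n + 1) => hs.1).to_subtype
  cases nonempty_fintype {s : Finset E // s ∈ K.faces ∧ s.card = n + 1}
  simp only [RiemannianMetric.vol, volIntegral_eq, tsum_fintype, one_mul]
  refine tendsto_finsetSum _ fun ⟨s, hsK, hs⟩ _ => ?_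
  obtain ⟨R, hR0, hR⟩ := exists_norm_form_le hfin g
  obtain ⟨M, hM⟩ := exists_edgeDet_le hs (R + ‖A‖)
  have hform : ∀ j x, (g.stretch n hK A hsymm hpos j).form s x =
      (1 - collar s j x) • g.form s x + collar s j x • A := fun j x => if_pos ⟨hsK, hs⟩
  refine MeasureTheory.tendsto_lintegral_of_dominated_convergence' (fun _ => ENNReal.ofReal M)
    (fun j => ?_) (fun j => ?_) ?_ ?_
  · refine (ContinuousOn.aemeasurable ?_ measurableSet_cornerSimplex).ennreal_ofReal
    exact (Real.continuous_sqrt.comp (continuous_edgeDet hs)).comp_continuousOn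
      (continuousOn_form_chart _ hsK hs)
  · filter_upwards [MeasureTheory.ae_restrict_mem measurableSet_cornerSimplex] with t ht
    refine ENNReal.ofReal_le_ofReal (hM _ ?_)
    have hx := chart_mem hs ht
    obtain ⟨hc0, hc1⟩ := collar_mem (K.indep hsK) hx j
    rw [hform]
    refine (norm_add_le _ _).trans (add_le_add ?_ ?_)
    · rw [norm_smul, Real.norm_of_nonneg (by linarith)]
      exact (mul_le_of_le_one_left (norm_nonneg _) (by linarith)).trans (hR s hsK _ hx)
    · rw [norm_smul, Real.norm_of_nonneg hc0]
      exact mul_le_of_le_one_left (norm_nonneg _) hc1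
  · rw [MeasureTheory.setLIntegral_const]
    exact (ENNReal.mul_lt_top ENNReal.ofReal_lt_top volume_cornerSimplex_lt_top).ne
  · filter_upwards [ae_cornerSimplex_interior, MeasureTheory.ae_restrict_mem
      measurableSet_cornerSimplex] with t ht htm
    have hc := tendsto_collar (K.indep hsK) (chart_mem hs htm) fun v hv =>
      simplexCoord_chart_pos hs (K.indep hsK) ht.1 ht.2 hv
    have hlim : Tendsto (fun j => (g.stretch n hK A hsymm hpos j).form s (chart s hs t)) atTop
        (𝓝 (g.form s (chart s hs t))) := by
      simp_rw [hform]
      have := (((tendsto_const_nhds (x := (1 : ℝ))).sub hc).smul_const (g.form s (chart s hs t))).add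
        (hc.smul_const A)
      simpa using this
    exact (ENNReal.continuous_ofReal.tendsto _).comp
      (((Real.continuous_sqrt.comp (continuous_edgeDet hs)).tendsto _).comp hlim)

/-- A metric on `K` can be approximated by metrics that are larger, that have almost the same volume,
and that extend to `L` such that the simplices outside `K` are arbitrarily large. -/
theorem exists_metric_extension [FiniteDimensional ℝ E] (hKL : K.faces ⊆ L.faces)
    (hfin : L.faces.Finite) (hK : ∀ s ∈ K.faces, s.card ≤ n + 1)
    (hL : ∀ s ∈ L.faces, s ∉ K.faces → s.card ≤ n) (g : RiemannianMetric K) (Λ : ℝ) {ε : ℝ≥0∞}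
    (hε : ε ≠ 0) :
    ∃ g' : RiemannianMetric L,
      (∀ s ∈ K.faces, ∀ x ∈ convexHull ℝ (s : Set E), ∀ v, g.form s x v v ≤ g'.form s x v v) ∧
      (∀ s ∈ L.faces, s ∉ K.faces → ∀ x ∈ convexHull ℝ (s : Set E), ∀ v,
        Λ ^ 2 * ‖v‖ ^ 2 ≤ g'.form s x v v) ∧
      g'.vol n ≤ g.vol n + ε := by
  have hfinK := hfin.subset hKL
  obtain ⟨B, hBsymm, hB⟩ := exists_innerForm (E := E)
  obtain ⟨M, hM0, hM⟩ := exists_norm_form_le hfinK g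
  -- `M` makes `A` dominate `g`, `Λ ^ 2` gives the lower bound outside `K`, and `1` ensures
  -- definiteness.
  set A : E →L[ℝ] E →L[ℝ] ℝ := (M + Λ ^ 2 + 1) • B with hA
  have hAv : ∀ v, (M + Λ ^ 2 + 1) * ‖v‖ ^ 2 ≤ A v v := fun v => by
    rw [hA, _root_.smul_apply, _root_.smul_apply, smul_eq_mul]
    exact mul_le_mul_of_nonneg_left (hB v) (by positivity)
  have hsymm : ∀ v w, A v w = A w v := fun v w => by simp [hA, hBsymm v w]
  have hpos : ∀ v, v ≠ 0 → 0 < A v v := fun v hv => by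
    have : 0 < ‖v‖ := norm_pos_iff.2 hv
    exact lt_of_lt_of_le (by positivity) (hAv v)
  have hgA : ∀ s ∈ K.faces, ∀ x ∈ convexHull ℝ (s : Set E), ∀ v, g.form s x v v ≤ A v v := by
    intro s hs x hx v
    calc g.form s x v v ≤ ‖g.form s x v v‖ := Real.le_norm_self _
      _ ≤ ‖g.form s x‖ * ‖v‖ * ‖v‖ := (g.form s x).le_opNorm₂ v v
      _ ≤ M * ‖v‖ * ‖v‖ := by gcongr; exact hM s hs x hx
      _ ≤ (M + Λ ^ 2 + 1) * ‖v‖ ^ 2 := by nlinarith [sq_nonneg Λ, sq_nonneg ‖v‖]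
      _ ≤ A v v := hAv v
  have hL' : ∀ s ∈ L.faces, s.card ≤ n + 1 := fun s hs => by
    by_cases h : s ∈ K.faces
    · exact hK s h
    · exact (hL s hs h).trans (Nat.le_succ n)
  have hlt : g.vol n < g.vol n + ε := ENNReal.lt_add_right (vol_lt_top hfinK g n).ne hε
  obtain ⟨j, hj⟩ := ((tendsto_vol_stretch hfinK g n hK A hsymm hpos).eventually_lt_const hlt).exists
  refine ⟨g.stretch n hL' A hsymm hpos j, fun s hs x hx v => ?_, fun s hs hsK x hx v => ?_, ?_⟩
  · change _ ≤ stretchForm g n A j s x v v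
    rw [stretchForm]
    have h1 := hgA s hs x hx v
    split_ifs with h
    · obtain ⟨hc0, hc1⟩ := collar_mem (K.indep hs) hx j
      simp only [add_apply, _root_.smul_apply, smul_eq_mul]
      nlinarith
    · exact h1
  · change _ ≤ stretchForm g n A j s x v v
    rw [stretchForm, if_neg fun h => hsK h.1]
    exact le_trans (by nlinarith [sq_nonneg ‖v‖]) (hAv v)
  · refine le_of_eq_of_le ?_ hj.le
    refine (vol_restrict _ hKL fun s hs hc => ?_).symm
    by_contra h
    have := hL s hs h
    omega

end

end SystolicEntropy

end


noncomputable section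

namespace SystolicEntropy

open Geometry (SimplicialComplex)

variable {E : Type*} [NormedAddCommGroup E] [NormedSpace ℝ E]

/-! ### The curve system of a complex and a subcomplex -/

section Pair

variable {K L : SimplicialComplex ℝ E} {π : Type*} [Group π]

/-- A path in a subcomplex as a path in the complex. -/
def pathIncl (h : K.faces ⊆ L.faces) {x y : K.space} (γ : Path x y) :
    Path (inclusionMap h x) (inclusionMap h y) :=
  γ.map (inclusionMap h).continuous

theorem pathIncl_trans (h : K.faces ⊆ L.faces) {x y z : K.space} (γ : Path x y) (γ' : Path y z) :
    pathIncl h (γ.trans γ') = (pathIncl h γ).trans (pathIncl h γ') :=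
  Path.map_trans _ _ _

theorem pathIncl_symm (h : K.faces ⊆ L.faces) {x y : K.space} (γ : Path x y) :
    pathIncl h γ.symm = (pathIncl h γ).symm :=
  (Path.map_symm _ _).symm

theorem pathIncl_homotopic (h : K.faces ⊆ L.faces) {x y : K.space} {γ γ' : Path x y}
    (hγ : γ.Homotopic γ') : (pathIncl h γ).Homotopic (pathIncl h γ') :=
  hγ.map (inclusionMap h)

theorem loopClass_comp_map (h : K.faces ⊆ L.faces) {x₀ : K.space}
    (ψ : FundamentalGroup L.space (inclusionMap h x₀) →* π) (γ : Path x₀ x₀) :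
    loopClass (ψ.comp (FundamentalGroup.map (inclusionMap h) x₀)) γ =
      loopClass ψ (pathIncl h γ) := rfl

theorem exists_form_le (hfin : K.faces.Finite) (g : RiemannianMetric K) :
    ∃ M : ℝ, 0 ≤ M ∧ ∀ s ∈ K.faces, ∀ x ∈ convexHull ℝ (s : Set E), ∀ v,
      g.form s x v v ≤ M ^ 2 * ‖v‖ ^ 2 := by
  obtain ⟨M, hM0, hM⟩ := exists_norm_form_le hfin g
  refine ⟨M + 1, by positivity, fun s hs x hx v => ?_⟩
  calc g.form s x v v ≤ ‖g.form s x v v‖ := Real.le_norm_self _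
    _ ≤ ‖g.form s x‖ * ‖v‖ * ‖v‖ := (g.form s x).le_opNorm₂ v v
    _ ≤ M * ‖v‖ * ‖v‖ := by gcongr; exact hM s hs x hx
    _ ≤ (M + 1) ^ 2 * ‖v‖ ^ 2 := by nlinarith [sq_nonneg M, sq_nonneg ‖v‖, mul_nonneg hM0 (sq_nonneg ‖v‖), mul_nonneg (mul_nonneg hM0 hM0) (sq_nonneg ‖v‖)]

/-- The points of a connected complex are connected to the base point by curves of finite length. -/
theorem exists_reach (hfin : K.faces.Finite) (hconn : IsConnected K.space) (g : RiemannianMetric K)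
    (x₀ x : K.space) :
    ∃ p : Path x₀ x, ∃ ℓ, 0 ≤ ℓ ∧ Reach g p ℓ ∧ Reach g p.symm ℓ := by
  obtain ⟨M, hM0, hM⟩ := exists_form_le hfin g
  -- A simplex that meets `R` lies in `R`. So the simplices meeting `R` and the others form two
  -- disjoint closed sets that cover `|K|`, and connectedness applies.
  let R : Set E := {y | ∃ hy : y ∈ K.space, ∃ p : Path x₀ ⟨y, hy⟩, ∃ ℓ, 0 ≤ ℓ ∧
    Reach g p ℓ ∧ Reach g p.symm ℓ}
  have hseg : ∀ s ∈ K.faces, ∀ y ∈ convexHull ℝ (s : Set E), ∀ z ∈ convexHull ℝ (s : Set E),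
      y ∈ R → z ∈ R := by
    rintro s hs y hy z hz ⟨hyK, p, ℓ, hℓ, h1, h2⟩
    have hzK := SimplicialComplex.convexHull_subset_space hs hz
    let σ' : Path (⟨y, hyK⟩ : K.space) ⟨z, hzK⟩ := segPath (segment_subset_space hs hy hz)
    have hσ : ∀ t, (σ' t : E) ∈ convexHull ℝ (s : Set E) := segPath_mem _ hy hz
    have h3 := Reach.of_mem_convexHull hM0 hs (hM s hs) hσ
    have h4 := Reach.of_mem_convexHull (γ := σ'.symm) hM0 hs (hM s hs) fun t => hσ _
    refine ⟨hzK, p.trans σ', ℓ + M * ‖y - z‖, by positivity, h1.trans h3 hℓ (by positivity), ?_⟩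
    rw [Path.trans_symm, add_comm]
    rw [norm_sub_rev] at h4
    exact h4.trans h2 (by positivity) hℓ
  have hclosed : ∀ F : Set (Finset E), F ⊆ K.faces → IsClosed (⋃ s ∈ F, convexHull ℝ (s : Set E)) :=
    fun F hF => (hfin.subset hF).isClosed_biUnion fun s _ => (s.finite_toSet.isCompact_convexHull ℝ).isClosed
  let F₁ : Set (Finset E) := {s ∈ K.faces | (convexHull ℝ (s : Set E) ∩ R).Nonempty}
  let F₂ : Set (Finset E) := {s ∈ K.faces | ¬ (convexHull ℝ (s : Set E) ∩ R).Nonempty}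
  have hF₁ : ∀ y ∈ ⋃ s ∈ F₁, convexHull ℝ (s : Set E), y ∈ R := by
    intro y hy
    obtain ⟨s, ⟨hs, z, hzs, hzR⟩, hys⟩ := mem_iUnion₂.1 hy
    exact hseg s hs z hzs y hys hzR
  have hx₀ : (x₀ : E) ∈ R := by
    obtain ⟨s, hs, hxs⟩ := SimplicialComplex.mem_space_iff.1 x₀.2
    have h := Reach.of_mem_convexHull (γ := Path.refl x₀) hM0 hs (hM s hs) (fun t => hxs)
    rw [sub_self, norm_zero, mul_zero] at h
    exact ⟨x₀.2, Path.refl x₀, 0, le_rfl, h, h⟩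
  have hxR : (x : E) ∈ R := by
    obtain ⟨s, hs, hxs⟩ := SimplicialComplex.mem_space_iff.1 x.2
    by_contra hx
    have hdisj := isPreconnected_closed_iff.1 hconn.isPreconnected _ _ (hclosed F₁ fun s hs => hs.1)
      (hclosed F₂ fun s hs => hs.1) (fun y hy => ?_) ?_ ?_
    · obtain ⟨y, -, hy1, hy2⟩ := hdisj
      obtain ⟨t, ⟨ht, hne⟩, hyt⟩ := mem_iUnion₂.1 hy2
      exact hne ⟨y, hyt, hF₁ y hy1⟩
    · obtain ⟨t, ht, hyt⟩ := SimplicialComplex.mem_space_iff.1 hy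
      by_cases h : (convexHull ℝ (t : Set E) ∩ R).Nonempty
      · exact .inl (mem_biUnion (show t ∈ F₁ from ⟨ht, h⟩) hyt)
      · exact .inr (mem_biUnion (show t ∈ F₂ from ⟨ht, h⟩) hyt)
    · obtain ⟨t, ht, hyt⟩ := SimplicialComplex.mem_space_iff.1 x₀.2
      exact ⟨x₀, x₀.2, mem_biUnion (show t ∈ F₁ from ⟨ht, x₀, hyt, hx₀⟩) hyt⟩
    · refine ⟨x, x.2, mem_biUnion (show s ∈ F₂ from ⟨hs, ?_⟩) hxs⟩
      rintro ⟨z, hzs, hzR⟩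
      exact hx (hseg s hs z hzs x hxs hzR)
  obtain ⟨_, p, ℓ, h⟩ := hxR
  exact ⟨p, ℓ, h⟩

theorem segPath_self {x : L.space} (h : segment ℝ (x : E) x ⊆ L.space) :
    segPath h = Path.refl x := by
  ext t
  simp [segPath]

open Classical in
/-- The label of a straight path in `|L|`. -/
def segLabel {x₀ : L.space} (ψ : FundamentalGroup L.space x₀ →* π)
    (q : ∀ x, Joined x₀ x → Path x₀ x) (x y : E) : π :=
  if h : x ∈ L.space ∧ y ∈ L.space ∧ segment ℝ x y ⊆ L.space then
    holonomy ψ q (segPath (x := (⟨x, h.1⟩ : L.space)) (y := (⟨y, h.2.1⟩ : L.space)) h.2.2)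
  else 1

theorem holonomy_eq_segLabel {x₀ : L.space} (ψ : FundamentalGroup L.space x₀ →* π)
    (q : ∀ x, Joined x₀ x → Path x₀ x) {s : Finset E} (hs : s ∈ L.faces) {x y : L.space}
    (γ : Path x y) (hγ : ∀ t, (γ t : E) ∈ convexHull ℝ (s : Set E)) :
    holonomy ψ q γ = segLabel ψ q x y := by
  have hx : (x : E) ∈ convexHull ℝ (s : Set E) := by simpa using hγ 0
  have hy : (y : E) ∈ convexHull ℝ (s : Set E) := by simpa using hγ 1
  have hseg := segment_subset_space hs hx hy
  rw [segLabel, dif_pos ⟨x.2, y.2, hseg⟩]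
  exact holonomy_congr (homotopic_of_mem_convexHull hs _ _ hγ (segPath_mem hseg hx hy))

/-! ### Frames normalized at vertices -/

variable [FiniteDimensional ℝ E]

theorem segment_topVertex_subset {s : Finset E} (hs : s ∈ L.faces) {x : E}
    (hx : x ∈ convexHull ℝ (s : Set E)) : segment ℝ (topVertex L x) x ⊆ convexHull ℝ (s : Set E) :=
  (convex_convexHull ℝ (s : Set E)).segment_subset
    (subset_convexHull ℝ _ (by exact_mod_cast topVertex_mem hs hx)) hx

/-- The point `topVertex L x` of `|L|`. -/
def topPoint (x : L.space) : L.space :=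
  ⟨topVertex L x, by
    obtain ⟨s, hs, hxs⟩ := SimplicialComplex.mem_space_iff.1 x.2
    exact SimplicialComplex.subset_space hs (by exact_mod_cast topVertex_mem hs hxs)⟩

theorem segment_topPoint_subset (x : L.space) : segment ℝ (topPoint x : E) x ⊆ L.space := by
  obtain ⟨s, hs, hxs⟩ := SimplicialComplex.mem_space_iff.1 x.2
  exact (segment_topVertex_subset hs hxs).trans (SimplicialComplex.convexHull_subset_space hs)

theorem topPoint_topPoint (x : L.space) : topPoint (topPoint x) = topPoint x := by
  obtain ⟨s, hs, hxs⟩ := SimplicialComplex.mem_space_iff.1 x.2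
  exact Subtype.ext (topVertex_vertex hs (topVertex_mem hs hxs))

theorem topVertex_mem_space (h : K.faces ⊆ L.faces) (x : K.space) : topVertex L x ∈ K.space := by
  obtain ⟨s, hs, hxs⟩ := SimplicialComplex.mem_space_iff.1 x.2
  exact SimplicialComplex.subset_space hs (by exact_mod_cast topVertex_mem (h hs) hxs)

open Classical in
/-- Paths from the base point to the points of `|L|`, which in `|K|` are the given ones. -/
def frameBase (h : K.faces ⊆ L.faces) {x₀ : K.space} (p : ∀ x, Path x₀ x) (v : L.space)
    (hv : Joined (inclusionMap h x₀) v) : Path (inclusionMap h x₀) v :=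
  if hK : (v : E) ∈ K.space then pathIncl h (p ⟨v, hK⟩) else hv.somePath

/-- Paths from the base point to the points of `|L|` whose last part is the straight path from a
vertex. -/
def frame (h : K.faces ⊆ L.faces) {x₀ : K.space} (p : ∀ x, Path x₀ x) (x : L.space)
    (hx : Joined (inclusionMap h x₀) x) : Path (inclusionMap h x₀) x :=
  (frameBase h p (topPoint x) (hx.trans ⟨(segPath (segment_topPoint_subset x)).symm⟩)).trans
    (segPath (segment_topPoint_subset x))

/-- At points of `K` the frame runs inside `K`; thus it turns curves in `K` into loops in `K`, whose
lengths can be measured by `g`. -/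
theorem frame_inclusionMap (h : K.faces ⊆ L.faces) {x₀ : K.space} (p : ∀ x, Path x₀ x) (x : K.space)
    (hx : Joined (inclusionMap h x₀) (inclusionMap h x))
    (hseg : segment ℝ (topVertex L x) (x : E) ⊆ K.space) :
    frame h p (inclusionMap h x) hx =
      pathIncl h ((p ⟨topVertex L x, topVertex_mem_space h x⟩).trans (segPath hseg)) := by
  rw [pathIncl_trans]
  exact congrArg (fun r : Path (inclusionMap h x₀) (topPoint (inclusionMap h x)) =>
    r.trans (segPath (segment_topPoint_subset (inclusionMap h x)))) (dif_pos (topVertex_mem_space h x))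

theorem holonomy_segPath_topPoint (h : K.faces ⊆ L.faces) {x₀ : K.space} (p : ∀ x, Path x₀ x)
    (ψ : FundamentalGroup L.space (inclusionMap h x₀) →* π) (x : L.space) :
    holonomy ψ (frame h p) (segPath (segment_topPoint_subset x)) = 1 := by
  by_cases hx : Joined (inclusionMap h x₀) x
  · have hv : Joined (inclusionMap h x₀) (topPoint x) :=
      hx.trans ⟨(segPath (segment_topPoint_subset x)).symm⟩
    -- A variable end point `u` allows substitution in the types of the paths. The frame at a top
    -- point then ends with a constant path.
    have key : ∀ (u : L.space) (hu : u = topPoint x) (hju : Joined (inclusionMap h x₀) u)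
        (hs : segment ℝ (u : E) (topPoint x) ⊆ L.space),
        ((frameBase h p u hju).trans (segPath hs)).Homotopic (frameBase h p (topPoint x) hv) := by
      rintro u rfl hju hs
      rw [segPath_self]
      exact ⟨Path.Homotopy.transRefl _⟩
    have h1 : (frame h p (topPoint x) hv).Homotopic (frameBase h p (topPoint x) hv) :=
      key _ (topPoint_topPoint x) _ _
    rw [holonomy_of_joined _ hv hx, inv_eq_one, ← loopClass_refl ψ]
    apply loopClass_congr
    refine ((h1.hcomp (.refl _)).hcomp (.refl _)).trans ?_
    exact ⟨(Path.Homotopy.reflTransSymm _).symm⟩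
  · have hv : ¬ Joined (inclusionMap h x₀) (topPoint x) := fun hv =>
      hx (hv.trans ⟨segPath (segment_topPoint_subset x)⟩)
    simp [holonomy, hv]

/-- The curve system of a metric on a subcomplex. -/
def curveSystem (h : K.faces ⊆ L.faces) {x₀ : K.space} (p : ∀ x, Path x₀ x)
    (ψ : FundamentalGroup L.space (inclusionMap h x₀) →* π) (g : RiemannianMetric K) {M : ℝ}
    (hM0 : 0 ≤ M) (hM : ∀ s ∈ K.faces, ∀ x ∈ convexHull ℝ (s : Set E), ∀ v,
      g.form s x v v ≤ M ^ 2 * ‖v‖ ^ 2) : CurveSystem K L π where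
  le := h
  seg := segLabel ψ (frame h p)
  seg_mul s hs x hx y hy z hz := by
    have mem := SimplicialComplex.convexHull_subset_space hs
    let γ : Path (⟨x, mem hx⟩ : L.space) ⟨y, mem hy⟩ := segPath (segment_subset_space hs hx hy)
    let γ' : Path (⟨y, mem hy⟩ : L.space) ⟨z, mem hz⟩ := segPath (segment_subset_space hs hy hz)
    have h1 : ∀ t, (γ t : E) ∈ convexHull ℝ (s : Set E) := segPath_mem _ hx hy
    have h2 : ∀ t, (γ' t : E) ∈ convexHull ℝ (s : Set E) := segPath_mem _ hy hz
    have h3 := holonomy_eq_segLabel ψ (frame h p) hs γ h1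
    have h4 := holonomy_eq_segLabel ψ (frame h p) hs γ' h2
    have h5 := holonomy_eq_segLabel ψ (frame h p) hs (γ.trans γ')
      fun t => trans_mem (U := {u : L.space | (u : E) ∈ convexHull ℝ (s : Set E)}) h1 h2 t
    rw [holonomy_trans, h3, h4] at h5
    exact h5
  seg_topVertex x hx := by
    rw [segLabel, dif_pos ⟨(topPoint ⟨x, hx⟩).2, hx, segment_topPoint_subset ⟨x, hx⟩⟩]
    exact holonomy_segPath_topPoint h p ψ ⟨x, hx⟩
  step x y a ℓ := 0 ≤ ℓ ∧ ∃ (hx : x ∈ K.space) (hy : y ∈ K.space)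
    (γ : Path (⟨x, hx⟩ : K.space) ⟨y, hy⟩), Reach g γ ℓ ∧
      holonomy ψ (frame h p) (pathIncl h γ) = a
  step_mem := fun ⟨hℓ, hx, hy, _⟩ => ⟨hx, hy, hℓ⟩
  step_mono := fun ⟨hℓ, hx, hy, γ, hγ, ha⟩ hle => ⟨hℓ.trans hle, hx, hy, γ, hγ.mono hle, ha⟩
  step_mul := fun ⟨hℓ, hx, hy, γ, hγ, ha⟩ ⟨hℓ', _, hz, γ', hγ', ha'⟩ =>
    ⟨add_nonneg hℓ hℓ', hx, hz, γ.trans γ', hγ.trans hγ' hℓ hℓ', by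
      rw [pathIncl_trans, holonomy_trans, ha, ha']⟩
  slope := M
  slope_nonneg := hM0
  step_seg s hs x hx y hy := by
    have mem := SimplicialComplex.convexHull_subset_space hs
    let γ : Path (⟨x, mem hx⟩ : K.space) ⟨y, mem hy⟩ := segPath (segment_subset_space hs hx hy)
    have h1 : ∀ t, (γ t : E) ∈ convexHull ℝ (s : Set E) := segPath_mem _ hx hy
    exact ⟨by positivity, mem hx, mem hy, γ, Reach.of_mem_convexHull hM0 hs (hM s hs) h1,
      holonomy_eq_segLabel ψ (frame h p) (h hs) (pathIncl h γ) h1⟩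

end Pair

end SystolicEntropy

end


noncomputable section

namespace SystolicEntropy

open Geometry (SimplicialComplex)

variable {E : Type*} [NormedAddCommGroup E] [NormedSpace ℝ E]

/-! ### Decomposition of piecewise smooth curves -/

section Subdivision

variable {K L : SimplicialComplex ℝ E} {π : Type*} [Group π]

theorem CurveSystem.chain_seg (S : CurveSystem K L π) {δ Λ : ℝ} (hδ : 0 < δ) {s : Finset E}
    (hs : s ∈ L.faces) {x y : E} (hx : x ∈ convexHull ℝ (s : Set E))
    (hy : y ∈ convexHull ℝ (s : Set E)) : S.Chain δ Λ y x (S.seg x y) (Λ * ‖x - y‖) := by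
  obtain ⟨N, hN⟩ := exists_nat_ge (‖x - y‖ / δ)
  rw [div_le_iff₀ hδ] at hN
  induction N generalizing x with
  | zero =>
    have hxy : x = y := by
      rw [Nat.cast_zero, zero_mul] at hN
      exact sub_eq_zero.1 (norm_le_zero_iff.1 hN)
    subst hxy
    rw [S.seg_self hs hx, sub_self, norm_zero, mul_zero]
    exact .nil (SimplicialComplex.convexHull_subset_space hs hx)
  | succ N ih =>
    have hN0 : (0 : ℝ) < N + 1 := by positivity
    -- One of `N + 1` equal pieces is split off.
    set c : ℝ := 1 / (N + 1) with hc
    have hc0 : 0 ≤ c := by positivity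
    have hc1 : c ≤ 1 := by rw [hc, div_le_one hN0]; linarith [(Nat.cast_nonneg N : (0 : ℝ) ≤ N)]
    set z := AffineMap.lineMap x y c with hz
    have hzs : z ∈ convexHull ℝ (s : Set E) :=
      (convex_convexHull ℝ (s : Set E)).segment_subset hx hy (by
        rw [segment_eq_image_lineMap]
        exact mem_image_of_mem _ ⟨hc0, hc1⟩)
    have h1 : ‖x - z‖ = c * ‖x - y‖ := by
      rw [← dist_eq_norm, ← dist_eq_norm, hz, dist_left_lineMap, Real.norm_of_nonneg hc0]
    have h2 : ‖z - y‖ = (1 - c) * ‖x - y‖ := by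
      rw [← dist_eq_norm, ← dist_eq_norm, hz, dist_lineMap_right,
        Real.norm_of_nonneg (sub_nonneg.2 hc1)]
    push_cast at hN
    have h3 : ‖x - z‖ ≤ δ := by
      rw [h1, hc, one_div, inv_mul_le_iff₀ hN0]
      exact hN
    have h4 : ‖z - y‖ ≤ N * δ := by
      calc ‖z - y‖ = (1 - c) * ‖x - y‖ := h2
        _ ≤ (1 - c) * ((N + 1) * δ) := by
          exact mul_le_mul_of_nonneg_left hN (sub_nonneg.2 hc1)
        _ = N * δ := by rw [hc]; field_simp; ring
    have h5 := Chain.thin (S := S) hs hx hzs h3 (ih hzs h4)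
    rw [S.seg_mul s hs x hx z hzs y hy, ← mul_add, h1, h2, ← add_mul, add_sub_cancel, one_mul] at h5
    exact h5

theorem ofReal_mul_norm_le_lintegral_speed {B : E → E →L[ℝ] E →L[ℝ] ℝ} {Λ : ℝ} (hΛ : 0 ≤ Λ)
    {ρ : ℝ → E} {a b : ℝ} (hab : a ≤ b) (hρ : ContDiffOn ℝ ∞ ρ (Icc a b))
    (hB : ∀ u ∈ Icc a b, ∀ v, Λ ^ 2 * ‖v‖ ^ 2 ≤ B (ρ u) v v) :
    ENNReal.ofReal (Λ * ‖ρ a - ρ b‖) ≤ ∫⁻ u in Icc a b, speed B ρ u := by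
  have h1 := enorm_sub_le_lintegral_deriv_of_contDiffOn_Icc (hρ.of_le (by simp)) hab
  rw [ENNReal.ofReal_mul hΛ, norm_sub_rev, ofReal_norm]
  calc ENNReal.ofReal Λ * ‖ρ b - ρ a‖ₑ ≤ ENNReal.ofReal Λ * ∫⁻ u in Icc a b, ‖deriv ρ u‖ₑ := by
        gcongr
    _ = ∫⁻ u in Icc a b, ENNReal.ofReal Λ * ‖deriv ρ u‖ₑ :=
        (MeasureTheory.lintegral_const_mul' _ _ ENNReal.ofReal_ne_top).symm
    _ ≤ _ := by
        refine MeasureTheory.setLIntegral_mono' measurableSet_Icc fun u hu => ?_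
        rw [speed, ← ofReal_norm, ← ENNReal.ofReal_mul hΛ]
        refine ENNReal.ofReal_le_ofReal (Real.le_sqrt_of_sq_le ?_)
        rw [mul_pow]
        exact hB u hu _

variable [FiniteDimensional ℝ E]

section

variable {h : K.faces ⊆ L.faces} {x₀ : K.space} {p : ∀ x, Path x₀ x}
  {ψ : FundamentalGroup L.space (inclusionMap h x₀) →* π} {g : RiemannianMetric K} {M : ℝ}
  {hM0 : 0 ≤ M} {hM : ∀ s ∈ K.faces, ∀ x ∈ convexHull ℝ (s : Set E), ∀ v,
      g.form s x v v ≤ M ^ 2 * ‖v‖ ^ 2} {g' : RiemannianMetric L} {δ Λ : ℝ}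

/-- A piece in a simplex of `K` is one step of the chain, and its length with respect to `g` is no
larger. A piece in another simplex is replaced by its chord, subdivided into thin segments. -/
theorem exists_chain_of_contDiffOn (hδ : 0 < δ) (hΛ : 0 ≤ Λ)
    (hK : ∀ s ∈ K.faces, ∀ x ∈ convexHull ℝ (s : Set E), ∀ v, g.form s x v v ≤ g'.form s x v v)
    (hL : ∀ s ∈ L.faces, s ∉ K.faces → ∀ x ∈ convexHull ℝ (s : Set E), ∀ v,
      Λ ^ 2 * ‖v‖ ^ 2 ≤ g'.form s x v v)
    {s : Finset E} (hs : s ∈ L.faces) {ρ : ℝ → E} {a b : ℝ} (hab : a ≤ b)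
    (hρ : ContDiffOn ℝ ∞ ρ (Icc a b)) (hm : ∀ u ∈ Icc a b, ρ u ∈ convexHull ℝ (s : Set E))
    {x y : L.space} (hx : (x : E) = ρ a) (hy : (y : E) = ρ b) (γ : Path x y)
    (hγ : ∀ t, (γ t : E) ∈ convexHull ℝ (s : Set E))
    (hfin : ∫⁻ u in Icc a b, speed (g'.form s) ρ u ≠ ⊤) :
    ∃ ℓ, 0 ≤ ℓ ∧ ENNReal.ofReal ℓ ≤ ∫⁻ u in Icc a b, speed (g'.form s) ρ u ∧
      (curveSystem h p ψ g hM0 hM).Chain δ Λ y x (holonomy ψ (frame h p) γ) ℓ := by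
  have hxs : (x : E) ∈ convexHull ℝ (s : Set E) := by simpa using hγ 0
  have hys : (y : E) ∈ convexHull ℝ (s : Set E) := by simpa using hγ 1
  by_cases hsK : s ∈ K.faces
  · refine ⟨(∫⁻ u in Icc a b, speed (g'.form s) ρ u).toReal, ENNReal.toReal_nonneg,
      ENNReal.ofReal_toReal_le, ?_⟩
    have mem := SimplicialComplex.convexHull_subset_space hsK
    let γ' : Path (⟨x, mem hxs⟩ : K.space) ⟨y, mem hys⟩ := segPath (segment_subset_space hsK hxs hys)
    have h1 : ∀ t, (γ' t : E) ∈ convexHull ℝ (s : Set E) := segPath_mem _ hxs hys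
    have h2 : Reach g γ' (∫⁻ u in Icc a b, speed (g'.form s) ρ u).toReal := by
      refine Reach.of_contDiffOn hsK hab hρ hm hx hy h1 ?_
      rw [ENNReal.ofReal_toReal hfin]
      refine MeasureTheory.setLIntegral_mono' measurableSet_Icc fun u hu => ?_
      exact ENNReal.ofReal_le_ofReal (Real.sqrt_le_sqrt (hK s hsK _ (hm u hu) _))
    have h3 : holonomy ψ (frame h p) (pathIncl h γ') = holonomy ψ (frame h p) γ :=
      holonomy_congr (homotopic_of_mem_convexHull hs _ _ h1 hγ)
    have h4 : (curveSystem h p ψ g hM0 hM).step x y (holonomy ψ (frame h p) γ)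
        (∫⁻ u in Icc a b, speed (g'.form s) ρ u).toReal :=
      ⟨ENNReal.toReal_nonneg, mem hxs, mem hys, γ', h2, h3⟩
    have h5 := CurveSystem.Chain.step (δ := δ) (Λ := Λ) h4 (.nil y.2)
    rwa [mul_one, add_zero] at h5
  · refine ⟨Λ * ‖(x : E) - y‖, by positivity, ?_, ?_⟩
    · rw [hx, hy]
      exact ofReal_mul_norm_le_lintegral_speed hΛ hab hρ fun u hu => hL s hs hsK _ (hm u hu)
    · rw [holonomy_eq_segLabel ψ (frame h p) hs γ hγ]
      exact (curveSystem h p ψ g hM0 hM).chain_seg hδ hs hxs hys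

theorem exists_chain (hδ : 0 < δ) (hΛ : 0 ≤ Λ)
    (hK : ∀ s ∈ K.faces, ∀ x ∈ convexHull ℝ (s : Set E), ∀ v, g.form s x v v ≤ g'.form s x v v)
    (hL : ∀ s ∈ L.faces, s ∉ K.faces → ∀ x ∈ convexHull ℝ (s : Set E), ∀ v,
      Λ ^ 2 * ‖v‖ ^ 2 ≤ g'.form s x v v)
    {x y : L.space} {γ : Path x y} (P : SmoothPieces γ) (hP : g'.length P ≠ ⊤) :
    ∃ ℓ, ENNReal.ofReal ℓ ≤ g'.length P ∧
      (curveSystem h p ψ g hM0 hM).Chain δ Λ y x (holonomy ψ (frame h p) γ) ℓ := by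
  set c : ℕ → ℝ≥0∞ := fun i => ∫⁻ u in Icc (P.time i) (P.time (i + 1)),
    speed (g'.form (P.face i)) (fun u => (γ.extend u : E)) u with hc
  have hlen : g'.length P = ∑ i ∈ Finset.range P.num, c i := rfl
  have hfin : ∀ i < P.num, c i ≠ ⊤ := fun i hi htop => by
    apply hP
    rw [hlen, ENNReal.sum_eq_top]
    exact ⟨i, Finset.mem_range.2 hi, htop⟩
  let T : ℕ → I := fun i => projIcc 0 1 zero_le_one (P.time i)
  have hT : ∀ i ≤ P.num, ((T i : I) : ℝ) = P.time i := fun i hi => by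
    simp only [T]
    rw [projIcc_of_mem _ (P.time_mem hi)]
  have hγT : ∀ i, γ (T i) = γ.extend (P.time i) := fun i => rfl
  have hmono : ∀ i, T i ≤ T (i + 1) := fun i => monotone_projIcc _ (P.mono (Nat.le_succ i))
  -- The induction runs downwards, over the parts of the curve from the `k`-th subdivision point to
  -- the end.
  have key : ∀ k ≤ P.num, ∃ ℓ, 0 ≤ ℓ ∧ ENNReal.ofReal ℓ ≤ ∑ i ∈ Finset.Ico k P.num, c i ∧
      (curveSystem h p ψ g hM0 hM).Chain δ Λ (γ (T P.num)) (γ (T k))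
        (holonomy ψ (frame h p) (γ.subpath (T k) (T P.num))) ℓ := by
    intro k hk
    induction hk using Nat.decreasingInduction with
    | self =>
      refine ⟨0, le_rfl, by simp, ?_⟩
      rw [Path.subpath_self, holonomy_refl]
      exact .nil (Subtype.prop _)
    | of_succ k hk ih =>
      obtain ⟨ℓ, hℓ0, hℓ, hch⟩ := ih
      have hmem : ∀ t, (γ.subpath (T k) (T (k + 1)) t : E) ∈ convexHull ℝ (P.face k : Set E) := by
        intro t
        have : γ.subpath (T k) (T (k + 1)) t ∈ range (γ.subpath (T k) (T (k + 1))) :=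
          mem_range_self t
        rw [Path.range_subpath_of_le _ _ _ (hmono k)] at this
        obtain ⟨u, hu, hut⟩ := this
        rw [← hut]
        have := P.maps k hk u ⟨by rw [← hT k hk.le]; exact hu.1, by rw [← hT (k + 1) hk]; exact hu.2⟩
        rwa [Path.extend_apply _ u.2] at this
      obtain ⟨ℓ', hℓ0', hℓ', hch'⟩ := exists_chain_of_contDiffOn (h := h) (p := p) (ψ := ψ)
        (hM0 := hM0) (hM := hM) hδ hΛ hK hL (P.face_mem k hk)
        (P.mono (Nat.le_succ k)) (P.smooth k hk) (P.maps k hk) (x := γ (T k)) (y := γ (T (k + 1)))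
        rfl rfl (γ.subpath (T k) (T (k + 1))) hmem (hfin k hk)
      refine ⟨ℓ' + ℓ, add_nonneg hℓ0' hℓ0, ?_, ?_⟩
      · rw [ENNReal.ofReal_add hℓ0' hℓ0, Finset.sum_eq_sum_Ico_succ_bot hk]
        exact add_le_add hℓ' hℓ
      · rw [← holonomy_congr ⟨Path.Homotopy.subpathTransSubpath γ (T k) (T (k + 1)) (T P.num)⟩,
          holonomy_trans]
        exact hch'.append hch
  obtain ⟨ℓ, -, hℓ, hch⟩ := key 0 (Nat.zero_le _)
  refine ⟨ℓ, by rwa [hlen, Finset.range_eq_Ico], ?_⟩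
  have h0 : T 0 = 0 := Subtype.ext (by rw [hT 0 (Nat.zero_le _), P.time_zero]; rfl)
  have h1 : T P.num = 1 := Subtype.ext (by rw [hT _ le_rfl, P.time_num]; rfl)
  rw [h0, h1, Path.subpath_zero_one] at hch
  have hcast : ∀ {x' y' : L.space} (hx : x' = x) (hy : y' = y),
      holonomy ψ (frame h p) (γ.cast hx hy) = holonomy ψ (frame h p) γ := by
    rintro _ _ rfl rfl
    rfl
  rwa [hcast, γ.source, γ.target] at hch

end

end Subdivision

end SystolicEntropy

end


noncomputable section

namespace SystolicEntropy

open Geometry (SimplicialComplex)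

variable {E : Type*} [NormedAddCommGroup E] [NormedSpace ℝ E]

/-! ### Noncontractible curves in a subcomplex -/

section Noncontractible

variable {K L : SimplicialComplex ℝ E} {π : Type*} [Group π]

/-- Any path may be made part of a frame, and by `noncontractible_iff` the frame does not matter. -/
theorem Noncontractible.loopClass_ne {x₀ : K.space} {φ : FundamentalGroup K.space x₀ →* π}
    {x : K.space} {γ : Path x x} (hγ : Noncontractible φ γ) (p : Path x₀ x) :
    loopClass φ ((p.trans γ).trans p.symm) ≠ 1 := by
  classical
  let q : ∀ z, Joined x₀ z → Path x₀ z := fun z hz => if e : z = x then p.cast rfl e else hz.somePath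
  have hq : q x ⟨p⟩ = p := dif_pos rfl
  have h := (noncontractible_iff (q := q) γ).1 hγ
  rw [holonomy_of_joined γ ⟨p⟩ ⟨p⟩, hq] at h
  simpa using h

theorem noncontractible_pathIncl (h : K.faces ⊆ L.faces) {x₀ : K.space}
    {ψ : FundamentalGroup L.space (inclusionMap h x₀) →* π} {x : K.space} (hx : Joined x₀ x)
    {γ : Path x x} :
    Noncontractible ψ (pathIncl h γ) ↔
      Noncontractible (ψ.comp (FundamentalGroup.map (inclusionMap h) x₀)) γ := by
  have key : ∀ p : Path x₀ x, loopClass (ψ.comp (FundamentalGroup.map (inclusionMap h) x₀))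
      ((p.trans γ).trans p.symm) =
        loopClass ψ (((pathIncl h p).trans (pathIncl h γ)).trans (pathIncl h p).symm) := fun p => by
    rw [loopClass_comp_map, pathIncl_trans, pathIncl_trans, pathIncl_symm]
  constructor
  · intro hγ
    obtain ⟨p⟩ := hx
    exact ⟨p, by rw [key]; exact hγ.loopClass_ne _⟩
  · rintro ⟨p, hp⟩
    exact ⟨pathIncl h p, by rwa [← key]⟩

end Noncontractible

/-! ### The Galois covering -/

namespace GaloisCover

variable {K : SimplicialComplex ℝ E} {π : Type*} [Group π] {x₀ : K.space}
  {φ : FundamentalGroup K.space x₀ →* π}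

theorem mk_eq_iff {y : K.space} {p p' : Path x₀ y} :
    mk φ p = mk φ p' ↔ loopClass φ (p.trans p'.symm) = 1 := by
  constructor
  · intro h
    exact Quotient.exact (s := coverSetoid φ y) (eq_of_heq (Sigma.mk.inj_iff.1 h).2)
  · intro h
    exact congrArg (Sigma.mk y) (Quotient.sound (s := coverSetoid φ y) h)

theorem loopClass_trans_symm_self {y : K.space} (p : Path x₀ y) :
    loopClass φ (p.trans p.symm) = 1 :=
  (coverSetoid φ y).refl p

theorem mk_congr {y : K.space} {p p' : Path x₀ y} (h : p.Homotopic p') : mk φ p = mk φ p' := by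
  rw [mk_eq_iff, ← loopClass_trans_symm_self (φ := φ) p]
  exact loopClass_congr φ ((Path.Homotopic.refl p).hcomp h.symm₂.symm)

theorem loopClass_trans_trans_symm {y : K.space} (l l' : Path x₀ x₀) (r : Path x₀ y) :
    loopClass φ ((l.trans r).trans (l'.trans r).symm) = (loopClass φ l')⁻¹ * loopClass φ l := by
  rw [← loopClass_symm, ← loopClass_trans]
  apply loopClass_congr
  apply homotopic_of_mk_eq
  simp only [Path.Homotopic.Quotient.mk_trans, Path.Homotopic.Quotient.mk_symm,
    Path.Homotopic.Quotient.trans_assoc, Path.trans_symm]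
  rw [← Path.Homotopic.Quotient.trans_assoc (Path.Homotopic.Quotient.mk r),
    Path.Homotopic.Quotient.trans_symm, Path.Homotopic.Quotient.refl_trans]

/-- Holonomy embeds each fibre of the covering into `π`, so points in fibres can be counted as
labels. -/
theorem mk_eq_iff_holonomy_eq {q : ∀ x, Joined x₀ x → Path x₀ x} {y : K.space} {p p' : Path x₀ y} :
    mk φ p = mk φ p' ↔ holonomy φ q p = holonomy φ q p' := by
  have h : Joined x₀ x₀ := .refl _
  set l := q x₀ h
  rw [holonomy_eq_iff h, mk_eq_iff]
  have : loopClass φ ((l.trans p).trans (l.trans p').symm) =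
      (loopClass φ l)⁻¹ * loopClass φ (p.trans p'.symm) * loopClass φ l := by
    rw [← loopClass_symm, ← loopClass_trans, ← loopClass_trans]
    apply loopClass_congr
    apply homotopic_of_mk_eq
    simp only [Path.Homotopic.Quotient.mk_trans, Path.Homotopic.Quotient.mk_symm,
      Path.Homotopic.Quotient.trans_assoc, Path.trans_symm]
  rw [this]
  constructor
  · intro h
    simp [h]
  · intro h
    rwa [mul_assoc, inv_mul_eq_one, right_eq_mul] at h

theorem mem_ball_base {g : RiemannianMetric K} {r : ℝ} {a : GaloisCover φ} :
    a ∈ ball g (mk φ (Path.refl x₀)) r ↔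
      ∃ (z : K.space) (γ : Path x₀ z) (P : SmoothPieces γ),
        a = mk φ γ ∧ g.length P < ENNReal.ofReal r := by
  have key : ∀ {z : K.space} (p : Path x₀ x₀) (γ : Path x₀ z),
      mk φ (Path.refl x₀) = mk φ p → mk φ (p.trans γ) = mk φ γ := by
    intro z p γ hp
    have h1 : mk φ γ = mk φ ((Path.refl x₀).trans γ) :=
      mk_congr ⟨(Path.Homotopy.reflTrans γ).symm⟩
    rw [mk_eq_iff, loopClass_trans, loopClass_refl, mul_one, loopClass_symm, inv_eq_one] at hp
    rw [h1, mk_eq_iff, loopClass_trans_trans_symm, hp, loopClass_refl, inv_one, one_mul]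
  constructor
  · rintro ⟨y, z, p, γ, P, hc, rfl, hP⟩
    obtain rfl : x₀ = y := congrArg Sigma.fst hc
    exact ⟨z, γ, P, key p γ hc, hP⟩
  · rintro ⟨z, γ, P, rfl, hP⟩
    exact ⟨x₀, z, Path.refl x₀, γ, P, rfl, (key _ γ rfl).symm, hP⟩

end GaloisCover

/-! ### Volume entropy and exponential growth -/

section Entropy

variable {K : SimplicialComplex ℝ E} {π : Type*} [Group π] {x₀ : K.space}
  {φ : FundamentalGroup K.space x₀ →* π} {g : RiemannianMetric K} {n : ℕ}

theorem eventually_vol_ball_le {h : ℝ} (hh : volumeEntropy n φ g < h) :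
    ∃ r₀, 0 ≤ r₀ ∧ ∀ r ≥ r₀, GaloisCover.vol g n
      (GaloisCover.ball g (GaloisCover.mk φ (Path.refl x₀)) r) ≤ ENNReal.ofReal (Real.exp (h * r)) := by
  have h1 := eventually_lt_of_limsup_lt hh
  obtain ⟨r₀, hr₀⟩ := eventually_atTop.1 h1
  refine ⟨max r₀ 1, by positivity, fun r hr => ?_⟩
  have hr1 : (0 : ℝ) < r := lt_of_lt_of_le one_pos ((le_max_right _ _).trans hr)
  have h2 := hr₀ r ((le_max_left _ _).trans hr)
  rw [EReal.div_lt_iff (by exact_mod_cast hr1) (EReal.coe_ne_top r), ← EReal.coe_mul] at h2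
  have h3 := EReal.exp_monotone h2.le
  rwa [ENNReal.exp_log, EReal.exp_coe] at h3

theorem volumeEntropy_le {C h h' : ℝ} (hh : h < h') (hvol : ∀ r ≥ 0, GaloisCover.vol g n
      (GaloisCover.ball g (GaloisCover.mk φ (Path.refl x₀)) r) ≤
        ENNReal.ofReal (C * Real.exp (h * r))) : volumeEntropy n φ g ≤ h' := by
  refine limsup_le_of_le (h := ?_)
  have h1 : Tendsto (fun r : ℝ => Real.exp ((h' - h) * r)) atTop atTop :=
    Real.tendsto_exp_atTop.comp (tendsto_id.const_mul_atTop (sub_pos.2 hh))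
  -- The slack between `h` and `h'` eventually absorbs the factor `C`.
  filter_upwards [h1.eventually_ge_atTop C, eventually_gt_atTop 0] with r hC hr
  rw [EReal.div_le_iff_le_mul (by exact_mod_cast hr) (EReal.coe_ne_top r), ← EReal.coe_mul]
  rw [← EReal.log_exp ((r * h' : ℝ) : EReal), ENNReal.log_le_log_iff, EReal.exp_coe]
  refine (hvol r hr.le).trans (ENNReal.ofReal_le_ofReal ?_)
  calc C * Real.exp (h * r) ≤ Real.exp ((h' - h) * r) * Real.exp (h * r) := by gcongr
    _ = _ := by rw [← Real.exp_add]; ring_nf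

end Entropy

/-! ### The metrics on the complex -/

theorem CardLE.of_forall_finset {α : Type*} {s : Set α} {c : ℝ}
    (h : ∀ F : Finset α, (F : Set α) ⊆ s → (F.card : ℝ) ≤ c) : CardLE s c := by
  have hfin : s.Finite := by
    by_contra hs
    obtain ⟨N, hN⟩ := exists_nat_gt c
    obtain ⟨F, hF, hFN⟩ := Set.Infinite.exists_subset_card_eq hs N
    exact absurd (h F hF) (by rw [hFN]; exact not_le.2 hN)
  exact ⟨hfin.toFinset, by simp, h _ (by simp)⟩

section Pair

variable [FiniteDimensional ℝ E] {K L : SimplicialComplex ℝ E} {π : Type*} [Group π]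
  {h : K.faces ⊆ L.faces} {x₀ : K.space} {p : ∀ x, Path x₀ x}
  {ψ : FundamentalGroup L.space (inclusionMap h x₀) →* π} {g : RiemannianMetric K} {M : ℝ}
  {hM0 : 0 ≤ M} {hM : ∀ s ∈ K.faces, ∀ x ∈ convexHull ℝ (s : Set E), ∀ v,
      g.form s x v v ≤ M ^ 2 * ‖v‖ ^ 2} {g' : RiemannianMetric L} {δ Λ : ℝ}

/-- Below length `Λ * δ`, `Chain.exists_step` moves a noncontractible curve into `K`. -/
theorem min_systole_le (hS : (curveSystem h p ψ g hM0 hM).IsControlled δ Λ) (hΛ : 0 < Λ)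
    (hK : ∀ s ∈ K.faces, ∀ x ∈ convexHull ℝ (s : Set E), ∀ v, g.form s x v v ≤ g'.form s x v v)
    (hL : ∀ s ∈ L.faces, s ∉ K.faces → ∀ x ∈ convexHull ℝ (s : Set E), ∀ v,
      Λ ^ 2 * ‖v‖ ^ 2 ≤ g'.form s x v v) :
    min (systole (ψ.comp (FundamentalGroup.map (inclusionMap h) x₀)) g) (ENNReal.ofReal (Λ * δ)) ≤
      systole ψ g' := by
  refine le_iInf fun y => le_iInf fun γ => le_iInf fun hγ => le_iInf fun P => ?_
  rcases le_or_gt (ENNReal.ofReal (Λ * δ)) (g'.length P) with hP | hP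
  · exact (min_le_right _ _).trans hP
  · obtain ⟨ℓ, hℓ, hch⟩ := exists_chain (h := h) (p := p) (ψ := ψ) (hM0 := hM0) (hM := hM) hS.pos
      hΛ.le hK hL P hP.ne_top
    have hℓ' : ℓ < Λ * δ :=
      (ENNReal.ofReal_lt_ofReal_iff (mul_pos hΛ hS.pos)).1 (hℓ.trans_lt hP)
    obtain ⟨z, b, hb, -, hz, _, γ₁, ⟨γ₂, hγ₂, P₂, hP₂⟩, hhol⟩ :=
      hch.exists_step hS hΛ ((noncontractible_iff γ).1 hγ) hℓ'
    refine (min_le_left _ _).trans ((?_ : _ ≤ g.length P₂).trans (hP₂.trans hℓ))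
    refine iInf_le_of_le ⟨z, hz⟩ (iInf_le_of_le γ₂ (iInf_le_of_le ?_ (iInf_le _ P₂)))
    rw [← noncontractible_pathIncl h ⟨p _⟩, noncontractible_iff (q := frame h p),
      holonomy_congr (pathIncl_homotopic h hγ₂), hhol]
    exact hb

theorem exists_frame_eq (x : K.space) (hx : Joined (inclusionMap h x₀) (inclusionMap h x)) :
    ∃ (hv : topVertex L (x : E) ∈ K.space) (hseg : segment ℝ (topVertex L (x : E)) (x : E) ⊆ K.space),
      frame h p (inclusionMap h x) hx =
        pathIncl h ((p ⟨topVertex L (x : E), hv⟩).trans (segPath hseg)) := by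
  obtain ⟨s, hs, hxs⟩ := SimplicialComplex.mem_space_iff.1 x.2
  have hseg := (segment_topVertex_subset (h hs) hxs).trans
    (SimplicialComplex.convexHull_subset_space hs)
  exact ⟨_, hseg, frame_inclusionMap h p x hx hseg⟩

end Pair

end SystolicEntropy

end


noncomputable section

namespace SystolicEntropy

open Geometry (SimplicialComplex)

variable {E : Type*} [NormedAddCommGroup E] [NormedSpace ℝ E]

/-! ### Counting -/

theorem mem_of_card_eq {K L : SimplicialComplex ℝ E} {n : ℕ}
    (hL : ∀ s ∈ L.faces, s ∉ K.faces → s.card ≤ n) :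
    ∀ s ∈ L.faces, s.card = n + 1 → s ∈ K.faces := fun s hs hcard => by
  by_contra hsK
  have := hL s hs hsK
  omega

theorem CardLE.image {α β : Type*} {s : Set α} {c : ℝ} (hs : CardLE s c) (f : α → β) :
    CardLE (f '' s) c := by
  classical
  obtain ⟨F, hF, hFc⟩ := hs
  refine ⟨F.image f, by rw [Finset.coe_image]; exact image_mono hF, ?_⟩
  exact le_trans (by exact_mod_cast Finset.card_image_le) hFc

theorem CardLE.nonneg {α : Type*} {s : Set α} {c : ℝ} (hs : CardLE s c) : 0 ≤ c := by
  obtain ⟨F, -, hF⟩ := hs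
  exact (Nat.cast_nonneg _).trans hF

/-- The number of the elements of `π` that are given by loops of length at most `w` is bounded by the
volume of balls in the covering. -/
theorem exists_cardLE_loopClass {K : SimplicialComplex ℝ E} {π : Type*} [Group π] {x₀ : K.space}
    {φ : FundamentalGroup K.space x₀ →* π} {g : RiemannianMetric K} {n : ℕ} (hV : 0 < g.vol n)
    (hV' : g.vol n < ⊤) {c : ℝ} (hc : 0 ≤ c) (hr : ∀ y, ∃ r : Path x₀ y, Reach g r c) {h : ℝ}
    (hent : volumeEntropy n φ g < h) :
    ∃ A, 0 ≤ A ∧ ∀ w, 0 ≤ w →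
      CardLE {a | ∃ l, Reach g l w ∧ loopClass φ l = a} (A * Real.exp (h * w)) := by
  obtain ⟨r₀, hr₀, hvol⟩ := eventually_vol_ball_le hent
  have hV0 : 0 < (g.vol n).toReal := ENNReal.toReal_pos hV.ne' hV'.ne
  refine ⟨Real.exp (h * (c + 1 + r₀)) / (g.vol n).toReal, by positivity, fun w hw =>
    CardLE.of_forall_finset fun F hF => ?_⟩
  -- `w + c` is the length of a loop followed by a path to `y`, `1` makes the inequality strict, and
  -- `r₀` brings the radius into the range of the volume bound.
  set R := w + c + 1 + r₀ with hR
  have h1 : (F.card : ℝ≥0∞) * g.vol n ≤ ENNReal.ofReal (Real.exp (h * R)) := by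
    refine le_trans ?_ (hvol R (by linarith))
    rw [← volIntegral_const g n (ENNReal.natCast_ne_top _)]
    refine volIntegral_mono g n fun y hy => ?_
    obtain ⟨r, hr⟩ := hr ⟨y, hy⟩
    have hl : ∀ a : π, ∃ l : Path x₀ x₀, a ∈ F → Reach g l w ∧ loopClass φ l = a := fun a => by
      by_cases ha : a ∈ F
      · obtain ⟨l, hl⟩ := hF ha
        exact ⟨l, fun _ => hl⟩
      · exact ⟨Path.refl _, fun h => absurd h ha⟩
    choose l hl using hl
    have h2 : (F : Set π).encard ≤
        {a ∈ GaloisCover.ball g (GaloisCover.mk φ (Path.refl x₀)) R | (a.1 : E) = y}.encard := by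
      -- Loops with different classes, followed by the same path, end at different points of the
      -- fibre; so every fibre of the ball has at least `F.card` points.
      refine encard_le_encard_of_injOn (f := fun a => GaloisCover.mk φ ((l a).trans r)) ?_ ?_
      · intro a ha
        refine ⟨GaloisCover.mem_ball_base.2 ?_, rfl⟩
        obtain ⟨γ, hγ, P, hP⟩ := (hl a ha).1.trans hr hw hc
        refine ⟨_, γ, P, GaloisCover.mk_congr hγ.symm, hP.trans_lt ?_⟩
        exact (ENNReal.ofReal_lt_ofReal_iff (by linarith)).2 (by linarith)
      · intro a ha b hb hab
        rw [GaloisCover.mk_eq_iff, GaloisCover.loopClass_trans_trans_symm, (hl a ha).2,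
          (hl b hb).2, inv_mul_eq_one] at hab
        exact hab.symm
    rw [encard_coe_eq_coe_finsetCard] at h2
    exact_mod_cast h2
  rw [div_mul_eq_mul_div, ← Real.exp_add, le_div_iff₀ hV0]
  have h3 := ENNReal.toReal_mono ENNReal.ofReal_ne_top h1
  rw [ENNReal.toReal_mul, ENNReal.toReal_natCast, ENNReal.toReal_ofReal (Real.exp_nonneg _)] at h3
  refine h3.trans (le_of_eq ?_)
  rw [hR]
  ring_nf

section Pair

variable [FiniteDimensional ℝ E] {K L : SimplicialComplex ℝ E} {π : Type*} [Group π]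

/-- A uniform bound exists because the paths pass through one of finitely many vertices and end with
a straight segment. -/
theorem exists_paths (h : K.faces ⊆ L.faces) (hfin : K.faces.Finite) (hconn : IsConnected K.space)
    (g : RiemannianMetric K) (x₀ : K.space) :
    ∃ (p : ∀ x, Path x₀ x) (c : ℝ), 0 ≤ c ∧ ∀ (x : K.space) (hv : topVertex L (x : E) ∈ K.space)
      (hseg : segment ℝ (topVertex L (x : E)) (x : E) ⊆ K.space),
      Reach g ((p ⟨topVertex L (x : E), hv⟩).trans (segPath hseg)) c ∧
        Reach g ((p ⟨topVertex L (x : E), hv⟩).trans (segPath hseg)).symm c := by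
  obtain ⟨M, hM0, hM⟩ := exists_form_le hfin g
  choose p ℓ hℓ0 hp hp' using exists_reach hfin hconn g x₀
  obtain ⟨c, hc⟩ := (((CurveSystem.finite_vertices hfin).preimage
    (Subtype.val_injective (p := (· ∈ K.space))).injOn).image ℓ).bddAbove
  have hbdd : Bornology.IsBounded K.space :=
    (Bornology.isBounded_biUnion hfin).2 fun s _ => (s.finite_toSet.isCompact_convexHull ℝ).isBounded
  obtain ⟨D, hD⟩ := Metric.isBounded_iff.1 hbdd
  refine ⟨p, max c 0 + M * max D 0, by positivity, fun x hv hseg => ?_⟩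
  obtain ⟨s, hs, hxs⟩ := SimplicialComplex.mem_space_iff.1 x.2
  have hvs := topVertex_mem (h hs) hxs
  have hvs' : topVertex L (x : E) ∈ convexHull ℝ (s : Set E) :=
    subset_convexHull ℝ _ (by exact_mod_cast hvs)
  have hc' : ℓ ⟨topVertex L (x : E), hv⟩ ≤ max c 0 :=
    (hc (mem_image_of_mem ℓ (CurveSystem.mem_vertices_of_mem hs hvs))).trans (le_max_left _ _)
  have hD' : ‖topVertex L (x : E) - x‖ ≤ max D 0 := by
    rw [← dist_eq_norm]
    exact (hD hv x.2).trans (le_max_left _ _)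
  set r : Path (⟨topVertex L (x : E), hv⟩ : K.space) x := segPath hseg
  have hr : ∀ t, (r t : E) ∈ convexHull ℝ (s : Set E) := segPath_mem _ hvs' hxs
  have h1 : Reach g r (M * max D 0) :=
    (Reach.of_mem_convexHull hM0 hs (hM s hs) hr).mono (by dsimp only; gcongr)
  have h2 : Reach g r.symm (M * max D 0) :=
    (Reach.of_mem_convexHull (γ := r.symm) hM0 hs (hM s hs) fun t => hr _).mono (by
      rw [norm_sub_rev]; dsimp only; gcongr)
  refine ⟨((hp _).mono hc').trans h1 (by positivity) (by positivity), ?_⟩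
  rw [Path.trans_symm, add_comm]
  exact h2.trans ((hp' _).mono hc') (by positivity) (by positivity)

variable {h : K.faces ⊆ L.faces} {x₀ : K.space} {p : ∀ x, Path x₀ x}
  {ψ : FundamentalGroup L.space (inclusionMap h x₀) →* π} {g : RiemannianMetric K} {M : ℝ}
  {hM0 : 0 ≤ M} {hM : ∀ s ∈ K.faces, ∀ x ∈ convexHull ℝ (s : Set E), ∀ v,
      g.form s x v v ≤ M ^ 2 * ‖v‖ ^ 2} {g' : RiemannianMetric L} {δ Λ : ℝ}

theorem curveSystem_step_subset {c v : ℝ} (hc : 0 ≤ c)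
    (hp : ∀ (x : K.space) (hv : topVertex L (x : E) ∈ K.space)
      (hseg : segment ℝ (topVertex L (x : E)) (x : E) ⊆ K.space),
      Reach g ((p ⟨topVertex L (x : E), hv⟩).trans (segPath hseg)) c ∧
        Reach g ((p ⟨topVertex L (x : E), hv⟩).trans (segPath hseg)).symm c) :
    {a | ∃ x z, (curveSystem h p ψ g hM0 hM).step x z a v} ⊆ (·⁻¹) '' {a | ∃ l,
      Reach g l (c + v + c) ∧
        loopClass (ψ.comp (FundamentalGroup.map (inclusionMap h) x₀)) l = a} := by
  rintro a ⟨x, z, hv0, hx, hz, γ, hγ, rfl⟩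
  have hjoin : ∀ y : K.space, Joined (inclusionMap h x₀) (inclusionMap h y) :=
    fun y => ⟨pathIncl h (p y)⟩
  obtain ⟨hvx, hsx, hfx⟩ := exists_frame_eq (p := p) ⟨x, hx⟩ (hjoin _)
  obtain ⟨hvz, hsz, hfz⟩ := exists_frame_eq (p := p) ⟨z, hz⟩ (hjoin _)
  refine ⟨_, ⟨_, ((hp ⟨x, hx⟩ hvx hsx).1.trans hγ hc hv0).trans (hp ⟨z, hz⟩ hvz hsz).2
    (add_nonneg hc hv0) hc, rfl⟩, ?_⟩
  rw [holonomy_of_joined _ (hjoin _) (hjoin _), hfx, hfz, loopClass_comp_map, pathIncl_trans,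
    pathIncl_trans, pathIncl_symm]

theorem vol_ball_le (hS : (curveSystem h p ψ g hM0 hM).IsControlled δ Λ)
    (hK : ∀ s ∈ K.faces, ∀ x ∈ convexHull ℝ (s : Set E), ∀ v, g.form s x v v ≤ g'.form s x v v)
    (hL : ∀ s ∈ L.faces, s ∉ K.faces → ∀ x ∈ convexHull ℝ (s : Set E), ∀ v,
      Λ ^ 2 * ‖v‖ ^ 2 ≤ g'.form s x v v) {n : ℕ}
    (hn : ∀ s ∈ L.faces, s.card = n + 1 → s ∈ K.faces) {r B : ℝ}
    (hB : CardLE (image2 (· * ·) (curveSystem h p ψ g hM0 hM).edgeLabels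
      {a | (curveSystem h p ψ g hM0 hM).Word (Λ * δ) a r}) B) :
    GaloisCover.vol g' n (GaloisCover.ball g'
      (GaloisCover.mk ψ (Path.refl (inclusionMap h x₀))) r) ≤ ENNReal.ofReal B * g'.vol n := by
  rw [GaloisCover.vol, ← volIntegral_restrict g' h hn, ← vol_restrict g' h hn,
    ← volIntegral_const _ n ENNReal.ofReal_ne_top]
  -- After passing to the integral over `K` only fibres over points of `K` remain, and for these the
  -- decomposition into words is available.
  refine volIntegral_mono _ n fun x hx => le_trans ?_ hB.encard_le
  have h1 : {a ∈ GaloisCover.ball g' (GaloisCover.mk ψ (Path.refl (inclusionMap h x₀))) r |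
      (a.1 : E) = x}.encard ≤ (image2 (· * ·) (curveSystem h p ψ g hM0 hM).edgeLabels
      {a | (curveSystem h p ψ g hM0 hM).Word (Λ * δ) a r}).encard := by
    refine encard_le_encard_of_injOn
      (f := fun a : GaloisCover ψ => holonomy ψ (frame h p) a.2.out) ?_ ?_
    · rintro a ⟨ha, hax⟩
      obtain ⟨z, γ, P, rfl, hP⟩ := GaloisCover.mem_ball_base.1 ha
      obtain ⟨ℓ, hℓ, hch⟩ := exists_chain (h := h) (p := p) (ψ := ψ) (hM0 := hM0) (hM := hM)
        hS.pos hS.nonneg hK hL P hP.ne_top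
      have hzK : (z : E) ∈ K.space := by rw [show (z : E) = x from hax]; exact hx
      obtain ⟨f, hf, b, v, hw, hfb, hvℓ⟩ := hch.exists_word hS hzK
      have hℓr : ℓ ≤ r := by
        by_contra! hlt
        exact absurd ((ENNReal.ofReal_le_ofReal hlt.le).trans hℓ) (not_le.2 hP)
      exact ⟨f, hf, b, hw.mono (hvℓ.trans hℓr), hfb.symm.trans
        (GaloisCover.mk_eq_iff_holonomy_eq.1 (congrArg (Sigma.mk z) (Quotient.out_eq _))).symm⟩
    · rintro ⟨y, Q⟩ ⟨-, hy⟩ ⟨y', Q'⟩ ⟨-, hy'⟩ heq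
      obtain rfl : y = y' := Subtype.ext (hy.trans hy'.symm)
      have h2 := GaloisCover.mk_eq_iff_holonomy_eq.2 heq
      have h3 : GaloisCover.mk ψ Q.out = ⟨y, Q⟩ := congrArg (Sigma.mk y) (Quotient.out_eq Q)
      have h4 : GaloisCover.mk ψ Q'.out = ⟨y, Q'⟩ := congrArg (Sigma.mk y) (Quotient.out_eq Q')
      rw [← h3, ← h4]
      exact h2
  exact_mod_cast h1

/-- Metrics on a subcomplex can be extended such that neither the volume nor the volume entropy
increases much, and such that the systole does not decrease. -/
theorem exists_extension_metric (h : K.faces ⊆ L.faces) (hfin : L.faces.Finite)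
    (hconn : IsConnected K.space) {n : ℕ} (hdim : HasDimension K n)
    (hL : ∀ s ∈ L.faces, s ∉ K.faces → s.card ≤ n) {x₀ : K.space}
    (ψ : FundamentalGroup L.space (inclusionMap h x₀) →* π) (g : RiemannianMetric K) (R H : ℝ)
    {ε : ℝ≥0∞} (hε : ε ≠ 0) :
    ∃ g' : RiemannianMetric L, g'.vol n ≤ g.vol n + ε ∧
      min (systole (ψ.comp (FundamentalGroup.map (inclusionMap h) x₀)) g) (ENNReal.ofReal R) ≤
        systole ψ g' ∧
      (0 < H → volumeEntropy n (ψ.comp (FundamentalGroup.map (inclusionMap h) x₀)) g < H →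
        volumeEntropy n ψ g' ≤ H) := by
  have hfinK := hfin.subset h
  obtain ⟨M, hM0, hM⟩ := exists_form_le hfinK g
  obtain ⟨p, c, hc, hp⟩ := exists_paths h hfinK hconn g x₀
  let S := curveSystem h p ψ g hM0 hM
  -- `S`, `δ`, `Λ₀` and below `D₀` are fixed before `g'`, so `Λ` can be chosen large in terms of
  -- them.
  obtain ⟨δ, Λ₀, hS⟩ := CurveSystem.exists_isControlled S hfin
  have hδ := hS.pos
  have hcount : ∃ D₀ C h' : ℝ, h' < H ∧ (0 < H →
      volumeEntropy n (ψ.comp (FundamentalGroup.map (inclusionMap h) x₀)) g < H →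
      ∀ D, D₀ ≤ D → ∀ r, 0 ≤ r → CardLE (image2 (· * ·) S.edgeLabels {a | S.Word D a r})
        (C * Real.exp (h' * r))) := by
    by_cases hH : 0 < H ∧ volumeEntropy n (ψ.comp (FundamentalGroup.map (inclusionMap h) x₀)) g < H
    · obtain ⟨hH0, hent⟩ := hH
      obtain ⟨h₁, hh₁, hh₁H⟩ := EReal.lt_iff_exists_real_btwn.1 hent
      -- The count of words needs a nonnegative growth rate.
      have hh₁H' : max h₁ 0 < H := max_lt (by exact_mod_cast hh₁H) hH0
      obtain ⟨h', hh', hh'H⟩ := exists_between hh₁H'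
      have hent' : volumeEntropy n (ψ.comp (FundamentalGroup.map (inclusionMap h) x₀)) g <
          (max h₁ 0 : ℝ) := hh₁.trans_le (by exact_mod_cast le_max_left _ _)
      have hr : ∀ y, ∃ r : Path x₀ y, Reach g r c := fun y => by
        obtain ⟨hv, hseg, -⟩ := exists_frame_eq (p := p) y ⟨pathIncl h (p y)⟩
        exact ⟨_, (hp y hv hseg).1⟩
      obtain ⟨A, hA, hcard⟩ := exists_cardLE_loopClass (vol_pos g hdim.1) (vol_lt_top hfinK g n) hc hr hent'
      have hq : CardLE S.edgeLabels ((CurveSystem.finite_edgeLabels (S := S) hfin).toFinset.card) :=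
        ⟨_, by simp, le_rfl⟩
      have hstep : ∀ v, 0 ≤ v → CardLE {a | ∃ x z, S.step x z a v}
          (A * Real.exp (max h₁ 0 * (2 * c)) * Real.exp (max h₁ 0 * v)) := fun v hv => by
        refine ((hcard (c + v + c) (by positivity)).image (·⁻¹)).mono
          (curveSystem_step_subset (p := p) hc hp) (le_of_eq ?_)
        rw [mul_assoc, ← Real.exp_add]
        ring_nf
      obtain ⟨D₀, hD₀⟩ := CurveSystem.exists_cardLE_word S hq (le_max_right _ _) hh'
        (by positivity) hstep
      refine ⟨D₀, (CurveSystem.finite_edgeLabels (S := S) hfin).toFinset.card *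
        (2 * (A * Real.exp (max h₁ 0 * (2 * c)))), h', hh'H, fun _ _ D hD r hr => ?_⟩
      refine (hq.image2 _ (hD₀ D hD r hr)).mono subset_rfl (le_of_eq ?_)
      exact (mul_assoc _ _ _).symm
    · exact ⟨0, 0, H - 1, by linarith, fun h1 h2 => absurd ⟨h1, h2⟩ hH⟩
  obtain ⟨D₀, C, h', hh'H, hword⟩ := hcount
  set Λ := max (max Λ₀ (R / δ)) (max (D₀ / δ) 1) with hΛ
  have hΛ₀ : Λ₀ ≤ Λ := (le_max_left _ _).trans (le_max_left _ _)
  have hΛR : R ≤ Λ * δ := by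
    rw [← div_le_iff₀ hδ]
    exact (le_max_right _ _).trans (le_max_left _ _)
  have hΛD : D₀ ≤ Λ * δ := by
    rw [← div_le_iff₀ hδ]
    exact (le_max_left _ _).trans (le_max_right _ _)
  have hΛ0 : 0 < Λ := lt_of_lt_of_le one_pos ((le_max_right _ _).trans (le_max_right _ _))
  have hSΛ := hS.mono hΛ₀
  obtain ⟨g', hg1, hg2, hvol⟩ := exists_metric_extension h hfin hdim.2 hL g Λ hε
  refine ⟨g', hvol, ?_, fun hH hent => ?_⟩
  · exact (min_le_min_left _ (ENNReal.ofReal_le_ofReal hΛR)).trans (min_systole_le hSΛ hΛ0 hg1 hg2)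
  · have hV := vol_lt_top hfin g' n
    refine volumeEntropy_le (C := C * (g'.vol n).toReal) hh'H fun r hr => ?_
    refine (vol_ball_le hSΛ hg1 hg2 (mem_of_card_eq hL) (hword hH hent _ hΛD r hr)).trans (le_of_eq ?_)
    rw [← ENNReal.ofReal_toReal hV.ne, ← ENNReal.ofReal_mul (hword hH hent _ hΛD r hr).nonneg,
      ENNReal.toReal_ofReal ENNReal.toReal_nonneg]
    congr 1
    ring

end Pair

end SystolicEntropy

end


noncomputable section

namespace SystolicEntropy

open Geometry (SimplicialComplex)

variable {E : Type*} [NormedAddCommGroup E] [NormedSpace ℝ E]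

/-! ### Restriction of metrics to a subcomplex -/

section Restrict

variable {K L : SimplicialComplex ℝ E} {π : Type*} [Group π]

/-- The piecewise smooth structure of a curve in a subcomplex as a curve in the complex. -/
def SmoothPieces.incl (h : K.faces ⊆ L.faces) {x y : K.space} {γ : Path x y} (P : SmoothPieces γ) :
    SmoothPieces (pathIncl h γ) where
  num := P.num
  time := P.time
  time_zero := P.time_zero
  time_num := P.time_num
  mono := P.mono
  face := P.face
  face_mem i hi := h (P.face_mem i hi)
  maps := P.maps
  smooth := P.smooth

variable (h : K.faces ⊆ L.faces) {x₀ : K.space}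
  (ψ : FundamentalGroup L.space (inclusionMap h x₀) →* π) (g : RiemannianMetric L)

theorem systole_le_restrict :
    systole ψ g ≤ systole (ψ.comp (FundamentalGroup.map (inclusionMap h) x₀)) (g.restrict h) := by
  refine le_iInf fun y => le_iInf fun γ => le_iInf fun hγ => le_iInf fun P => ?_
  have hy : Joined x₀ y := let ⟨p, _⟩ := hγ; ⟨p⟩
  exact iInf_le_of_le (inclusionMap h y) (iInf_le_of_le (pathIncl h γ)
    (iInf_le_of_le ((noncontractible_pathIncl h hy).2 hγ) (iInf_le_of_le (P.incl h) le_rfl)))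

theorem GaloisCover.mk_pathIncl_eq_iff {y : K.space} {p p' : Path x₀ y} :
    mk ψ (pathIncl h p) = mk ψ (pathIncl h p') ↔
      mk (ψ.comp (FundamentalGroup.map (inclusionMap h) x₀)) p =
        mk (ψ.comp (FundamentalGroup.map (inclusionMap h) x₀)) p' := by
  rw [mk_eq_iff, mk_eq_iff, loopClass_comp_map, pathIncl_trans, pathIncl_symm]

theorem GaloisCover.vol_ball_restrict_le {n : ℕ}
    (hn : ∀ s ∈ L.faces, s.card = n + 1 → s ∈ K.faces) (r : ℝ) :
    vol (g.restrict h) n (ball (g.restrict h)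
      (mk (ψ.comp (FundamentalGroup.map (inclusionMap h) x₀)) (Path.refl x₀)) r) ≤
      vol g n (ball g (mk ψ (Path.refl (inclusionMap h x₀))) r) := by
  rw [vol, vol, volIntegral_restrict g h hn]
  -- Both integrals are written over `K`, so that fibres need to be compared only over points of
  -- `K`.
  refine (volIntegral_restrict g h hn _).symm.le.trans
    ((volIntegral_mono _ n fun x hx => ?_).trans (volIntegral_restrict g h hn _).le)
  set φ := ψ.comp (FundamentalGroup.map (inclusionMap h) x₀) with hφ
  have h1 : {a ∈ ball (g.restrict h) (mk φ (Path.refl x₀)) r | (a.1 : E) = x}.encard ≤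
      {a ∈ ball g (mk ψ (Path.refl (inclusionMap h x₀))) r | (a.1 : E) = x}.encard := by
    have hout : ∀ (y : K.space) (Q : Quotient (coverSetoid φ y)), mk φ Q.out = ⟨y, Q⟩ :=
      fun y Q => congrArg (Sigma.mk y) (Quotient.out_eq Q)
    refine encard_le_encard_of_injOn
      (f := fun a : GaloisCover φ => mk ψ (pathIncl h a.2.out)) ?_ ?_
    · rintro a ⟨ha, hax⟩
      obtain ⟨z, γ, P, rfl, hP⟩ := mem_ball_base.1 ha
      exact ⟨mem_ball_base.2 ⟨_, pathIncl h γ, P.incl h,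
        (mk_pathIncl_eq_iff h ψ).2 (hout z _), hP⟩, hax⟩
    · rintro ⟨y, Q⟩ ⟨-, hy⟩ ⟨y', Q'⟩ ⟨-, hy'⟩ heq
      obtain rfl : y = y' := Subtype.ext (hy.trans hy'.symm)
      rw [← hout y Q, ← hout y Q']
      exact (mk_pathIncl_eq_iff h ψ).1 heq
  exact_mod_cast h1

theorem volumeEntropy_restrict_le {n : ℕ} (hn : ∀ s ∈ L.faces, s.card = n + 1 → s ∈ K.faces) :
    volumeEntropy n (ψ.comp (FundamentalGroup.map (inclusionMap h) x₀)) (g.restrict h) ≤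
      volumeEntropy n ψ g := by
  refine limsup_le_limsup ?_
  filter_upwards [eventually_ge_atTop 0] with r hr
  exact EReal.div_le_div_right_of_nonneg (by exact_mod_cast hr)
    (ENNReal.log_monotone (GaloisCover.vol_ball_restrict_le h ψ g hn r))

end Restrict

/-! ### Comparison of the constants -/

section Compare

theorem tendsto_add_one_div (a : ℝ≥0∞) :
    Tendsto (fun k : ℕ => a + ((k : ℝ≥0∞) + 1)⁻¹) atTop (𝓝 a) := by
  have h1 : Tendsto (fun k : ℕ => (((k + 1 : ℕ) : ℝ≥0∞))⁻¹) atTop (𝓝 0) :=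
    ENNReal.tendsto_inv_nat_nhds_zero.comp (tendsto_add_atTop_nat 1)
  have h2 := (tendsto_const_nhds (x := a)).add h1
  rw [add_zero] at h2
  exact_mod_cast h2

variable [FiniteDimensional ℝ E] {K L : SimplicialComplex ℝ E} {π : Type*} [Group π]

theorem systolicConstant_eq
    (h : K.faces ⊆ L.faces) (hfin : L.faces.Finite) (hconn : IsConnected K.space) {n : ℕ}
    (hdim : HasDimension K n) (hL : ∀ s ∈ L.faces, s ∉ K.faces → s.card ≤ n) {x₀ : K.space}
    (ψ : FundamentalGroup L.space (inclusionMap h x₀) →* π) :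
    systolicConstant n ψ =
      systolicConstant n (ψ.comp (FundamentalGroup.map (inclusionMap h) x₀)) := by
  set φ := ψ.comp (FundamentalGroup.map (inclusionMap h) x₀)
  refine le_antisymm (le_iInf fun g => ?_) (le_iInf fun g => ?_)
  · have hV := vol_pos g hdim.1
    have hV' := vol_lt_top (hfin.subset h) g n
    have h1 : Tendsto (fun k : ℕ => min (systole φ g) (k : ℝ≥0∞)) atTop (𝓝 (systole φ g)) := by
      have := (tendsto_const_nhds (x := systole φ g)).min ENNReal.tendsto_nat_nhds_top
      rwa [min_top_right] at this
    have h2 := ENNReal.Tendsto.div (tendsto_add_one_div (g.vol n)) (.inl hV.ne')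
      (((ENNReal.continuous_pow n).tendsto _).comp h1) (.inr hV'.ne)
    refine ge_of_tendsto' h2 fun k => ?_
    obtain ⟨g', hvol, hsys, -⟩ := exists_extension_metric h hfin hconn hdim hL ψ g k 0
      (ε := ((k : ℝ≥0∞) + 1)⁻¹) (by simp)
    rw [ENNReal.ofReal_natCast] at hsys
    refine iInf_le_of_le g' (ENNReal.div_le_div hvol ?_)
    exact pow_le_pow_left' hsys n
  · refine iInf_le_of_le (g.restrict h) ?_
    rw [vol_restrict g h (mem_of_card_eq hL)]
    exact ENNReal.div_le_div_left (pow_le_pow_left' (systole_le_restrict h ψ g) n) _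

theorem minimalVolumeEntropy_eq
    (h : K.faces ⊆ L.faces) (hfin : L.faces.Finite) (hconn : IsConnected K.space) {n : ℕ}
    (hdim : HasDimension K n) (hL : ∀ s ∈ L.faces, s ∉ K.faces → s.card ≤ n) {x₀ : K.space}
    (ψ : FundamentalGroup L.space (inclusionMap h x₀) →* π)
    (hn : n ≠ 0) :
    minimalVolumeEntropy n ψ =
      minimalVolumeEntropy n (ψ.comp (FundamentalGroup.map (inclusionMap h) x₀)) := by
  set φ := ψ.comp (FundamentalGroup.map (inclusionMap h) x₀)
  refine le_antisymm (le_iInf fun g => ?_) (le_iInf fun g => ?_)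
  · have hV := vol_pos g hdim.1
    have hV' := vol_lt_top (hfin.subset h) g n
    have hn0 : 0 ≤ 1 / (n : ℝ) := by positivity
    set e := (volumeEntropy n φ g).toENNReal with he
    -- With infinite entropy the right-hand side is infinite, because the volume is positive.
    by_cases htop : e = ⊤
    · rw [htop, ENNReal.top_mul (ENNReal.rpow_pos hV hV'.ne).ne']
      exact le_top
    have h2 := ENNReal.Tendsto.mul (tendsto_add_one_div e)
      (.inr (ENNReal.rpow_ne_top_of_nonneg hn0 hV'.ne))
      (((ENNReal.continuous_rpow_const (y := 1 / (n : ℝ))).tendsto _).comp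
        (tendsto_add_one_div (g.vol n))) (.inr htop)
    refine ge_of_tendsto' h2 fun k => ?_
    -- The summand makes the target rate positive and strictly larger than the entropy of `g`.
    set d := e + ((k : ℝ≥0∞) + 1)⁻¹ with hd
    have hd0 : e < d := ENNReal.lt_add_right htop (by simp)
    have hd1 : d ≠ ⊤ := ENNReal.add_ne_top.2 ⟨htop, by simp⟩
    have hcoe : ((d.toReal : ℝ) : EReal) = (d : EReal) := by
      rw [EReal.coe_ennreal_toReal hd1]
    obtain ⟨g', hvol, -, hent⟩ := exists_extension_metric h hfin hconn hdim hL ψ g 0 d.toReal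
      (ε := ((k : ℝ≥0∞) + 1)⁻¹) (by simp)
    have h3 : volumeEntropy n ψ g' ≤ d.toReal := by
      refine hent (ENNReal.toReal_pos (ne_bot_of_gt hd0) hd1) ?_
      rw [hcoe]
      refine lt_of_le_of_lt ((le_max_right 0 _).trans_eq EReal.coe_toENNReal_eq_max.symm) ?_
      exact_mod_cast hd0
    refine iInf_le_of_le g' (mul_le_mul' ?_ (ENNReal.rpow_le_rpow hvol hn0))
    rw [hcoe] at h3
    simpa using EReal.toENNReal_le_toENNReal h3
  · refine iInf_le_of_le (g.restrict h) ?_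
    rw [vol_restrict g h (mem_of_card_eq hL)]
    gcongr
    exact EReal.toENNReal_le_toENNReal (volumeEntropy_restrict_le h ψ g (mem_of_card_eq hL))

end Compare

/-! ### Extensions -/

section Extension

variable {b : E} {π : Type*} [Group π]

/-- All attachments are treated at once: the argument needs only the bound on the dimension of the
new simplices and the compatibility of the homomorphisms. -/
theorem IsExtension.exists_le {n : ℕ} {X Y : MarkedComplex b π} (hX : X.cx.faces.Finite)
    (hXY : IsExtension n X Y) :
    Y.cx.faces.Finite ∧ ∃ h : X.cx.faces ⊆ Y.cx.faces,
      (∀ s ∈ Y.cx.faces, s ∉ X.cx.faces → s.card ≤ n) ∧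
      X.hom = Y.hom.comp (FundamentalGroup.map (inclusionMap h) ⟨b, X.base_mem⟩) := by
  induction hXY with
  | refl =>
    refine ⟨hX, subset_rfl, fun s hs hs' => absurd hs hs', ?_⟩
    ext a
    obtain ⟨γ, rfl⟩ := Quotient.exists_rep a
    rfl
  | @tail Y Z _ hYZ ih =>
    obtain ⟨-, h, hcard, hhom⟩ := ih
    obtain ⟨k, -, hkn, hcell, h', hhom'⟩ := hYZ
    refine ⟨hcell.finite, h.trans h', fun s hs hsX => ?_, ?_⟩
    · by_cases hsY : s ∈ Y.cx.faces
      · exact hcard s hsY hsX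
      · exact (hcell.card_le s hs hsY).trans hkn
    · rw [hhom, hhom']
      ext a
      obtain ⟨γ, rfl⟩ := Quotient.exists_rep a
      rfl

end Extension

end SystolicEntropy

end

theorem mainTheorem7 {E : Type*} [NormedAddCommGroup E] [NormedSpace ℝ E] [FiniteDimensional ℝ E]
    {π : Type*} [Group π] (n : ℕ) (b : E) (X X' : SystolicEntropy.MarkedComplex b π)
    (hfin : X.cx.faces.Finite) (hconn : IsConnected X.cx.space)
    (hdim : SystolicEntropy.HasDimension X.cx n)
    (hext : SystolicEntropy.IsExtension n X X') :
    SystolicEntropy.systolicConstant n X'.hom = SystolicEntropy.systolicConstant n X.hom ∧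
      SystolicEntropy.minimalVolumeEntropy n X'.hom =
        SystolicEntropy.minimalVolumeEntropy n X.hom := by
  obtain ⟨hfin', h, hcard, hhom⟩ := hext.exists_le hfin
  -- A first attachment, with `1 ≤ k < n`, excludes `n = 0`.
  rcases Relation.ReflTransGen.cases_head hext with rfl | ⟨_, ⟨k, hk, hkn, -⟩, -⟩
  · exact ⟨rfl, rfl⟩
  · have h1 := SystolicEntropy.systolicConstant_eq h hfin' hconn hdim hcard
      (x₀ := ⟨b, X.base_mem⟩) X'.hom
    have h2 := SystolicEntropy.minimalVolumeEntropy_eq h hfin' hconn hdim hcard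
      (x₀ := ⟨b, X.base_mem⟩) X'.hom (by omega)
    exact ⟨h1.trans (congrArg _ hhom.symm), h2.trans (congrArg _ hhom.symm)⟩
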